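/- Notation and setting. For a square matrix $M$, $\operatorname{He}(M)=M+M^{\mathsf T}$; $M<0$ means that the symmetric matrix $M$ is negative definite; $\bullet$ denotes blocks determined by symmetry; $|\cdot|$ is the Euclidean norm. Consider the plant $$\dot z=Az+B\psi(Sz)+Nw,\qquad y=Cz+\eta,$$ with $z\in\mathbb R^{n_z}$, $y,\eta\in\mathbb R^{n_y}$, $w\in\mathbb R^{n_w}$, where $\psi:\mathbb R^{n_q}\to\mathbb R^{n_s}$ satisfies $|\psi(v_1)-\psi(v_2)|\le \ell|v_1-v_2|$ for some $\ell>0$. The output is available only at times $t_1,t_2,\dots$ with $0\le t_1\le T_2$ and $T_1\le t_{k+1}-t_k\le T_2$ for $k\ge1$, where $0<T_1\le T_2$. For gains $L\in\mathbb R^{n_z\times n_y}$, $H\in\mathbb R^{n_y\times n_y}$ the observer is $$\dot{\hat z}=A\hat z+B\psi(S\hat z)+L\theta,\quad \dot\theta=H\theta\quad(t\ne t_k);\qquad \hat z^+=\hat z,\quad \theta^+=y-C\hat z\quad(t=t_k).$$ Put $\varepsilon=z-\hat z$, $\tilde\theta=C\varepsilon-\theta$, and let $y_p=C_p\varepsilon$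 be the performance output. The closed loop is modelled by the hybrid system $\mathcal H_e$ with state $x=(z,\varepsilon,\tilde\theta,\tau)$ and input $u=(w,\eta)$: $x$ flows while $\tau\in[0,T_2]$, according to the dynamics of $(z,\varepsilon,\tilde\theta)$ induced by the plant and the observer together with $\dot\tau=-1$, and jumps when $\tau=0$ by $z^+=z$, $\varepsilon^+=\varepsilon$, $\tilde\theta^+=-\eta$, $\tau^+\in[T_1,T_2]$. Hybrid inputs are measurable and essentially bounded on bounded time intervals, for each $j$. Let $\mathcal A=\{x:\varepsilon=0,\ \tilde\theta=0,\ \tau\in[0,T_2]\}$ and let $|x|_{\mathcal A}$ be the distance of $x$ to $\mathcal A$. Given $\lambda_t,\gamma>0$, the pair $(L,H)$ is said to solve Problem 1 if the following hold for $\mathcal H_e$. (P1) There is $\kappa>0$ such that every solution $\phi$ with $w\equiv0$, $\eta\equiv0$ satisfies $|\phi(t,j)|_{\mathcal A}\le\kappa e^{-\lambda_t t}|\phi(0,0)|_{\mathcal A}$ for all $(t,j)\in\operatorname{dom}\phi$. (P2) $\mathcal H_e$ is exponentially input-to-state stable with respect to $\mathcal A$: every maximal solution pair is complete, and there are $\kappa,\lambda>0$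 and a class-$\mathcal K$ function $\rho$ such that $|\phi(t,j)|_{\mathcal A}\le\max\{\kappa e^{-\lambda(t+j)}|\phi(0,0)|_{\mathcal A},\rho(\|u\|_\infty)\}$ for every solution pair $(\phi,u)$ with $\|u\|_\infty<\infty$ and all $(t,j)\in\operatorname{dom}\phi$. Here $\|u\|_\infty$ is the maximum of the essential supremum of $|u|$ off the jump times and its supremum over the jump times. (P3) There is $\alpha>0$ such that every solution pair with $\eta\equiv0$ satisfies $$\Big(\int_{\mathcal I}|y_p(s,j(s))|^2ds\Big)^{1/2}\le\alpha|\phi(0,0)|_{\mathcal A}+\gamma\Big(\int_{\mathcal I}|w(s,j(s))|^2ds\Big)^{1/2},$$ where $\mathcal I$ is the set of ordinary times $s$ in the domain of $\phi$ and $j(s)$ is the least $j$ with $(s,j)\in\operatorname{dom}\phi$. Moreover, the corresponding three properties are required of the plant interconnected with the observer on $[0,\infty)$, with constants uniform over all admissible sequences $(t_k)$: for $w\equiv0,\eta\equiv0$, $|(\varepsilon,\tilde\theta)(t)|\le\kappa e^{-\lambda_t t}|(\varepsilon,\tilde\theta)(0)|$; if $|w|\le W$ almost everywhere and $|\eta(t_k)|\le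 W$ for all $k\ge1$, then $|(\varepsilon,\tilde\theta)(t)|\le\max\{\kappa|(\varepsilon,\tilde\theta)(0)|,\rho(W)\}$ with $\rho$ of class $\mathcal K$; and for $\eta\equiv0$, $\|y_p\|_{\mathcal L_2}\le\alpha|(\varepsilon,\tilde\theta)(0)|+\gamma\|w\|_{\mathcal L_2}$. Proposition. Let $\lambda_t,\gamma>0$. Suppose there are symmetric positive definite matrices $P_1\in\mathbb R^{n_z\times n_z}$, $P_2\in\mathbb R^{n_y\times n_y}$, real numbers $\delta,\chi>0$, a nonsingular $X\in\mathbb R^{n_z\times n_z}$, and matrices $X_5,Y_5,X_7,Y_7\in\mathbb R^{n_y\times n_z}$, $X_6,Y_6,X_8,Y_8\in\mathbb R^{n_y\times n_y}$, $J\in\mathbb R^{n_z\times n_y}$ such that $$\begin{pmatrix}\operatorname{He}(Q_1)&Q_2+\mathcal P&Q_3&Q_4\\ \bullet&\mathcal N+\operatorname{He}(Q_5)&Q_3&Q_4\\ \bullet&\bullet&-\gamma^2I&0\\ \bullet&\bullet&\bullet&-\chi I\end{pmatrix}<0,\qquad \begin{pmatrix}\operatorname{He}(\widehat Q_1)&\widehat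 Q_2+\mathcal P_{T_2}&Q_3&Q_4\\ \bullet&\mathcal N_{T_2}+\operatorname{He}(Q_5)&Q_3&Q_4\\ \bullet&\bullet&-\gamma^2I&0\\ \bullet&\bullet&\bullet&-\chi I\end{pmatrix}<0,$$ where $$\mathcal P=\operatorname{diag}\{P_1,P_2\},\qquad \mathcal P_{T_2}=\operatorname{diag}\{P_1,e^{\delta T_2}P_2\},$$ $$\mathcal N=\operatorname{diag}\{2\lambda_tP_1+C_p^{\mathsf T}C_p+\chi\ell^2S^{\mathsf T}S,\ (2\lambda_t-\delta)P_2\},\qquad \mathcal N_{T_2}=\operatorname{diag}\{2\lambda_tP_1+C_p^{\mathsf T}C_p+\chi\ell^2S^{\mathsf T}S,\ (2\lambda_t-\delta)e^{\delta T_2}P_2\},$$ $$Q_1=\begin{pmatrix}-X+C^{\mathsf T}X_5&C^{\mathsf T}X_6\\-X_5&-X_6\end{pmatrix},\quad Q_2=\begin{pmatrix}-X+X^{\mathsf T}A-JC+C^{\mathsf T}X_7&J+C^{\mathsf T}X_8\\-X_7&-X_8\end{pmatrix},$$ $$Q_3=\begin{pmatrix}X^{\mathsf T}N\\0\end{pmatrix},\quad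 Q_4=\begin{pmatrix}X^{\mathsf T}B\\0\end{pmatrix},\quad Q_5=\begin{pmatrix}A^{\mathsf T}X-C^{\mathsf T}J^{\mathsf T}&0\\J^{\mathsf T}&0\end{pmatrix},$$ and $\widehat Q_1,\widehat Q_2$ are $Q_1,Q_2$ with $X_5,X_6,X_7,X_8$ replaced by $Y_5,Y_6,Y_7,Y_8$. Then $L=X^{-\mathsf T}J$ and $H=0$ solve Problem 1. -/

import Mathlib

open MeasureTheory Set Filter Topology
open scoped ENNReal Matrix

noncomputable section

namespace SporadicObserver

/-! ### Euclidean vectors -/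

/-- `ℝⁿ` with the Euclidean norm. -/
abbrev Vec (n : ℕ) := EuclideanSpace ℝ (Fin n)

/-- The matrix-vector product on Euclidean spaces. -/
def mv {ι κ : Type*} [Fintype κ] (M : Matrix ι κ ℝ) (x : EuclideanSpace ℝ κ) :
    EuclideanSpace ℝ ι :=
  WithLp.toLp 2 (M *ᵥ x.ofLp)

/-- The stacked vector `(x, y)`. -/
def stack {ι κ : Type*} (x : EuclideanSpace ℝ ι) (y : EuclideanSpace ℝ κ) :
    EuclideanSpace ℝ (ι ⊕ κ) :=
  WithLp.toLp 2 (Sum.elim x.ofLp y.ofLp)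

/-- The upper part of a stacked vector. -/
def upper {ι κ : Type*} (x : EuclideanSpace ℝ (ι ⊕ κ)) : EuclideanSpace ℝ ι :=
  WithLp.toLp 2 (fun i => x (Sum.inl i))

/-- The lower part of a stacked vector. -/
def lower {ι κ : Type*} (x : EuclideanSpace ℝ (ι ⊕ κ)) : EuclideanSpace ℝ κ :=
  WithLp.toLp 2 (fun i => x (Sum.inr i))

/-- Local absolute continuity on a set of times (in use: on an interval): absolute continuity on
every compact subinterval. -/
def LocallyAC {X : Type*} [PseudoMetricSpace X] (g : ℝ → X) (I : Set ℝ) : Prop :=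
  ∀ a b : ℝ, a ≤ b → Icc a b ⊆ I → AbsolutelyContinuousOnInterval g a b

/-- Class `𝒦` functions. -/
def IsClassK (ρ : ℝ → ℝ) : Prop :=
  ContinuousOn ρ (Ici 0) ∧ StrictMonoOn ρ (Ici 0) ∧ ρ 0 = 0

/-! ### Hybrid time domains and hybrid signals

A hybrid signal is a total function `ℝ → ℕ → X` together with a hybrid time domain; only its
values on the domain matter. -/

/-- Hybrid time domains: a finite or infinite union of intervals `[t j, t (j+1)] × {j}` with
`0 = t 0 ≤ t 1 ≤ ⋯`, the last interval, if there is one, being closed, or of the form `[t J, T)`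
with `T` finite or infinite. -/
def IsHybridTimeDomain (E : Set (ℝ × ℕ)) : Prop :=
  ∃ t : ℕ → ℝ, t 0 = 0 ∧ Monotone t ∧
    (E = {p | p.1 ∈ Icc (t p.2) (t (p.2 + 1))} ∨
      ∃ (J : ℕ) (I : Set ℝ),
        (I = Icc (t J) (t (J + 1)) ∨ (t J < t (J + 1) ∧ I = Ico (t J) (t (J + 1))) ∨
          I = Ici (t J)) ∧
        E = {p | (p.2 < J ∧ p.1 ∈ Icc (t p.2) (t (p.2 + 1))) ∨ (p.2 = J ∧ p.1 ∈ I)})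

/-- The interval of ordinary times `t` with `(t, j) ∈ E`. -/
def slice (E : Set (ℝ × ℕ)) (j : ℕ) : Set ℝ := {t | (t, j) ∈ E}

/-- The times just before a jump: `(t, j) ∈ E` such that `(t, j + 1) ∈ E`. -/
def jumpTimes (E : Set (ℝ × ℕ)) : Set (ℝ × ℕ) := {p | p ∈ E ∧ (p.1, p.2 + 1) ∈ E}

/-- The projection of a hybrid time domain on ordinary time. -/
def timeProj (E : Set (ℝ × ℕ)) : Set ℝ := {t | ∃ j : ℕ, (t, j) ∈ E}

/-- `j(t)`, the least `j` with `(t, j) ∈ E`. -/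
def firstIndex (E : Set (ℝ × ℕ)) (t : ℝ) : ℕ := sInf {j | (t, j) ∈ E}

/-- Hybrid inputs: measurable, and essentially bounded on bounded time intervals, for each `j`. -/
def IsHybridInput {m : Type*} [Fintype m] (E : Set (ℝ × ℕ)) (u : ℝ → ℕ → EuclideanSpace ℝ m) :
    Prop :=
  ∀ j : ℕ, AEMeasurable (fun t => u t j) (volume.restrict (slice E j)) ∧
    ∀ T : ℝ, ∃ M : ℝ, ∀ᵐ t ∂(volume : Measure ℝ), t ∈ slice E j → t ≤ T → ‖u t j‖ ≤ M

/-- The `ℒ_∞` norm of a hybrid signal with domain `E`: the maximum of the essential supremum off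
the jump times and of the supremum over the jump times. -/
def hybridSupNorm {m : Type*} [Fintype m] (E : Set (ℝ × ℕ)) (u : ℝ → ℕ → EuclideanSpace ℝ m) :
    ℝ≥0∞ :=
  max (⨆ j : ℕ, essSup (fun t => ‖u t j‖ₑ) (volume.restrict (slice (E \ jumpTimes E) j)))
    (⨆ p ∈ jumpTimes E, ‖u p.1 p.2‖ₑ)

/-! ### Hybrid systems with inputs -/

/-- The data of a hybrid system `ẋ = f(x, u)` for `x ∈ C`, `x⁺ ∈ G(x, u)` for `x ∈ D`. -/
structure HybridSystem (n m : Type*) where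
  /-- the flow map -/
  f : EuclideanSpace ℝ n → EuclideanSpace ℝ m → EuclideanSpace ℝ n
  /-- the flow set -/
  C : Set (EuclideanSpace ℝ n)
  /-- the jump map -/
  G : EuclideanSpace ℝ n → EuclideanSpace ℝ m → Set (EuclideanSpace ℝ n)
  /-- the jump set -/
  D : Set (EuclideanSpace ℝ n)

namespace HybridSystem

variable {n m : Type*} [Fintype n] [Fintype m]

/-- `(φ, u)` is a solution pair with hybrid time domain `E`. -/
structure IsSolutionPair (𝓗 : HybridSystem n m) (E : Set (ℝ × ℕ))
    (φ : ℝ → ℕ → EuclideanSpace ℝ n) (u : ℝ → ℕ → EuclideanSpace ℝ m) : Prop where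
  domain : IsHybridTimeDomain E
  input : IsHybridInput E u
  arc : ∀ j : ℕ, LocallyAC (fun t => φ t j) (slice E j)
  initial : φ 0 0 ∈ 𝓗.C ∪ 𝓗.D
  flow_mem : ∀ j : ℕ, ∀ t ∈ interior (slice E j), φ t j ∈ 𝓗.C
  flow : ∀ j : ℕ, ∀ᵐ t ∂(volume : Measure ℝ), t ∈ interior (slice E j) →
    HasDerivAt (fun s => φ s j) (𝓗.f (φ t j) (u t j)) t
  jump : ∀ (t : ℝ) (j : ℕ), (t, j) ∈ E → (t, j + 1) ∈ E →
    φ t j ∈ 𝓗.D ∧ φ t (j + 1) ∈ 𝓗.G (φ t j) (u t j)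

/-- A solution pair is maximal if it has no extension to a strictly larger domain. -/
def IsMaximal (𝓗 : HybridSystem n m) (E : Set (ℝ × ℕ))
    (φ : ℝ → ℕ → EuclideanSpace ℝ n) (u : ℝ → ℕ → EuclideanSpace ℝ m) : Prop :=
  𝓗.IsSolutionPair E φ u ∧
    ¬ ∃ (E' : Set (ℝ × ℕ)) (φ' : ℝ → ℕ → EuclideanSpace ℝ n) (u' : ℝ → ℕ → EuclideanSpace ℝ m),
      𝓗.IsSolutionPair E' φ' u' ∧ E ⊂ E' ∧
        ∀ p ∈ E, φ' p.1 p.2 = φ p.1 p.2 ∧ u' p.1 p.2 = u p.1 p.2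

/-- A hybrid time domain is that of a complete solution if it is unbounded. -/
def IsCompleteDomain (E : Set (ℝ × ℕ)) : Prop :=
  ∀ R : ℝ, ∃ p ∈ E, R ≤ p.1 + (p.2 : ℝ)

/-- Exponential input-to-state stability with respect to a set `𝓐`. -/
def IsEISS (𝓗 : HybridSystem n m) (𝓐 : Set (EuclideanSpace ℝ n)) : Prop :=
  (∃ (κ lam : ℝ) (ρ : ℝ → ℝ), 0 < κ ∧ 0 < lam ∧ IsClassK ρ ∧
    ∀ (E : Set (ℝ × ℕ)) (φ : ℝ → ℕ → EuclideanSpace ℝ n) (u : ℝ → ℕ → EuclideanSpace ℝ m),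
      𝓗.IsSolutionPair E φ u → hybridSupNorm E u ≠ ∞ →
        ∀ (t : ℝ) (j : ℕ), (t, j) ∈ E →
          Metric.infDist (φ t j) 𝓐 ≤
            max (κ * Real.exp (-lam * (t + j)) * Metric.infDist (φ 0 0) 𝓐)
              (ρ (hybridSupNorm E u).toReal)) ∧
  ∀ (E : Set (ℝ × ℕ)) (φ : ℝ → ℕ → EuclideanSpace ℝ n) (u : ℝ → ℕ → EuclideanSpace ℝ m),
    𝓗.IsMaximal E φ u → IsCompleteDomain E

end HybridSystem

/-! ### The plant, the observer and the error system -/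

/-- The plant `ż = A z + B ψ(S z) + N w`, `y = C z + η`, and the performance output matrix. -/
structure Plant (nz ny nw nq ns np : ℕ) where
  A : Matrix (Fin nz) (Fin nz) ℝ
  B : Matrix (Fin nz) (Fin ns) ℝ
  C : Matrix (Fin ny) (Fin nz) ℝ
  S : Matrix (Fin nq) (Fin nz) ℝ
  N : Matrix (Fin nz) (Fin nw) ℝ
  Cp : Matrix (Fin np) (Fin nz) ℝ
  ψ : Vec nq → Vec ns

/-- `He(M) = M + Mᵀ`. -/
def He {ι : Type*} (M : Matrix ι ι ℝ) : Matrix ι ι ℝ := M + Mᵀ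

/-- Index type of the error vector `(ε, θ̃)`. -/
abbrev ErrIx (nz ny : ℕ) := Fin nz ⊕ Fin ny

/-- Index type of the state `x = (z, (ε, θ̃), τ)`. -/
abbrev StateIx (nz ny : ℕ) := Fin nz ⊕ (ErrIx nz ny ⊕ Unit)

/-- The state `x = (z, e, τ)` with `e = (ε, θ̃)`. -/
def mkState {nz ny : ℕ} (z : Vec nz) (e : EuclideanSpace ℝ (ErrIx nz ny)) (τ : ℝ) :
    EuclideanSpace ℝ (StateIx nz ny) :=
  stack z (stack e (WithLp.toLp 2 (fun _ : Unit => τ)))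

/-- The plant state `z` in `x`. -/
def stZ {nz ny : ℕ} (x : EuclideanSpace ℝ (StateIx nz ny)) : Vec nz := upper x

/-- The error vector `(ε, θ̃)` in `x`. -/
def stE {nz ny : ℕ} (x : EuclideanSpace ℝ (StateIx nz ny)) : EuclideanSpace ℝ (ErrIx nz ny) :=
  upper (lower x)

/-- The timer `τ` in `x`. -/
def stτ {nz ny : ℕ} (x : EuclideanSpace ℝ (StateIx nz ny)) : ℝ := lower (lower x) ()

namespace Plant

variable {nz ny nw nq ns np : ℕ}

/-- `𝓕`. -/
def matF (P : Plant nz ny nw nq ns np) (L : Matrix (Fin nz) (Fin ny) ℝ)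
    (H : Matrix (Fin ny) (Fin ny) ℝ) : Matrix (ErrIx nz ny) (ErrIx nz ny) ℝ :=
  Matrix.fromBlocks (P.A - L * P.C) L (P.C * P.A - P.C * L * P.C - H * P.C) (P.C * L + H)

/-- `𝓣`. -/
def matT (P : Plant nz ny nw nq ns np) : Matrix (ErrIx nz ny) (Fin nw) ℝ :=
  Matrix.fromRows P.N (P.C * P.N)

/-- `𝓠`. -/
def matQ (P : Plant nz ny nw nq ns np) : Matrix (ErrIx nz ny) (Fin ns) ℝ :=
  Matrix.fromRows P.B (P.C * P.B)

/-- `ζ(v₁, v₂) = ψ(S v₁) - ψ(S (v₁ - v₂))`. -/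
def zeta (P : Plant nz ny nw nq ns np) (v₁ v₂ : Vec nz) : Vec ns :=
  P.ψ (mv P.S v₁) - P.ψ (mv P.S (v₁ - v₂))

/-- The hybrid system `𝓗ₑ` with state `(z, ε, θ̃, τ)` and input `u = (w, η)`, in which the timer
`τ` decreases along flows and is reset to an arbitrary point of `[T₁, T₂]` at jumps. -/
def errorSystem (P : Plant nz ny nw nq ns np) (T₁ T₂ : ℝ) (L : Matrix (Fin nz) (Fin ny) ℝ)
    (H : Matrix (Fin ny) (Fin ny) ℝ) : HybridSystem (StateIx nz ny) (Fin nw ⊕ Fin ny) where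
  f x u := mkState
    (mv P.A (stZ x) + mv P.B (P.ψ (mv P.S (stZ x))) + mv P.N (upper u))
    (mv (P.matF L H) (stE x) + mv P.matQ (P.zeta (stZ x) (upper (stE x)))
      + mv P.matT (upper u))
    (-1)
  C := {x | stτ x ∈ Icc 0 T₂}
  G x u := {x' | ∃ v ∈ Icc T₁ T₂, x' = mkState (stZ x)
    (mv (Matrix.fromBlocks 1 0 0 0 : Matrix (ErrIx nz ny) (ErrIx nz ny) ℝ) (stE x)
      + mv (Matrix.fromRows 0 (-1) : Matrix (ErrIx nz ny) (Fin ny) ℝ) (lower u)) v}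
  D := {x | stτ x = 0}

end Plant

/-- The set `𝓐` of states with `ε = 0`, `θ̃ = 0` and `τ ∈ [0, T₂]`. -/
def attractor (nz ny : ℕ) (T₂ : ℝ) : Set (EuclideanSpace ℝ (StateIx nz ny)) :=
  {x | upper (stE x) = 0 ∧ lower (stE x) = 0 ∧ stτ x ∈ Icc 0 T₂}

/-! ### The plant interconnected with the observer, for a given sequence of sampling times -/

/-- `t 1, t 2, …` is an admissible sequence of sampling times (`t 0 = 0` is the initial time,
not a sampling time); since `0 < T₁` in use, it is strictly increasing and unbounded. -/
def IsSamplingSequence (T₁ T₂ : ℝ) (t : ℕ → ℝ) : Prop :=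
  t 0 = 0 ∧ t 1 ∈ Icc 0 T₂ ∧ ∀ k : ℕ, 1 ≤ k → t (k + 1) - t k ∈ Icc T₁ T₂

/-- `(z, ẑ, θ)` is a trajectory on `[0, ∞)` of the plant with inputs `w, η` interconnected with
the observer
`ẑ' = A ẑ + B ψ(S ẑ) + L θ`, `θ' = H θ` between samples,
`ẑ⁺ = ẑ`, `θ⁺ = y - C ẑ = C z + η - C ẑ` at the sampling times `t 1, t 2, …`.
The function `θ` is left-continuous and `θ⁺` is its right limit. -/
structure IsTrajectory {nz ny nw nq ns np : ℕ} (P : Plant nz ny nw nq ns np)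
    (L : Matrix (Fin nz) (Fin ny) ℝ) (H : Matrix (Fin ny) (Fin ny) ℝ) (t : ℕ → ℝ)
    (w : ℝ → Vec nw) (η : ℝ → Vec ny) (z zhat : ℝ → Vec nz) (θ : ℝ → Vec ny) : Prop where
  w_meas : AEMeasurable w (volume.restrict (Ici 0))
  w_bdd : ∀ T : ℝ, ∃ M : ℝ, ∀ᵐ s ∂(volume : Measure ℝ), s ∈ Icc 0 T → ‖w s‖ ≤ M
  z_ac : LocallyAC z (Ici 0)
  zhat_ac : LocallyAC zhat (Ici 0)
  z_flow : ∀ᵐ s ∂(volume : Measure ℝ), 0 < s →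
    HasDerivAt z (mv P.A (z s) + mv P.B (P.ψ (mv P.S (z s))) + mv P.N (w s)) s
  zhat_flow : ∀ᵐ s ∂(volume : Measure ℝ), 0 < s →
    HasDerivAt zhat (mv P.A (zhat s) + mv P.B (P.ψ (mv P.S (zhat s))) + mv L (θ s)) s
  θ_init : ContinuousOn θ (Icc 0 (t 1))
  θ_cont : ∀ k : ℕ, 1 ≤ k → ContinuousOn θ (Ioc (t k) (t (k + 1)))
  θ_flow : ∀ k : ℕ, ∀ s ∈ Ioo (t k) (t (k + 1)), HasDerivAt θ (mv H (θ s)) s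
  θ_jump : ∀ k : ℕ, 1 ≤ k → Tendsto θ (𝓝[>] (t k))
    (𝓝 (mv P.C (z (t k)) + η (t k) - mv P.C (zhat (t k))))

/-- `|(ε, θ̃)|` with `ε = z - ẑ` and `θ̃ = C (z - ẑ) - θ`: the size of the error at one time. -/
def errNorm {nz ny nw nq ns np : ℕ} (P : Plant nz ny nw nq ns np) (z zhat : Vec nz)
    (θ : Vec ny) : ℝ :=
  ‖stack (z - zhat) (mv P.C (z - zhat) - θ)‖

/-! ### The design problem -/

/-- The gains `L` and `H` solve the observer design problem with convergence rate `lamt` and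
`ℒ₂`-gain `γ`, both for the hybrid model `𝓗ₑ` of the closed loop and for the plant interconnected
with the observer along every admissible sequence of sampling times. -/
structure SolvesProblem {nz ny nw nq ns np : ℕ} (P : Plant nz ny nw nq ns np)
    (T₁ T₂ lamt γ : ℝ) (L : Matrix (Fin nz) (Fin ny) ℝ) (H : Matrix (Fin ny) (Fin ny) ℝ) :
    Prop where
  /-- `𝓗ₑ` is exponentially input-to-state stable with respect to `𝓐`. -/
  eiss : (P.errorSystem T₁ T₂ L H).IsEISS (attractor nz ny T₂)
  /-- With zero inputs, `𝓐` is globally exponentially stable with rate `lamt` in ordinary time. -/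
  rate : ∃ κ : ℝ, 0 < κ ∧
    ∀ (E : Set (ℝ × ℕ)) (φ : ℝ → ℕ → EuclideanSpace ℝ (StateIx nz ny))
      (u : ℝ → ℕ → EuclideanSpace ℝ (Fin nw ⊕ Fin ny)),
      (P.errorSystem T₁ T₂ L H).IsSolutionPair E φ u → (∀ p ∈ E, u p.1 p.2 = 0) →
        ∀ (t : ℝ) (j : ℕ), (t, j) ∈ E →
          Metric.infDist (φ t j) (attractor nz ny T₂) ≤
            κ * Real.exp (-lamt * t) * Metric.infDist (φ 0 0) (attractor nz ny T₂)
  /-- With `η ≡ 0`, the `ℒ₂`-gain from `w` to `C_p ε` is at most `γ`. -/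
  gain : ∃ α : ℝ, 0 < α ∧
    ∀ (E : Set (ℝ × ℕ)) (φ : ℝ → ℕ → EuclideanSpace ℝ (StateIx nz ny))
      (u : ℝ → ℕ → EuclideanSpace ℝ (Fin nw ⊕ Fin ny)),
      (P.errorSystem T₁ T₂ L H).IsSolutionPair E φ u → (∀ p ∈ E, lower (u p.1 p.2) = 0) →
        (∫⁻ s in timeProj E, ‖mv P.Cp (upper (stE (φ s (firstIndex E s))))‖ₑ ^ 2) ^ (1 / 2 : ℝ) ≤
          ENNReal.ofReal (α * Metric.infDist (φ 0 0) (attractor nz ny T₂)) +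
            ENNReal.ofReal γ *
              (∫⁻ s in timeProj E, ‖upper (u s (firstIndex E s))‖ₑ ^ 2) ^ (1 / 2 : ℝ)
  /-- Exponential convergence of the estimate with rate `lamt` for zero inputs. -/
  sampled_rate : ∃ κ : ℝ, 0 < κ ∧
    ∀ (t : ℕ → ℝ) (w : ℝ → Vec nw) (η : ℝ → Vec ny) (z zhat : ℝ → Vec nz) (θ : ℝ → Vec ny),
      IsSamplingSequence T₁ T₂ t → IsTrajectory P L H t w η z zhat θ →
      (∀ s : ℝ, 0 ≤ s → w s = 0) → (∀ s : ℝ, 0 ≤ s → η s = 0) →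
        ∀ s : ℝ, 0 ≤ s → errNorm P (z s) (zhat s) (θ s) ≤
          κ * Real.exp (-lamt * s) * errNorm P (z 0) (zhat 0) (θ 0)
  /-- Boundedness of the error for bounded inputs. -/
  sampled_bounded : ∃ (κ : ℝ) (ρ : ℝ → ℝ), 0 < κ ∧ IsClassK ρ ∧
    ∀ (t : ℕ → ℝ) (w : ℝ → Vec nw) (η : ℝ → Vec ny) (z zhat : ℝ → Vec nz) (θ : ℝ → Vec ny),
      IsSamplingSequence T₁ T₂ t → IsTrajectory P L H t w η z zhat θ →
      ∀ W : ℝ, 0 ≤ W → (∀ᵐ s ∂(volume : Measure ℝ), 0 ≤ s → ‖w s‖ ≤ W) →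
        (∀ k : ℕ, 1 ≤ k → ‖η (t k)‖ ≤ W) →
        ∀ s : ℝ, 0 ≤ s → errNorm P (z s) (zhat s) (θ s) ≤
          max (κ * errNorm P (z 0) (zhat 0) (θ 0)) (ρ W)
  /-- `ℒ₂`-external stability from `w` to `C_p (z - ẑ)` with gain at most `γ` when `η ≡ 0`. -/
  sampled_gain : ∃ α : ℝ, 0 < α ∧
    ∀ (t : ℕ → ℝ) (w : ℝ → Vec nw) (η : ℝ → Vec ny) (z zhat : ℝ → Vec nz) (θ : ℝ → Vec ny),
      IsSamplingSequence T₁ T₂ t → IsTrajectory P L H t w η z zhat θ →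
      (∀ s : ℝ, 0 ≤ s → η s = 0) →
        (∫⁻ s in Ici (0 : ℝ), ‖mv P.Cp (z s - zhat s)‖ₑ ^ 2) ^ (1 / 2 : ℝ) ≤
          ENNReal.ofReal (α * errNorm P (z 0) (zhat 0) (θ 0)) +
            ENNReal.ofReal γ * (∫⁻ s in Ici (0 : ℝ), ‖w s‖ₑ ^ 2) ^ (1 / 2 : ℝ)

/-! ### The matrix inequalities -/

section LMI

variable {nz ny nw nq ns np : ℕ}

/-- The symmetric `4 × 4` block matrix with upper triangle
`M₁₁ M₁₂ M₁₃ M₁₄`, `M₂₂ M₂₃ M₂₄`, `-γ² I, 0`, `-χ I`. -/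
def lmiBlock {ι : Type*} (γ χ : ℝ) (M₁₁ M₁₂ M₂₂ : Matrix ι ι ℝ)
    (M₁₃ M₂₃ : Matrix ι (Fin nw) ℝ) (M₁₄ M₂₄ : Matrix ι (Fin ns) ℝ) :
    Matrix ((ι ⊕ ι) ⊕ (Fin nw ⊕ Fin ns)) ((ι ⊕ ι) ⊕ (Fin nw ⊕ Fin ns)) ℝ :=
  Matrix.fromBlocks
    (Matrix.fromBlocks M₁₁ M₁₂ M₁₂ᵀ M₂₂)
    (Matrix.fromBlocks M₁₃ M₁₄ M₂₃ M₂₄)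
    (Matrix.fromBlocks M₁₃ M₁₄ M₂₃ M₂₄)ᵀ
    (Matrix.fromBlocks (-(γ ^ 2) • (1 : Matrix (Fin nw) (Fin nw) ℝ)) 0 0
      (-χ • (1 : Matrix (Fin ns) (Fin ns) ℝ)))

/-- `𝓟_τ = diag(P₁, e^{δτ} P₂)`, in use for `τ = 0` (where it is `𝓟`) and `τ = T₂`. -/
def lmiP (P₁ : Matrix (Fin nz) (Fin nz) ℝ) (P₂ : Matrix (Fin ny) (Fin ny) ℝ) (δ τ : ℝ) :
    Matrix (ErrIx nz ny) (ErrIx nz ny) ℝ :=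
  Matrix.fromBlocks P₁ 0 0 (Real.exp (δ * τ) • P₂)

/-- `𝓝_τ = diag(2 λ_t P₁ + C_pᵀ C_p + χ ℓ² Sᵀ S, (-δ + 2 λ_t) e^{δτ} P₂)`, in use for `τ = 0`
(where it is `𝓝`) and `τ = T₂`. -/
def lmiN (P : Plant nz ny nw nq ns np) (ℓ lamt : ℝ) (P₁ : Matrix (Fin nz) (Fin nz) ℝ)
    (P₂ : Matrix (Fin ny) (Fin ny) ℝ) (δ χ τ : ℝ) :
    Matrix (ErrIx nz ny) (ErrIx nz ny) ℝ :=
  Matrix.fromBlocks ((2 * lamt) • P₁ + P.Cpᵀ * P.Cp + (χ * ℓ ^ 2) • (P.Sᵀ * P.S)) 0 0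
    (((-δ + 2 * lamt) * Real.exp (δ * τ)) • P₂)

/-- `Q₁`, for the slack blocks `X₅, X₆`. -/
def lmiQ1 (P : Plant nz ny nw nq ns np) (X : Matrix (Fin nz) (Fin nz) ℝ)
    (X₅ : Matrix (Fin ny) (Fin nz) ℝ) (X₆ : Matrix (Fin ny) (Fin ny) ℝ) :
    Matrix (ErrIx nz ny) (ErrIx nz ny) ℝ :=
  Matrix.fromBlocks (-X + P.Cᵀ * X₅) (P.Cᵀ * X₆) (-X₅) (-X₆)

/-- `Q₂`, for the slack blocks `X₇, X₈`. -/
def lmiQ2 (P : Plant nz ny nw nq ns np) (X : Matrix (Fin nz) (Fin nz) ℝ)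
    (J : Matrix (Fin nz) (Fin ny) ℝ)
    (X₇ : Matrix (Fin ny) (Fin nz) ℝ) (X₈ : Matrix (Fin ny) (Fin ny) ℝ) :
    Matrix (ErrIx nz ny) (ErrIx nz ny) ℝ :=
  Matrix.fromBlocks (-X + Xᵀ * P.A - J * P.C + P.Cᵀ * X₇) (J + P.Cᵀ * X₈) (-X₇) (-X₈)

/-- `Q₅`. -/
def lmiQ5 (P : Plant nz ny nw nq ns np) (X : Matrix (Fin nz) (Fin nz) ℝ)
    (J : Matrix (Fin nz) (Fin ny) ℝ) : Matrix (ErrIx nz ny) (ErrIx nz ny) ℝ :=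
  Matrix.fromBlocks (P.Aᵀ * X - P.Cᵀ * Jᵀ) 0 Jᵀ 0

/-- The left-hand side of the matrix inequality at `τ` (in use for `τ = 0` and `τ = T₂`), with
slack blocks `X₅, X₆, X₇, X₈`. -/
def lmiZOH (P : Plant nz ny nw nq ns np) (ℓ lamt γ : ℝ) (P₁ : Matrix (Fin nz) (Fin nz) ℝ)
    (P₂ : Matrix (Fin ny) (Fin ny) ℝ) (δ χ : ℝ) (X : Matrix (Fin nz) (Fin nz) ℝ)
    (J : Matrix (Fin nz) (Fin ny) ℝ)
    (X₅ : Matrix (Fin ny) (Fin nz) ℝ) (X₆ : Matrix (Fin ny) (Fin ny) ℝ)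
    (X₇ : Matrix (Fin ny) (Fin nz) ℝ) (X₈ : Matrix (Fin ny) (Fin ny) ℝ) (τ : ℝ) :
    Matrix ((ErrIx nz ny ⊕ ErrIx nz ny) ⊕ (Fin nw ⊕ Fin ns))
      ((ErrIx nz ny ⊕ ErrIx nz ny) ⊕ (Fin nw ⊕ Fin ns)) ℝ :=
  lmiBlock γ χ
    (He (lmiQ1 P X X₅ X₆))
    (lmiQ2 P X J X₇ X₈ + lmiP P₁ P₂ δ τ)
    (lmiN P ℓ lamt P₁ P₂ δ χ τ + He (lmiQ5 P X J))
    (Matrix.fromRows (Xᵀ * P.N) 0) (Matrix.fromRows (Xᵀ * P.N) 0)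
    (Matrix.fromRows (Xᵀ * P.B) 0) (Matrix.fromRows (Xᵀ * P.B) 0)

/-- `M < 0` for a symmetric matrix `M`. -/
def NegDef {ι : Type*} (M : Matrix ι ι ℝ) : Prop := (-M).PosDef

end LMI

end SporadicObserver

end

/-!
In the error variables the observer with `H = 0` has the Lyapunov function
`V = εᵀ P₁ ε + exp (δ τ) θ̃ᵀ P₂ θ̃`. Evaluate the matrix inequality at the vector made of the error
velocity, the error, the disturbance and the increment of `ψ`: the terms in `X` and the slack
matrices multiply the error dynamics, so they vanish, and what remains is
`V̇ + 2 λ_t V + |C_p ε|² ≤ γ² |w|²`. This inequality is affine in `exp (δ τ)`, so the two endpoints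
`τ = 0` and `τ = T₂` give it on the whole flow set.

At a jump `V` grows by at most a multiple of `|η|²`, and successive jumps are at least `T₁` apart,
so the accumulated increments are bounded by a geometric series. Integrating along flows then gives
the decay rate, the input-to-state bound and the gain. Maximal solutions are complete because the
error system is globally Lipschitz, and a trajectory of the plant and the observer is a solution of
`𝓗ₑ`.
-/

noncomputable section

namespace SporadicObserver

section LinearAlgebra

variable {ι κ : Type*}

@[simp] lemma upper_stack (x : EuclideanSpace ℝ ι) (y : EuclideanSpace ℝ κ) :
    upper (stack x y) = x := rfl

@[simp] lemma lower_stack (x : EuclideanSpace ℝ ι) (y : EuclideanSpace ℝ κ) :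
    lower (stack x y) = y := rfl

@[simp] lemma stack_upper_lower (x : EuclideanSpace ℝ (ι ⊕ κ)) :
    stack (upper x) (lower x) = x := by
  ext (i | i) <;> rfl

variable [Fintype ι] [Fintype κ]

/-- `mv M` as a continuous linear map. -/
def mvL (M : Matrix ι κ ℝ) : EuclideanSpace ℝ κ →L[ℝ] EuclideanSpace ℝ ι :=
  LinearMap.toContinuousLinearMap
    { toFun := mv M
      map_add' := fun x y => by ext i; simp [mv, Matrix.mulVec_add]
      map_smul' := fun c x => by ext i; simp [mv, Matrix.mulVec_smul] }

@[simp] lemma mvL_apply (M : Matrix ι κ ℝ) (x : EuclideanSpace ℝ κ) : mvL M x = mv M x := rfl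

/-- `upper` as a continuous linear map. -/
def upperL : EuclideanSpace ℝ (ι ⊕ κ) →L[ℝ] EuclideanSpace ℝ ι :=
  LinearMap.toContinuousLinearMap
    { toFun := upper
      map_add' := fun x y => by ext i; simp [upper]
      map_smul' := fun c x => by ext i; simp [upper] }

/-- `lower` as a continuous linear map. -/
def lowerL : EuclideanSpace ℝ (ι ⊕ κ) →L[ℝ] EuclideanSpace ℝ κ :=
  LinearMap.toContinuousLinearMap
    { toFun := lower
      map_add' := fun x y => by ext i; simp [lower]
      map_smul' := fun c x => by ext i; simp [lower] }

/-- `stack` as a continuous linear map. -/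
def stackL : EuclideanSpace ℝ ι × EuclideanSpace ℝ κ →L[ℝ] EuclideanSpace ℝ (ι ⊕ κ) :=
  LinearMap.toContinuousLinearMap
    { toFun := fun p => stack p.1 p.2
      map_add' := fun x y => by ext (i | i) <;> simp [stack]
      map_smul' := fun c x => by ext (i | i) <;> simp [stack] }

lemma norm_sq_eq_upper_add_lower (x : EuclideanSpace ℝ (ι ⊕ κ)) :
    ‖x‖ ^ 2 = ‖upper x‖ ^ 2 + ‖lower x‖ ^ 2 := by
  simp [EuclideanSpace.norm_sq_eq, upper, lower]

lemma inner_eq_dotProduct (x y : EuclideanSpace ℝ ι) : inner ℝ x y = x.ofLp ⬝ᵥ y.ofLp := by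
  rw [EuclideanSpace.inner_eq_star_dotProduct, star_trivial, dotProduct_comm]

lemma dotProduct_transpose_mulVec (M : Matrix ι κ ℝ) (a : κ → ℝ) (b : ι → ℝ) :
    a ⬝ᵥ (Mᵀ *ᵥ b) = (M *ᵥ a) ⬝ᵥ b := by
  rw [Matrix.dotProduct_mulVec, Matrix.vecMul_transpose]

lemma inner_mv_comm_of_isHermitian {M : Matrix ι ι ℝ} (hM : M.IsHermitian)
    (x y : EuclideanSpace ℝ ι) : inner ℝ x (mv M y) = inner ℝ y (mv M x) := by
  have hT : Mᵀ = M := by simpa using hM.eq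
  have h := dotProduct_transpose_mulVec M x.ofLp y.ofLp
  rw [hT] at h
  rw [inner_eq_dotProduct, inner_eq_dotProduct, dotProduct_comm y.ofLp]
  exact h

lemma NegDef.dotProduct_mulVec_nonpos {M : Matrix ι ι ℝ} (h : NegDef M) (x : ι → ℝ) :
    x ⬝ᵥ (M *ᵥ x) ≤ 0 := by
  have := Matrix.PosSemidef.dotProduct_mulVec_nonneg (Matrix.PosDef.posSemidef h) x
  simp only [star_trivial, Matrix.neg_mulVec, dotProduct_neg] at this
  linarith

lemma inner_mv_le (M : Matrix ι ι ℝ) (x : EuclideanSpace ℝ ι) :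
    inner ℝ x (mv M x) ≤ ‖mvL M‖ * ‖x‖ ^ 2 :=
  calc inner ℝ x (mv M x) ≤ ‖x‖ * ‖mvL M x‖ := real_inner_le_norm _ _
    _ ≤ ‖x‖ * (‖mvL M‖ * ‖x‖) := by gcongr; exact (mvL M).le_opNorm x
    _ = ‖mvL M‖ * ‖x‖ ^ 2 := by ring

lemma exists_pos_mul_norm_sq_le_inner_mv {M : Matrix ι ι ℝ} (hM : M.PosDef) :
    ∃ a > 0, ∀ x : EuclideanSpace ℝ ι, a * ‖x‖ ^ 2 ≤ inner ℝ x (mv M x) := by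
  have hpos : ∀ x : EuclideanSpace ℝ ι, x ≠ 0 → 0 < inner ℝ x (mv M x) := fun x hx => by
    simpa [inner_eq_dotProduct, mv] using hM.dotProduct_mulVec_pos (x := x.ofLp) (by simpa using hx)
  have hcont : Continuous fun x : EuclideanSpace ℝ ι => inner ℝ x (mv M x) :=
    continuous_id.inner (mvL M).continuous
  obtain ⟨a, ha, hmin⟩ : ∃ a > 0, ∀ x ∈ Metric.sphere (0 : EuclideanSpace ℝ ι) 1,
      a ≤ inner ℝ x (mv M x) := by
    rcases (Metric.sphere (0 : EuclideanSpace ℝ ι) 1).eq_empty_or_nonempty with he | hne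
    · exact ⟨1, one_pos, by simp [he]⟩
    obtain ⟨x₀, hx₀, hmin⟩ := (isCompact_sphere 0 1).exists_isMinOn hne hcont.continuousOn
    exact ⟨_, hpos x₀ (by rintro rfl; simp at hx₀), fun x hx => hmin hx⟩
  refine ⟨a, ha, fun x => ?_⟩
  rcases eq_or_ne x 0 with rfl | hx
  · simp
  have hn : ‖x‖ ≠ 0 := norm_ne_zero_iff.2 hx
  have := hmin (‖x‖⁻¹ • x) (by simp [norm_smul, hn])
  rw [← mvL_apply, map_smul, real_inner_smul_left, real_inner_smul_right, mvL_apply] at this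
  calc a * ‖x‖ ^ 2 ≤ (‖x‖⁻¹ * (‖x‖⁻¹ * inner ℝ x (mv M x))) * ‖x‖ ^ 2 := by gcongr
    _ = inner ℝ x (mv M x) := by field_simp

end LinearAlgebra

section AbsolutelyContinuous

variable {X Y : Type*} [PseudoMetricSpace X] [PseudoMetricSpace Y] {a b : ℝ}

lemma absolutelyContinuousOnInterval_congr {f g : ℝ → X}
    (hf : AbsolutelyContinuousOnInterval f a b) (h : EqOn f g (uIcc a b)) :
    AbsolutelyContinuousOnInterval g a b := by
  rw [absolutelyContinuousOnInterval_iff] at hf ⊢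
  intro ε hε
  obtain ⟨δ, hδ, hd⟩ := hf ε hε
  refine ⟨δ, hδ, fun E hE hlen => ?_⟩
  convert hd E hE hlen using 1
  exact Finset.sum_congr rfl fun i hi => by rw [h (hE.1 i hi).1, h (hE.1 i hi).2]

lemma absolutelyContinuousOnInterval_comp_lipschitzOn {g : X → Y} {s : Set X} {K : NNReal}
    (hg : LipschitzOnWith K g s) {f : ℝ → X} (hf : AbsolutelyContinuousOnInterval f a b)
    (hs : MapsTo f (uIcc a b) s) : AbsolutelyContinuousOnInterval (fun t => g (f t)) a b := by
  rw [absolutelyContinuousOnInterval_iff] at hf ⊢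
  intro ε hε
  obtain ⟨δ, hδ, h⟩ := hf (ε / (K + 1)) (by positivity)
  refine ⟨δ, hδ, fun E hE hlen => ?_⟩
  calc ∑ i ∈ Finset.range E.1, dist (g (f (E.2 i).1)) (g (f (E.2 i).2))
      ≤ ∑ i ∈ Finset.range E.1, K * dist (f (E.2 i).1) (f (E.2 i).2) :=
        Finset.sum_le_sum fun i hi =>
          hg.dist_le_mul _ (hs (hE.1 i hi).1) _ (hs (hE.1 i hi).2)
    _ = K * ∑ i ∈ Finset.range E.1, dist (f (E.2 i).1) (f (E.2 i).2) := by rw [Finset.mul_sum]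
    _ ≤ K * (ε / (K + 1)) := by gcongr; exact (h E hE hlen).le
    _ < (K + 1) * (ε / (K + 1)) := by gcongr; linarith
    _ = ε := by field_simp

lemma absolutelyContinuousOnInterval_comp_contDiff {E F : Type*} [NormedAddCommGroup E]
    [NormedSpace ℝ E] [FiniteDimensional ℝ E] [NormedAddCommGroup F] [NormedSpace ℝ F]
    {g : E → F} (hg : ContDiff ℝ 1 g) {f : ℝ → E} (hf : AbsolutelyContinuousOnInterval f a b) :
    AbsolutelyContinuousOnInterval (fun t => g (f t)) a b := by
  have := FiniteDimensional.proper ℝ E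
  obtain ⟨R, hR⟩ := hf.exists_bound
  obtain ⟨K, hK⟩ := (hg.contDiffOn (s := Metric.closedBall 0 R)).exists_lipschitzOnWith
    one_ne_zero (convex_closedBall _ _) (isCompact_closedBall _ _)
  exact absolutelyContinuousOnInterval_comp_lipschitzOn hK hf
    fun t ht => mem_closedBall_zero_iff.2 (hR t ht)

lemma dist_le_dist_of_uIoc_subset {x y x' y' : ℝ} (h : uIoc x' y' ⊆ uIoc x y) :
    dist x' y' ≤ dist x y := by
  have := measure_mono (μ := volume) h
  rwa [Real.volume_uIoc, Real.volume_uIoc, ENNReal.ofReal_le_ofReal_iff (abs_nonneg _),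
    ← Real.dist_eq, ← Real.dist_eq, dist_comm, dist_comm y] at this

-- Disjoint intervals are sent to disjoint intervals that are no longer.
lemma absolutelyContinuousOnInterval_comp_of_uIoc_subset {f : ℝ → X} {c d : ℝ} {r : ℝ → ℝ}
    (hf : AbsolutelyContinuousOnInterval f c d) (hr : MapsTo r (uIcc a b) (uIcc c d))
    (hsub : ∀ x y, uIoc (r x) (r y) ⊆ uIoc x y) :
    AbsolutelyContinuousOnInterval (fun t => f (r t)) a b := by
  rw [absolutelyContinuousOnInterval_iff] at hf ⊢
  intro ε hε
  obtain ⟨δ, hδ, h⟩ := hf ε hε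
  refine ⟨δ, hδ, fun E hE hlen => h (E.1, fun i => (r (E.2 i).1, r (E.2 i).2))
    ⟨fun i hi => ⟨hr (hE.1 i hi).1, hr (hE.1 i hi).2⟩, fun i hi j hj hij => ?_⟩ ?_⟩
  · exact (hE.2 hi hj hij).mono (hsub _ _) (hsub _ _)
  · exact (Finset.sum_le_sum fun i _ => dist_le_dist_of_uIoc_subset (hsub _ _)).trans_lt hlen

lemma absolutelyContinuousOnInterval_trans {F : Type*} [NormedAddCommGroup F] {f : ℝ → F} {c : ℝ}
    (hac : a ≤ c) (hcb : c ≤ b) (hleft : AbsolutelyContinuousOnInterval f a c)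
    (hright : AbsolutelyContinuousOnInterval f c b) : AbsolutelyContinuousOnInterval f a b := by
  have hmin : AbsolutelyContinuousOnInterval (fun t => f (min t c)) a b :=
    absolutelyContinuousOnInterval_comp_of_uIoc_subset hleft
      (fun x hx => by
        rw [uIcc_of_le (hac.trans hcb)] at hx; rw [uIcc_of_le hac]
        exact ⟨le_min hx.1 hac, min_le_right _ _⟩)
      (fun x y z hz => by simp only [mem_uIoc] at hz ⊢; grind)
  have hmax : AbsolutelyContinuousOnInterval (fun t => f (max t c)) a b :=
    absolutelyContinuousOnInterval_comp_of_uIoc_subset hright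
      (fun x hx => by
        rw [uIcc_of_le (hac.trans hcb)] at hx; rw [uIcc_of_le hcb]
        exact ⟨le_max_right _ _, max_le hx.2 hcb⟩)
      (fun x y z hz => by simp only [mem_uIoc] at hz ⊢; grind)
  have hconst : AbsolutelyContinuousOnInterval (fun _ : ℝ => f c) a b :=
    (LipschitzWith.const (f c)).lipschitzOnWith.absolutelyContinuousOnInterval
  convert (hmin.fun_add hmax).fun_sub hconst using 2 with t
  rcases le_total t c with h | h <;> simp [h]

lemma sub_le_integral_of_ae_hasDerivAt {f f' g : ℝ → ℝ} (hab : a ≤ b)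
    (hf : AbsolutelyContinuousOnInterval f a b)
    (hf' : ∀ᵐ t, t ∈ Ioo a b → HasDerivAt f (f' t) t ∧ f' t ≤ g t)
    (hg : IntervalIntegrable g volume a b) : f b - f a ≤ ∫ t in a..b, g t := by
  rw [← hf.integral_deriv_eq_sub]
  refine intervalIntegral.integral_mono_ae_restrict hab hf.intervalIntegrable_deriv hg ?_
  rw [EventuallyLE, ← restrict_Ioo_eq_restrict_Icc, ae_restrict_iff' measurableSet_Ioo]
  filter_upwards [hf'] with t ht hmem
  rw [(ht hmem).1.deriv]
  exact (ht hmem).2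

lemma le_of_ae_hasDerivAt_nonpos {f f' : ℝ → ℝ} (hab : a ≤ b)
    (hf : AbsolutelyContinuousOnInterval f a b)
    (hf' : ∀ᵐ t, t ∈ Ioo a b → HasDerivAt f (f' t) t ∧ f' t ≤ 0) : f b ≤ f a := by
  have := sub_le_integral_of_ae_hasDerivAt (g := fun _ => 0) hab hf hf' (by simp)
  simpa using this

lemma sub_eq_mul_of_ae_hasDerivAt_const {f : ℝ → ℝ} {c : ℝ} (hab : a ≤ b)
    (hf : AbsolutelyContinuousOnInterval f a b)
    (hf' : ∀ᵐ t, t ∈ Ioo a b → HasDerivAt f c t) : f b - f a = c * (b - a) := by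
  have h₁ := sub_le_integral_of_ae_hasDerivAt (f' := fun _ => c) (g := fun _ => c) hab hf
    (by filter_upwards [hf'] with t ht hmem using ⟨ht hmem, le_rfl⟩) (by simp)
  have h₂ := sub_le_integral_of_ae_hasDerivAt (f' := fun _ => -c) (g := fun _ => -c) hab hf.fun_neg
    (by filter_upwards [hf'] with t ht hmem using ⟨(ht hmem).neg, le_rfl⟩) (by simp)
  rw [intervalIntegral.integral_const, smul_eq_mul] at h₁ h₂
  linarith

lemma norm_sub_le_of_ae_hasDerivAt {F : Type*} [NormedAddCommGroup F] [NormedSpace ℝ F]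
    {f f' : ℝ → F} {M : ℝ} (hab : a ≤ b) (hf : AbsolutelyContinuousOnInterval f a b)
    (hf' : ∀ᵐ t, t ∈ Ioo a b → HasDerivAt f (f' t) t ∧ ‖f' t‖ ≤ M) :
    ‖f b - f a‖ ≤ M * (b - a) := by
  obtain ⟨g, hg, hgf⟩ := exists_dual_vector'' ℝ (f b - f a)
  have h := sub_le_integral_of_ae_hasDerivAt (f := fun t => g (f t)) (f' := fun t => g (f' t))
    (g := fun _ => M) hab
    (absolutelyContinuousOnInterval_comp_lipschitzOn g.lipschitz.lipschitzOnWith hf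
      (mapsTo_univ _ _)) (by
      filter_upwards [hf'] with t ht hmem
      exact ⟨g.hasFDerivAt.comp_hasDerivAt t (ht hmem).1, (le_abs_self _).trans
        ((g.le_of_opNorm_le hg _).trans (by simpa using (ht hmem).2))⟩)
    (by simp)
  rw [← map_sub, hgf, intervalIntegral.integral_const, smul_eq_mul, mul_comm] at h
  simpa using h

lemma le_exp_mul_add_of_ae_hasDerivAt {V V' : ℝ → ℝ} {c d : ℝ} (hc : c ≠ 0) (hab : a ≤ b)
    (hV : AbsolutelyContinuousOnInterval V a b)
    (hV' : ∀ᵐ t, t ∈ Ioo a b → HasDerivAt V (V' t) t ∧ V' t ≤ -c * V t + d) :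
    V b ≤ Real.exp (-c * (b - a)) * (V a - d / c) + d / c := by
  have hexp : AbsolutelyContinuousOnInterval (fun t => Real.exp (c * (t - a))) a b :=
    ((by fun_prop : ContDiff ℝ 1 fun t => Real.exp (c * (t - a))).contDiffOn)
      |>.absolutelyContinuousOnInterval
  have hconst : AbsolutelyContinuousOnInterval (fun _ : ℝ => d / c) a b :=
    (LipschitzWith.const (d / c)).lipschitzOnWith.absolutelyContinuousOnInterval
  have h := le_of_ae_hasDerivAt_nonpos
    (f := fun t => Real.exp (c * (t - a)) * (V t - d / c))
    (f' := fun t => Real.exp (c * (t - a)) * (V' t - (-c * V t + d)))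
    hab (hexp.fun_mul (hV.fun_sub hconst)) (by
      filter_upwards [hV'] with t ht hmem
      obtain ⟨hd, hle⟩ := ht hmem
      refine ⟨?_, mul_nonpos_of_nonneg_of_nonpos (Real.exp_pos _).le (sub_nonpos.2 hle)⟩
      have he : HasDerivAt (fun t => Real.exp (c * (t - a))) (Real.exp (c * (t - a)) * c) t := by
        simpa using (((hasDerivAt_id t).sub_const a).const_mul c).exp
      refine (he.mul (hd.sub_const (d / c))).congr_deriv ?_
      field_simp
      ring)
  simp only [sub_self, mul_zero, Real.exp_zero, one_mul] at h
  calc V b = Real.exp (-c * (b - a)) * (Real.exp (c * (b - a)) * (V b - d / c)) + d / c := by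
        rw [← mul_assoc, ← Real.exp_add]; ring_nf; simp
    _ ≤ _ := by gcongr

end AbsolutelyContinuous

section Exponential

lemma exp_mul_mem_segment {δ τ T : ℝ} (hδ : 0 ≤ δ) (hτ : τ ∈ Icc 0 T) :
    Real.exp (δ * τ) ∈ segment ℝ 1 (Real.exp (δ * T)) := by
  refine Icc_subset_segment ⟨Real.one_le_exp (mul_nonneg hδ hτ.1), ?_⟩
  gcongr
  exact hτ.2

end Exponential

section HybridDomain

variable {E : Set (ℝ × ℕ)}

/-- The possible last intervals of a hybrid time domain: `[a, b]`, `[a, b)` or `[a, ∞)`. -/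
def IsTerminalInterval (a b : ℝ) (I : Set ℝ) : Prop :=
  I = Icc a b ∨ (a < b ∧ I = Ico a b) ∨ I = Ici a

/-- The set of hybrid times consisting of `[t j, t (j+1)] × {j}` for `j < J` and of `I × {J}`. -/
def finiteDomain (t : ℕ → ℝ) (J : ℕ) (I : Set ℝ) : Set (ℝ × ℕ) :=
  {p | (p.2 < J ∧ p.1 ∈ Icc (t p.2) (t (p.2 + 1))) ∨ (p.2 = J ∧ p.1 ∈ I)}

lemma IsTerminalInterval.left_mem {a b : ℝ} {I : Set ℝ} (hI : IsTerminalInterval a b I)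
    (hab : a ≤ b) : a ∈ I := by
  rcases hI with rfl | ⟨h, rfl⟩ | rfl
  · exact left_mem_Icc.2 hab
  · exact left_mem_Ico.2 h
  · exact self_mem_Ici

lemma IsTerminalInterval.subset_Ici {a b : ℝ} {I : Set ℝ} (hI : IsTerminalInterval a b I) :
    I ⊆ Ici a := by
  rcases hI with rfl | ⟨-, rfl⟩ | rfl
  exacts [Icc_subset_Ici_self, Ico_subset_Ici_self, Subset.rfl]

lemma IsTerminalInterval.Icc_subset {a b s : ℝ} {I : Set ℝ} (hI : IsTerminalInterval a b I)
    (hs : s ∈ I) : Icc a s ⊆ I := by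
  rcases hI with rfl | ⟨-, rfl⟩ | rfl
  · exact Icc_subset_Icc_right hs.2
  · exact Icc_subset_Ico_right hs.2
  · exact Icc_subset_Ici_self

lemma slice_finiteDomain_of_lt (t : ℕ → ℝ) {i J : ℕ} (I : Set ℝ) (h : i < J) :
    slice (finiteDomain t J I) i = Icc (t i) (t (i + 1)) := by
  ext x; simp [slice, finiteDomain, h, h.ne]

lemma slice_finiteDomain_self (t : ℕ → ℝ) (J : ℕ) (I : Set ℝ) :
    slice (finiteDomain t J I) J = I := by
  ext x; simp [slice, finiteDomain]

lemma slice_finiteDomain_of_gt (t : ℕ → ℝ) {i J : ℕ} (I : Set ℝ) (h : J < i) :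
    slice (finiteDomain t J I) i = ∅ := by
  ext x; simp [slice, finiteDomain, h.not_gt, h.ne']

lemma IsHybridTimeDomain.exists_times (hE : IsHybridTimeDomain E) :
    ∃ t : ℕ → ℝ, t 0 = 0 ∧ Monotone t ∧ 0 ∈ slice E 0 ∧ ∀ j, ∀ s ∈ slice E j,
      t j ≤ s ∧ Icc (t j) s ⊆ slice E j ∧ ∀ i < j, slice E i = Icc (t i) (t (i + 1)) := by
  obtain ⟨t, h0, hmono, rfl | ⟨J, I, hI, hE⟩⟩ := hE
  · exact ⟨t, h0, hmono, ⟨h0.le, h0 ▸ hmono (Nat.zero_le _)⟩,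
      fun j s hs => ⟨hs.1, Icc_subset_Icc_right hs.2, fun i _ => rfl⟩⟩
  change E = finiteDomain t J I at hE
  change IsTerminalInterval _ _ I at hI
  subst hE
  refine ⟨t, h0, hmono, ?_, fun j s hs => ?_⟩
  · rcases J.eq_zero_or_pos with rfl | hJ
    · rw [slice_finiteDomain_self]
      exact h0 ▸ hI.left_mem (hmono (Nat.le_succ _))
    · rw [slice_finiteDomain_of_lt _ _ hJ]
      exact ⟨h0.le, h0 ▸ hmono (Nat.zero_le _)⟩
  · rcases lt_trichotomy j J with hj | rfl | hj
    · rw [slice_finiteDomain_of_lt _ _ hj] at hs ⊢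
      exact ⟨hs.1, Icc_subset_Icc_right hs.2,
        fun i hi => slice_finiteDomain_of_lt _ _ (hi.trans hj)⟩
    · rw [slice_finiteDomain_self] at hs ⊢
      exact ⟨hI.subset_Ici hs, hI.Icc_subset hs, fun i hi => slice_finiteDomain_of_lt _ _ hi⟩
    · rw [slice_finiteDomain_of_gt _ _ hj] at hs
      exact hs.elim

lemma IsHybridTimeDomain.zero_mem (hE : IsHybridTimeDomain E) : (0, 0) ∈ E := by
  obtain ⟨t, -, -, h, -⟩ := hE.exists_times
  exact h

lemma IsHybridTimeDomain.nonneg (hE : IsHybridTimeDomain E) {s : ℝ} {j : ℕ} (h : (s, j) ∈ E) :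
    0 ≤ s := by
  obtain ⟨t, h0, hm, -, ht⟩ := hE.exists_times
  exact h0.symm.le.trans ((hm (Nat.zero_le j)).trans (ht j s h).1)

lemma IsHybridTimeDomain.induction (hE : IsHybridTimeDomain E) {Q : ℝ → ℕ → Prop} (h0 : Q 0 0)
    (hflow : ∀ j a b, a ≤ b → Icc a b ⊆ slice E j → Q a j → Q b j)
    (hjump : ∀ t j, (t, j) ∈ E → (t, j + 1) ∈ E → Q t j → Q t (j + 1))
    {s : ℝ} {j : ℕ} (h : (s, j) ∈ E) : Q s j := by
  obtain ⟨t, ht0, hm, -, ht⟩ := hE.exists_times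
  induction j generalizing s with
  | zero =>
    obtain ⟨hle, hsub, -⟩ := ht 0 s h
    exact hflow 0 (t 0) s hle hsub (ht0 ▸ h0)
  | succ j ih =>
    obtain ⟨hle, hsub, hslice⟩ := ht (j + 1) s h
    have hj : t (j + 1) ∈ slice E j := by
      rw [hslice j (Nat.lt_succ_self j)]; exact ⟨hm (Nat.le_succ j), le_rfl⟩
    exact hflow (j + 1) (t (j + 1)) s hle hsub (hjump _ j hj (hsub ⟨le_rfl, hle⟩) (ih hj))

lemma Ioo_subset_interior_slice {j : ℕ} {a b : ℝ} (h : Icc a b ⊆ slice E j) :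
    Ioo a b ⊆ interior (slice E j) :=
  interior_maximal (Ioo_subset_Icc_self.trans h) isOpen_Ioo

lemma IsHybridTimeDomain.le_of_mem_of_lt (hE : IsHybridTimeDomain E) {s r : ℝ} {i j : ℕ}
    (hs : (s, i) ∈ E) (hr : (r, j) ∈ E) (hij : i < j) : s ≤ r := by
  obtain ⟨t, -, hm, -, ht⟩ := hE.exists_times
  obtain ⟨hle, -, hslice⟩ := ht j r hr
  have hs' : s ∈ slice E i := hs
  rw [hslice i hij] at hs'
  exact hs'.2.trans ((hm hij).trans hle)

lemma IsHybridTimeDomain.interior_slice_subset (hE : IsHybridTimeDomain E) (j : ℕ) :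
    interior (slice E j) ⊆ slice (E \ jumpTimes E) j := by
  intro s hs
  have hs' : s ∈ slice E j := interior_subset hs
  refine ⟨hs', fun hj => ?_⟩
  have hub : slice E j ⊆ Iic s := fun x hx => hE.le_of_mem_of_lt hx hj.2 j.lt_succ_self
  exact lt_irrefl s (by simpa using interior_mono hub hs)

lemma IsHybridTimeDomain.firstIndex_eq (hE : IsHybridTimeDomain E) {s r : ℝ} {j : ℕ}
    (hs : (s, j) ∈ E) (hr : (r, j) ∈ E) (hsr : s < r) : firstIndex E r = j := by
  refine le_antisymm (Nat.sInf_le hr) (le_csInf ⟨j, hr⟩ fun i hi => ?_)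
  by_contra! hlt
  exact hsr.not_ge (hE.le_of_mem_of_lt hi hs hlt)

lemma IsHybridTimeDomain.Icc_subset_timeProj (hE : IsHybridTimeDomain E) {s : ℝ}
    (hs : s ∈ timeProj E) : Icc 0 s ⊆ timeProj E := by
  obtain ⟨j, hj⟩ := hs
  refine hE.induction (Q := fun s _ => Icc 0 s ⊆ timeProj E) ?_ ?_ (fun _ _ _ _ h => h) hj
  · rintro x ⟨h1, h2⟩
    obtain rfl := le_antisymm h1 h2
    exact ⟨0, hE.zero_mem⟩
  · intro j a b _ hI ha x hx
    rcases le_total x a with h | h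
    · exact ha ⟨hx.1, h⟩
    · exact ⟨j, hI ⟨h, hx.2⟩⟩

end HybridDomain

section HybridSupNorm

variable {E : Set (ℝ × ℕ)} {m : Type*} [Fintype m] {u : ℝ → ℕ → EuclideanSpace ℝ m}

lemma norm_le_toReal_of_enorm_le {x : EuclideanSpace ℝ m} {B : ℝ≥0∞} (hB : B ≠ ∞)
    (hx : ‖x‖ₑ ≤ B) : ‖x‖ ≤ B.toReal := by
  rw [← toReal_enorm]; exact ENNReal.toReal_mono hB hx

lemma ae_norm_le_hybridSupNorm (hE : IsHybridTimeDomain E) (hu : hybridSupNorm E u ≠ ∞) (j : ℕ) :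
    ∀ᵐ t, t ∈ interior (slice E j) → ‖u t j‖ ≤ (hybridSupNorm E u).toReal := by
  rw [← ae_restrict_iff' isOpen_interior.measurableSet]
  refine ae_mono (Measure.restrict_mono_set volume (hE.interior_slice_subset j)) ?_
  filter_upwards [ENNReal.ae_le_essSup (μ := volume.restrict (slice (E \ jumpTimes E) j))
    (fun t => ‖u t j‖ₑ)] with t ht
  exact norm_le_toReal_of_enorm_le hu (ht.trans ((le_iSup (fun j => essSup (fun t => ‖u t j‖ₑ)
    (volume.restrict (slice (E \ jumpTimes E) j))) j).trans (le_max_left _ _)))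

lemma norm_le_hybridSupNorm_of_jump (hu : hybridSupNorm E u ≠ ∞) {t : ℝ} {j : ℕ}
    (h : (t, j) ∈ E) (h' : (t, j + 1) ∈ E) : ‖u t j‖ ≤ (hybridSupNorm E u).toReal :=
  norm_le_toReal_of_enorm_le hu <| (le_iSup₂ (f := fun p (_ : p ∈ jumpTimes E) => ‖u p.1 p.2‖ₑ)
    (t, j) ⟨h, h'⟩).trans (le_max_right _ _)

end HybridSupNorm

section HybridComparison

variable {E : Set (ℝ × ℕ)} {T₁ T₂ : ℝ} {τ : ℝ → ℕ → ℝ}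

/-- A countdown timer on a hybrid time domain: it stays in `[0, T₂]`, decreases at unit rate along
flows, triggers a jump only at `0`, and is reset into `[T₁, T₂]`. -/
structure IsTimer (T₁ T₂ : ℝ) (E : Set (ℝ × ℕ)) (τ : ℝ → ℕ → ℝ) : Prop where
  mem : ∀ t j, (t, j) ∈ E → τ t j ∈ Icc 0 T₂
  flow : ∀ j s t, s ≤ t → Icc s t ⊆ slice E j → τ t j = τ s j - (t - s)
  jump : ∀ t j, (t, j) ∈ E → (t, j + 1) ∈ E → τ t j = 0 ∧ τ t (j + 1) ∈ Icc T₁ T₂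

lemma IsTimer.mul_add_le_add (hτ : IsTimer T₁ T₂ E τ) (hE : IsHybridTimeDomain E) {t : ℝ} {j : ℕ}
    (h : (t, j) ∈ E) : j * T₁ + τ 0 0 ≤ t + τ t j := by
  refine hE.induction (Q := fun t j => j * T₁ + τ 0 0 ≤ t + τ t j) (by simp) ?_ ?_ h
  · intro j s t hst hI ih
    rw [hτ.flow j s t hst hI]
    linarith
  · intro t j h h' ih
    obtain ⟨hzero, hreset⟩ := hτ.jump t j h h'
    push_cast
    linarith [hreset.1]

lemma IsTimer.mul_le_add (hτ : IsTimer T₁ T₂ E τ) (hE : IsHybridTimeDomain E) {t : ℝ} {j : ℕ}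
    (h : (t, j) ∈ E) : j * T₁ ≤ t + T₂ := by
  linarith [hτ.mul_add_le_add hE h, (hτ.mem t j h).2, (hτ.mem 0 0 hE.zero_mem).1]

-- `exp (c τ)` decays along flows at the rate of `exp (-c t)` and grows by the factor `exp (c T₁)`
-- at jumps, so a fixed multiple of it absorbs the increments `r`.
lemma IsTimer.le_of_flow_of_jump (hτ : IsTimer T₁ T₂ E τ) (hE : IsHybridTimeDomain E)
    (hT₁ : 0 < T₁) {c d r : ℝ} (hc : 0 < c) (hd : 0 ≤ d) (hr : 0 ≤ r) {V : ℝ → ℕ → ℝ}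
    (hflow : ∀ j s t, s ≤ t → Icc s t ⊆ slice E j →
      V t j ≤ Real.exp (-c * (t - s)) * (V s j - d) + d)
    (hjump : ∀ t j, (t, j) ∈ E → (t, j + 1) ∈ E → V t (j + 1) ≤ V t j + r)
    {t : ℝ} {j : ℕ} (h : (t, j) ∈ E) :
    V t j ≤ Real.exp (-c * t) * V 0 0 + d + r / (Real.exp (c * T₁) - 1) * Real.exp (c * τ t j) := by
  set K := r / (Real.exp (c * T₁) - 1)
  have hgrow : 0 < Real.exp (c * T₁) - 1 := sub_pos.2 (Real.one_lt_exp_iff.2 (by positivity))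
  have hK : 0 ≤ K := div_nonneg hr hgrow.le
  have hKr : K * Real.exp (c * T₁) = K + r := by
    have : K * (Real.exp (c * T₁) - 1) = r := div_mul_cancel₀ _ hgrow.ne'
    linarith
  refine hE.induction
    (Q := fun t j => V t j ≤ Real.exp (-c * t) * V 0 0 + d + K * Real.exp (c * τ t j)) ?_ ?_ ?_ h
  · simp only [mul_zero, Real.exp_zero, one_mul]
    linarith [mul_nonneg hK (Real.exp_pos (c * τ 0 0)).le]
  · intro j s t hst hI ih
    calc V t j ≤ Real.exp (-c * (t - s)) * (V s j - d) + d := hflow j s t hst hI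
      _ ≤ Real.exp (-c * (t - s)) *
            (Real.exp (-c * s) * V 0 0 + K * Real.exp (c * τ s j)) + d := by
          gcongr; linarith
      _ = Real.exp (-c * (t - s) + -c * s) * V 0 0 + d +
            K * Real.exp (-c * (t - s) + c * τ s j) := by rw [Real.exp_add, Real.exp_add]; ring
      _ = _ := by rw [hτ.flow j s t hst hI]; ring_nf
  · intro t j h h' ih
    obtain ⟨hzero, hreset⟩ := hτ.jump t j h h'
    rw [hzero, mul_zero, Real.exp_zero] at ih
    have : K * Real.exp (c * T₁) ≤ K * Real.exp (c * τ t (j + 1)) := by gcongr; exact hreset.1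
    linarith [hjump t j h h']

lemma IsHybridTimeDomain.lintegral_Ioc_add_le (hE : IsHybridTimeDomain E) {v f g : ℝ → ℕ → ℝ≥0∞}
    (hflow : ∀ j s t, s ≤ t → Icc s t ⊆ slice E j →
      (∫⁻ x in Ioc s t, f x j) + v t j ≤ v s j + ∫⁻ x in Ioc s t, g x j)
    (hjump : ∀ t j, (t, j) ∈ E → (t, j + 1) ∈ E → v t (j + 1) ≤ v t j)
    {t : ℝ} {j : ℕ} (h : (t, j) ∈ E) :
    (∫⁻ x in Ioc 0 t, f x (firstIndex E x)) + v t j ≤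
      v 0 0 + ∫⁻ x in Ioc 0 t, g x (firstIndex E x) := by
  refine hE.induction (Q := fun t j => (∫⁻ x in Ioc 0 t, f x (firstIndex E x)) + v t j ≤
      v 0 0 + ∫⁻ x in Ioc 0 t, g x (firstIndex E x)) (by simp) ?_
    (fun t j h h' ih => (by gcongr; exact hjump t j h h' : _ ≤ _ + v t j).trans ih) h
  intro j s t hst hI ih
  have hs : (s, j) ∈ E := hI (left_mem_Icc.2 hst)
  have hsplit : ∀ F : ℝ → ℕ → ℝ≥0∞, ∫⁻ x in Ioc 0 t, F x (firstIndex E x) =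
      (∫⁻ x in Ioc 0 s, F x (firstIndex E x)) + ∫⁻ x in Ioc s t, F x j := fun F => by
    rw [← Ioc_union_Ioc_eq_Ioc (hE.nonneg hs) hst,
      lintegral_union measurableSet_Ioc (Ioc_disjoint_Ioc_of_le le_rfl)]
    congr 1
    refine setLIntegral_congr_fun measurableSet_Ioc fun x hx => ?_
    simp only [hE.firstIndex_eq hs (hI (Ioc_subset_Icc_self hx)) hx.1]
  calc (∫⁻ x in Ioc 0 t, f x (firstIndex E x)) + v t j
      = (∫⁻ x in Ioc 0 s, f x (firstIndex E x)) + ((∫⁻ x in Ioc s t, f x j) + v t j) := by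
        rw [hsplit, add_assoc]
    _ ≤ (∫⁻ x in Ioc 0 s, f x (firstIndex E x)) + (v s j + ∫⁻ x in Ioc s t, g x j) := by
        exact add_le_add_right (hflow j s t hst hI) _
    _ ≤ (v 0 0 + ∫⁻ x in Ioc 0 s, g x (firstIndex E x)) + ∫⁻ x in Ioc s t, g x j := by
        rw [← add_assoc]; gcongr
    _ = v 0 0 + ∫⁻ x in Ioc 0 t, g x (firstIndex E x) := by rw [hsplit g, add_assoc]

lemma ae_le_iUnion_Ioc_rat {I : Set ℝ} (h0 : ∀ s ∈ I, 0 ≤ s) (hI : ∀ s ∈ I, Icc 0 s ⊆ I) :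
    I ≤ᵐ[volume] ⋃ q : {q : ℚ // (q : ℝ) ∈ I}, Ioc 0 (q : ℝ) := by
  have hsub : (I \ ⋃ q : {q : ℚ // (q : ℝ) ∈ I}, Ioc 0 (q : ℝ)) ⊆ {0} ∪ {x | IsGreatest I x} := by
    rintro x ⟨hx, hx'⟩
    rcases (h0 x hx).eq_or_lt with h | h
    · exact Or.inl h.symm
    · refine Or.inr ⟨hx, fun y hy => ?_⟩
      by_contra! hlt
      obtain ⟨q, hxq, hqy⟩ := exists_rat_btwn hlt
      exact hx' (mem_iUnion.2 ⟨⟨q, hI y hy ⟨h.le.trans hxq.le, hqy.le⟩⟩, h, hxq.le⟩)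
  have hsing : {x | IsGreatest I x}.Subsingleton := fun x hx y hy => hx.unique hy
  exact ae_le_set.2
    (measure_mono_null hsub (measure_union_null (by simp) (hsing.measure_zero volume)))

lemma setLIntegral_le_of_forall_Ioc {I : Set ℝ} (h0 : ∀ s ∈ I, 0 ≤ s)
    (hI : ∀ s ∈ I, Icc 0 s ⊆ I) {f : ℝ → ℝ≥0∞} {B : ℝ≥0∞}
    (hB : ∀ s ∈ I, ∫⁻ x in Ioc 0 s, f x ≤ B) : ∫⁻ x in I, f x ≤ B := by
  refine (lintegral_mono' (Measure.restrict_mono_ae (ae_le_iUnion_Ioc_rat h0 hI)) le_rfl).trans ?_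
  rw [setLIntegral_iUnion_of_directed]
  · exact iSup_le fun q => hB q q.2
  · intro q r
    rcases le_total (q : ℚ) r with h | h
    · exact ⟨r, Ioc_subset_Ioc_right (by exact_mod_cast h), subset_rfl⟩
    · exact ⟨q, subset_rfl, Ioc_subset_Ioc_right (by exact_mod_cast h)⟩

lemma IsHybridTimeDomain.lintegral_timeProj_le (hE : IsHybridTimeDomain E)
    {v f g : ℝ → ℕ → ℝ≥0∞}
    (hflow : ∀ j s t, s ≤ t → Icc s t ⊆ slice E j →
      (∫⁻ x in Ioc s t, f x j) + v t j ≤ v s j + ∫⁻ x in Ioc s t, g x j)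
    (hjump : ∀ t j, (t, j) ∈ E → (t, j + 1) ∈ E → v t (j + 1) ≤ v t j) :
    ∫⁻ x in timeProj E, f x (firstIndex E x) ≤
      v 0 0 + ∫⁻ x in timeProj E, g x (firstIndex E x) := by
  refine setLIntegral_le_of_forall_Ioc (fun s hs => hs.elim fun j hj => hE.nonneg hj)
    (fun s hs => hE.Icc_subset_timeProj hs) fun s hs => ?_
  obtain ⟨j, hj⟩ := hs
  refine le_self_add.trans ((hE.lintegral_Ioc_add_le hflow hjump hj).trans ?_)
  gcongr
  exact Ioc_subset_Icc_self.trans (hE.Icc_subset_timeProj ⟨j, hj⟩)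

end HybridComparison

section Dissipation

variable {nz ny nw nq ns np : ℕ}

-- The slack variables do not appear on the right: the rows of `X` pair with the error equation
-- `hp`, and those of `X₅, …, X₈` with the identity `C p - C p = 0` between the first two blocks.
lemma dotProduct_lmiZOH_mulVec (P : Plant nz ny nw nq ns np) (ℓ lamt γ : ℝ)
    (P₁ : Matrix (Fin nz) (Fin nz) ℝ) (P₂ : Matrix (Fin ny) (Fin ny) ℝ) (δ χ : ℝ)
    (X : Matrix (Fin nz) (Fin nz) ℝ) (L : Matrix (Fin nz) (Fin ny) ℝ)
    (X₅ : Matrix (Fin ny) (Fin nz) ℝ) (X₆ : Matrix (Fin ny) (Fin ny) ℝ)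
    (X₇ : Matrix (Fin ny) (Fin nz) ℝ) (X₈ : Matrix (Fin ny) (Fin ny) ℝ) (τ : ℝ)
    {e p : Fin nz → ℝ} {θ : Fin ny → ℝ} {w : Fin nw → ℝ} {s : Fin ns → ℝ}
    (hp : p = P.A *ᵥ e - L *ᵥ (P.C *ᵥ e) + L *ᵥ θ + P.B *ᵥ s + P.N *ᵥ w) :
    (Sum.elim (Sum.elim (Sum.elim p (P.C *ᵥ p)) (Sum.elim e θ)) (Sum.elim w s)) ⬝ᵥ
      (lmiZOH P ℓ lamt γ P₁ P₂ δ χ X (Xᵀ * L) X₅ X₆ X₇ X₈ τ *ᵥ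
        (Sum.elim (Sum.elim (Sum.elim p (P.C *ᵥ p)) (Sum.elim e θ)) (Sum.elim w s))) =
      2 * (p ⬝ᵥ (P₁ *ᵥ e)) + 2 * Real.exp (δ * τ) * ((P.C *ᵥ p) ⬝ᵥ (P₂ *ᵥ θ))
        + 2 * lamt * (e ⬝ᵥ (P₁ *ᵥ e)) + (P.Cp *ᵥ e) ⬝ᵥ (P.Cp *ᵥ e)
        + χ * ℓ ^ 2 * ((P.S *ᵥ e) ⬝ᵥ (P.S *ᵥ e))
        + (-δ + 2 * lamt) * Real.exp (δ * τ) * (θ ⬝ᵥ (P₂ *ᵥ θ))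
        - γ ^ 2 * (w ⬝ᵥ w) - χ * (s ⬝ᵥ s) := by
  have slack : (X *ᵥ (p + e)) ⬝ᵥ p =
      (X *ᵥ (p + e)) ⬝ᵥ (P.A *ᵥ e - L *ᵥ (P.C *ᵥ e) + L *ᵥ θ + P.B *ᵥ s + P.N *ᵥ w) := by
    rw [← hp]
  clear hp
  simp only [lmiZOH, lmiBlock, lmiQ1, lmiQ2, lmiQ5, lmiP, lmiN, He,
    Matrix.fromBlocks_transpose, Matrix.fromBlocks_add, Matrix.fromBlocks_mulVec,
    Matrix.fromRows_mulVec, Matrix.fromCols_mulVec_sumElim, Matrix.transpose_fromRows,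
    Sum.elim_comp_inl, Sum.elim_comp_inr, sumElim_dotProduct_sumElim, dotProduct_add,
    Matrix.add_mulVec, Matrix.sub_mulVec, Matrix.neg_mulVec, Matrix.smul_mulVec, Sum.elim_add_add,
    Matrix.transpose_add, Matrix.transpose_sub, Matrix.transpose_neg, Matrix.transpose_mul,
    Matrix.transpose_transpose, Matrix.transpose_zero, Matrix.zero_mulVec, Matrix.one_mulVec,
    ← Matrix.mulVec_mulVec, dotProduct_transpose_mulVec, dotProduct_neg, dotProduct_sub,
    dotProduct_smul, Matrix.mulVec_add, add_dotProduct, smul_eq_mul, dotProduct_zero,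
    Matrix.transpose_smul] at slack ⊢
  simp only [dotProduct_comm] at slack ⊢
  linear_combination (-2) * slack

/-- The Lyapunov function `V(ε, θ̃, τ) = εᵀ P₁ ε + e^{δτ} θ̃ᵀ P₂ θ̃`. -/
def lyap (P₁ : Matrix (Fin nz) (Fin nz) ℝ) (P₂ : Matrix (Fin ny) (Fin ny) ℝ) (δ : ℝ)
    (e : EuclideanSpace ℝ (ErrIx nz ny)) (τ : ℝ) : ℝ :=
  inner ℝ (upper e) (mv P₁ (upper e)) + Real.exp (δ * τ) * inner ℝ (lower e) (mv P₂ (lower e))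

/-- The derivative of `lyap` at `(e, τ)` in the direction `(e', -1)`, for symmetric `P₁, P₂`. -/
def lyapDot (P₁ : Matrix (Fin nz) (Fin nz) ℝ) (P₂ : Matrix (Fin ny) (Fin ny) ℝ) (δ : ℝ)
    (e e' : EuclideanSpace ℝ (ErrIx nz ny)) (τ : ℝ) : ℝ :=
  2 * inner ℝ (upper e') (mv P₁ (upper e)) + Real.exp (δ * τ) *
    (2 * inner ℝ (lower e') (mv P₂ (lower e)) - δ * inner ℝ (lower e) (mv P₂ (lower e)))

/-- The vector field of the error `e = (ε, θ̃)` for the gain `H = 0`. -/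
def errField (P : Plant nz ny nw nq ns np) (L : Matrix (Fin nz) (Fin ny) ℝ) (z : Vec nz)
    (e : EuclideanSpace ℝ (ErrIx nz ny)) (w : Vec nw) : EuclideanSpace ℝ (ErrIx nz ny) :=
  mv (P.matF L 0) e + mv P.matQ (P.zeta z (upper e)) + mv P.matT w

lemma errField_eq_stack (P : Plant nz ny nw nq ns np) (L : Matrix (Fin nz) (Fin ny) ℝ)
    (z : Vec nz) (e : EuclideanSpace ℝ (ErrIx nz ny)) (w : Vec nw) :
    errField P L z e w =
      stack (mv P.A (upper e) - mv L (mv P.C (upper e)) + mv L (lower e)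
          + mv P.B (P.zeta z (upper e)) + mv P.N w)
        (mv P.C (mv P.A (upper e) - mv L (mv P.C (upper e)) + mv L (lower e)
          + mv P.B (P.zeta z (upper e)) + mv P.N w)) := by
  rw [← stack_upper_lower e]
  ext (i | i) <;>
    simp [errField, stack, Plant.matF, Plant.matQ, Plant.matT, mv, upper, lower,
      Matrix.fromBlocks_mulVec, Matrix.fromRows_mulVec, Matrix.sub_mulVec, Matrix.mulVec_add,
      Matrix.mulVec_sub, ← Matrix.mulVec_mulVec]

lemma norm_zeta_le (P : Plant nz ny nw nq ns np) {ℓ : ℝ}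
    (hψ : ∀ v₁ v₂ : Vec nq, ‖P.ψ v₁ - P.ψ v₂‖ ≤ ℓ * ‖v₁ - v₂‖) (z ε : Vec nz) :
    ‖P.zeta z ε‖ ≤ ℓ * ‖mv P.S ε‖ := by
  refine (hψ _ _).trans_eq ?_
  rw [← mvL_apply, ← mvL_apply, ← mvL_apply, ← map_sub, sub_sub_cancel]

/-- The dissipation inequality for `lyap` at the value `τ` of the timer: decay rate `2 λ_t`, output
`C_p ε`, supply rate `γ² |w|²`. -/
def IsDissipativeAt (P : Plant nz ny nw nq ns np) (L : Matrix (Fin nz) (Fin ny) ℝ)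
    (lamt γ : ℝ) (P₁ : Matrix (Fin nz) (Fin nz) ℝ) (P₂ : Matrix (Fin ny) (Fin ny) ℝ)
    (δ τ : ℝ) : Prop :=
  ∀ (z : Vec nz) (e : EuclideanSpace ℝ (ErrIx nz ny)) (w : Vec nw),
    lyapDot P₁ P₂ δ e (errField P L z e w) τ + 2 * lamt * lyap P₁ P₂ δ e τ
      + ‖mv P.Cp (upper e)‖ ^ 2 ≤ γ ^ 2 * ‖w‖ ^ 2

variable {P : Plant nz ny nw nq ns np} {L : Matrix (Fin nz) (Fin ny) ℝ} {lamt γ δ : ℝ}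
  {P₁ : Matrix (Fin nz) (Fin nz) ℝ} {P₂ : Matrix (Fin ny) (Fin ny) ℝ}

lemma isDissipativeAt_of_negDef_lmiZOH {ℓ χ : ℝ}
    (hψ : ∀ v₁ v₂ : Vec nq, ‖P.ψ v₁ - P.ψ v₂‖ ≤ ℓ * ‖v₁ - v₂‖) (hχ : 0 ≤ χ)
    {X : Matrix (Fin nz) (Fin nz) ℝ}
    {X₅ X₇ : Matrix (Fin ny) (Fin nz) ℝ} {X₆ X₈ : Matrix (Fin ny) (Fin ny) ℝ} {τ : ℝ}
    (h : NegDef (lmiZOH P ℓ lamt γ P₁ P₂ δ χ X (Xᵀ * L) X₅ X₆ X₇ X₈ τ)) :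
    IsDissipativeAt P L lamt γ P₁ P₂ δ τ := by
  intro z e w
  set s := P.zeta z (upper e)
  set p := mv P.A (upper e) - mv L (mv P.C (upper e)) + mv L (lower e) + mv P.B s + mv P.N w
    with hp
  have hfield : errField P L z e w = stack p (mv P.C p) := errField_eq_stack P L z e w
  have hsector : χ * ‖s‖ ^ 2 ≤ χ * (ℓ ^ 2 * ‖mv P.S (upper e)‖ ^ 2) := by
    rw [← mul_pow]
    gcongr
    exact norm_zeta_le P hψ z (upper e)
  have hneg := h.dotProduct_mulVec_nonpos (Sum.elim (Sum.elim (Sum.elim p.ofLp (P.C *ᵥ p.ofLp))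
    (Sum.elim (upper e).ofLp (lower e).ofLp)) (Sum.elim w.ofLp s.ofLp))
  rw [dotProduct_lmiZOH_mulVec P ℓ lamt γ P₁ P₂ δ χ X L X₅ X₆ X₇ X₈ τ
    (congrArg WithLp.ofLp hp)] at hneg
  rw [hfield]
  simp only [lyapDot, lyap, upper_stack, lower_stack, ← real_inner_self_eq_norm_sq,
    inner_eq_dotProduct] at hsector ⊢
  simp only [mv] at hsector ⊢
  linarith

-- The inequality is affine in `exp (δ τ)`.
lemma IsDissipativeAt.of_mem_Icc {T₂ τ : ℝ} (h₀ : IsDissipativeAt P L lamt γ P₁ P₂ δ 0)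
    (h₂ : IsDissipativeAt P L lamt γ P₁ P₂ δ T₂) (hδ : 0 ≤ δ) (hτ : τ ∈ Icc 0 T₂) :
    IsDissipativeAt P L lamt γ P₁ P₂ δ τ := by
  intro z e w
  obtain ⟨c₀, c₂, hc₀, hc₂, hsum, hexp⟩ := exp_mul_mem_segment hδ hτ
  obtain rfl : c₀ = 1 - c₂ := eq_sub_of_add_eq hsum
  have i₀ := mul_le_mul_of_nonneg_left (h₀ z e w) hc₀
  have i₂ := mul_le_mul_of_nonneg_left (h₂ z e w) hc₂
  simp only [lyapDot, lyap, ← hexp, mul_zero, Real.exp_zero, smul_eq_mul] at i₀ i₂ ⊢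
  linarith

lemma exists_pos_mul_norm_sq_le_lyap (hP₁ : P₁.PosDef) (hP₂ : P₂.PosDef) (hδ : 0 ≤ δ) :
    ∃ a > 0, ∀ (e : EuclideanSpace ℝ (ErrIx nz ny)) (τ : ℝ), 0 ≤ τ →
      a * ‖e‖ ^ 2 ≤ lyap P₁ P₂ δ e τ := by
  obtain ⟨a₁, ha₁, h₁⟩ := exists_pos_mul_norm_sq_le_inner_mv hP₁
  obtain ⟨a₂, ha₂, h₂⟩ := exists_pos_mul_norm_sq_le_inner_mv hP₂
  refine ⟨min a₁ a₂, lt_min ha₁ ha₂, fun e τ hτ => ?_⟩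
  have hP₂_nonneg : 0 ≤ inner ℝ (lower e) (mv P₂ (lower e)) := le_trans (by positivity) (h₂ _)
  calc min a₁ a₂ * ‖e‖ ^ 2 = min a₁ a₂ * ‖upper e‖ ^ 2 + min a₁ a₂ * ‖lower e‖ ^ 2 := by
        rw [norm_sq_eq_upper_add_lower, mul_add]
    _ ≤ a₁ * ‖upper e‖ ^ 2 + a₂ * ‖lower e‖ ^ 2 := by
        gcongr
        exacts [min_le_left _ _, min_le_right _ _]
    _ ≤ inner ℝ (upper e) (mv P₁ (upper e)) + 1 * inner ℝ (lower e) (mv P₂ (lower e)) := by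
        rw [one_mul]
        exact add_le_add (h₁ _) (h₂ _)
    _ ≤ lyap P₁ P₂ δ e τ := by
        unfold lyap
        gcongr
        exact Real.one_le_exp (mul_nonneg hδ hτ)

lemma exp_mul_inner_mv_le (P₂ : Matrix (Fin ny) (Fin ny) ℝ) (hδ : 0 ≤ δ) {T₂ τ : ℝ}
    (hτ : τ ≤ T₂) (x : Vec ny) :
    Real.exp (δ * τ) * inner ℝ x (mv P₂ x) ≤ Real.exp (δ * T₂) * ‖mvL P₂‖ * ‖x‖ ^ 2 :=
  calc Real.exp (δ * τ) * inner ℝ x (mv P₂ x)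
      ≤ Real.exp (δ * τ) * (‖mvL P₂‖ * ‖x‖ ^ 2) := by gcongr; exact inner_mv_le P₂ x
    _ ≤ Real.exp (δ * T₂) * (‖mvL P₂‖ * ‖x‖ ^ 2) := by gcongr
    _ = Real.exp (δ * T₂) * ‖mvL P₂‖ * ‖x‖ ^ 2 := by ring

lemma exists_lyap_le_mul_norm_sq (P₁ : Matrix (Fin nz) (Fin nz) ℝ)
    (P₂ : Matrix (Fin ny) (Fin ny) ℝ) (hδ : 0 ≤ δ) (T₂ : ℝ) :
    ∃ b > 0, ∀ (e : EuclideanSpace ℝ (ErrIx nz ny)) (τ : ℝ), τ ≤ T₂ →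
      lyap P₁ P₂ δ e τ ≤ b * ‖e‖ ^ 2 := by
  set b₁ := ‖mvL P₁‖ + 1
  set b₂ := Real.exp (δ * T₂) * ‖mvL P₂‖
  refine ⟨max b₁ b₂, lt_max_of_lt_left (by positivity), fun e τ hτ => ?_⟩
  have h₁ : ‖mvL P₁‖ ≤ max b₁ b₂ := le_max_of_le_left (le_add_of_nonneg_right zero_le_one)
  calc lyap P₁ P₂ δ e τ
      ≤ ‖mvL P₁‖ * ‖upper e‖ ^ 2 + b₂ * ‖lower e‖ ^ 2 :=
        add_le_add (inner_mv_le P₁ _) (exp_mul_inner_mv_le P₂ hδ hτ _)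
    _ ≤ max b₁ b₂ * ‖upper e‖ ^ 2 + max b₁ b₂ * ‖lower e‖ ^ 2 := by
        gcongr
        exact le_max_right _ _
    _ = max b₁ b₂ * ‖e‖ ^ 2 := by rw [norm_sq_eq_upper_add_lower, mul_add]

lemma lyap_le_lyap_zero_add (P₁ : Matrix (Fin nz) (Fin nz) ℝ) (hP₂ : P₂.PosSemidef) (hδ : 0 ≤ δ)
    {T₂ τ : ℝ} (hτ : τ ≤ T₂) {e e' : EuclideanSpace ℝ (ErrIx nz ny)} (he : upper e' = upper e) :
    lyap P₁ P₂ δ e' τ ≤ lyap P₁ P₂ δ e 0 + Real.exp (δ * T₂) * ‖mvL P₂‖ * ‖lower e'‖ ^ 2 := by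
  have hnonneg : 0 ≤ inner ℝ (lower e) (mv P₂ (lower e)) := by
    simpa [inner_eq_dotProduct, mv] using hP₂.dotProduct_mulVec_nonneg (lower e).ofLp
  have hlower := exp_mul_inner_mv_le P₂ hδ hτ (lower e')
  simp only [lyap, he, mul_zero, Real.exp_zero]
  linarith

end Dissipation

section State

variable {nz ny : ℕ}

/-- `stE` as a continuous linear map. -/
def stEL : EuclideanSpace ℝ (StateIx nz ny) →L[ℝ] EuclideanSpace ℝ (ErrIx nz ny) :=
  upperL.comp lowerL

/-- `stτ` as a continuous linear map. -/
def stτL : EuclideanSpace ℝ (StateIx nz ny) →L[ℝ] ℝ :=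
  (EuclideanSpace.proj ()).comp (lowerL.comp lowerL)

@[simp] lemma stEL_apply (x : EuclideanSpace ℝ (StateIx nz ny)) : stEL x = stE x := rfl

@[simp] lemma stτL_apply (x : EuclideanSpace ℝ (StateIx nz ny)) : stτL x = stτ x := rfl

@[simp] lemma stZ_mkState (z : Vec nz) (e : EuclideanSpace ℝ (ErrIx nz ny)) (τ : ℝ) :
    stZ (mkState z e τ) = z := rfl

@[simp] lemma stE_mkState (z : Vec nz) (e : EuclideanSpace ℝ (ErrIx nz ny)) (τ : ℝ) :
    stE (mkState z e τ) = e := rfl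

@[simp] lemma stτ_mkState (z : Vec nz) (e : EuclideanSpace ℝ (ErrIx nz ny)) (τ : ℝ) :
    stτ (mkState z e τ) = τ := rfl

lemma mkState_stZ_stE_stτ (x : EuclideanSpace ℝ (StateIx nz ny)) :
    mkState (stZ x) (stE x) (stτ x) = x := by
  ext (i | i | i) <;> rfl

lemma norm_mkState_sq (z : Vec nz) (e : EuclideanSpace ℝ (ErrIx nz ny)) (τ : ℝ) :
    ‖mkState z e τ‖ ^ 2 = ‖z‖ ^ 2 + ‖e‖ ^ 2 + τ ^ 2 := by
  simp [mkState, norm_sq_eq_upper_add_lower (stack _ _), EuclideanSpace.norm_sq_eq (n := Unit),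
    add_assoc]

lemma norm_stE_le (x : EuclideanSpace ℝ (StateIx nz ny)) : ‖stE x‖ ≤ ‖x‖ := by
  have h := norm_mkState_sq (stZ x) (stE x) (stτ x)
  rw [mkState_stZ_stE_stτ] at h
  exact le_of_sq_le_sq (by nlinarith) (norm_nonneg _)

lemma infDist_attractor {T₂ : ℝ} {x : EuclideanSpace ℝ (StateIx nz ny)} (hx : stτ x ∈ Icc 0 T₂) :
    Metric.infDist x (attractor nz ny T₂) = ‖stE x‖ := by
  have hmem : mkState (stZ x) 0 (stτ x) ∈ attractor nz ny T₂ := ⟨rfl, rfl, hx⟩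
  refine le_antisymm ?_ ((Metric.le_infDist ⟨_, hmem⟩).2 fun y hy => ?_)
  · have hsub : x - mkState (stZ x) 0 (stτ x) = mkState 0 (stE x) 0 := by
      conv_lhs => rw [← mkState_stZ_stE_stτ x]
      ext (i | i | i) <;> simp [mkState, stack, stZ, stE, stτ, upper, lower]
    calc Metric.infDist x (attractor nz ny T₂) ≤ ‖x - mkState (stZ x) 0 (stτ x)‖ :=
          (Metric.infDist_le_dist_of_mem hmem).trans_eq (dist_eq_norm _ _)
      _ = ‖stE x‖ := by
          rw [hsub, ← sq_eq_sq₀ (norm_nonneg _) (norm_nonneg _), norm_mkState_sq]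
          simp
  · have hy_zero : stE y = 0 := by
      rw [← stack_upper_lower (stE y), hy.1, hy.2.1]
      ext (i | i) <;> rfl
    calc ‖stE x‖ = ‖stE (x - y)‖ := by
          rw [← stEL_apply (x - y), map_sub, stEL_apply, stEL_apply, hy_zero, sub_zero]
      _ ≤ dist x y := (norm_stE_le _).trans_eq (dist_eq_norm _ _).symm

lemma contDiff_lyap (P₁ : Matrix (Fin nz) (Fin nz) ℝ) (P₂ : Matrix (Fin ny) (Fin ny) ℝ) (δ : ℝ) :
    ContDiff ℝ 1 fun x : EuclideanSpace ℝ (StateIx nz ny) => lyap P₁ P₂ δ (stE x) (stτ x) := by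
  have hε : ContDiff ℝ 1 fun x : EuclideanSpace ℝ (StateIx nz ny) => upper (stE x) :=
    (upperL.comp stEL).contDiff
  have hθ : ContDiff ℝ 1 fun x : EuclideanSpace ℝ (StateIx nz ny) => lower (stE x) :=
    (lowerL.comp stEL).contDiff
  have hτ : ContDiff ℝ 1 fun x : EuclideanSpace ℝ (StateIx nz ny) => stτ x := stτL.contDiff
  exact (hε.inner ℝ ((mvL P₁).contDiff.comp hε)).add
    ((Real.contDiff_exp.comp (contDiff_const.mul hτ)).mul
      (hθ.inner ℝ ((mvL P₂).contDiff.comp hθ)))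

lemma hasDerivAt_lyap {P₁ : Matrix (Fin nz) (Fin nz) ℝ} {P₂ : Matrix (Fin ny) (Fin ny) ℝ}
    (hP₁ : P₁.IsHermitian) (hP₂ : P₂.IsHermitian) (δ : ℝ)
    {x : ℝ → EuclideanSpace ℝ (StateIx nz ny)} {x' : EuclideanSpace ℝ (StateIx nz ny)} {t : ℝ}
    (hx : HasDerivAt x x' t) (hx' : stτ x' = -1) :
    HasDerivAt (fun s => lyap P₁ P₂ δ (stE (x s)) (stτ (x s)))
      (lyapDot P₁ P₂ δ (stE (x t)) (stE x') (stτ (x t))) t := by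
  have hε : HasDerivAt (fun s => upper (stE (x s))) (upper (stE x')) t :=
    (upperL.comp stEL).hasFDerivAt.comp_hasDerivAt t hx
  have hθ : HasDerivAt (fun s => lower (stE (x s))) (lower (stE x')) t :=
    (lowerL.comp stEL).hasFDerivAt.comp_hasDerivAt t hx
  have hτ : HasDerivAt (fun s => stτ (x s)) (-1) t :=
    hx' ▸ stτL.hasFDerivAt.comp_hasDerivAt t hx
  have hV₁ := hε.inner ℝ ((mvL P₁).hasFDerivAt.comp_hasDerivAt t hε)
  have hV₂ := hθ.inner ℝ ((mvL P₂).hasFDerivAt.comp_hasDerivAt t hθ)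
  refine (hV₁.add (((hτ.const_mul δ).exp).mul hV₂)).congr_deriv ?_
  simp only [lyapDot, Function.comp_apply, mvL_apply]
  rw [inner_mv_comm_of_isHermitian hP₁ (upper (stE (x t))),
    inner_mv_comm_of_isHermitian hP₂ (lower (stE (x t))) (lower (stE x'))]
  ring

end State

section Solutions

variable {n m : Type*} [Fintype n] [Fintype m] {𝓗 : HybridSystem n m} {E : Set (ℝ × ℕ)}
  {φ : ℝ → ℕ → EuclideanSpace ℝ n} {u : ℝ → ℕ → EuclideanSpace ℝ m} {j : ℕ} {a b : ℝ}

lemma HybridSystem.IsSolutionPair.absolutelyContinuousOnInterval (h : 𝓗.IsSolutionPair E φ u)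
    (hab : a ≤ b) (hs : Icc a b ⊆ slice E j) :
    AbsolutelyContinuousOnInterval (fun t => φ t j) a b :=
  h.arc j a b hab hs

lemma HybridSystem.IsSolutionPair.continuousOn (h : 𝓗.IsSolutionPair E φ u)
    (hab : a ≤ b) (hs : Icc a b ⊆ slice E j) : ContinuousOn (fun t => φ t j) (Icc a b) :=
  uIcc_of_le hab ▸ (h.absolutelyContinuousOnInterval hab hs).continuousOn

lemma HybridSystem.IsSolutionPair.ae_hasDerivAt (h : 𝓗.IsSolutionPair E φ u)
    (hs : Icc a b ⊆ slice E j) :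
    ∀ᵐ t, t ∈ Ioo a b → HasDerivAt (fun s => φ s j) (𝓗.f (φ t j) (u t j)) t := by
  filter_upwards [h.flow j] with t ht hmem
  exact ht (Ioo_subset_interior_slice hs hmem)

end Solutions

section ErrorSystem

variable {nz ny nw nq ns np : ℕ} {P : Plant nz ny nw nq ns np} {T₁ T₂ : ℝ}
  {L : Matrix (Fin nz) (Fin ny) ℝ} {H : Matrix (Fin ny) (Fin ny) ℝ} {E : Set (ℝ × ℕ)}
  {φ : ℝ → ℕ → EuclideanSpace ℝ (StateIx nz ny)}
  {u : ℝ → ℕ → EuclideanSpace ℝ (Fin nw ⊕ Fin ny)} {j : ℕ} {a b s : ℝ}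

lemma stE_errorSystem_f (x : EuclideanSpace ℝ (StateIx nz ny))
    (v : EuclideanSpace ℝ (Fin nw ⊕ Fin ny)) :
    stE ((P.errorSystem T₁ T₂ L 0).f x v) = errField P L (stZ x) (stE x) (upper v) := rfl

lemma stτ_errorSystem_f (x : EuclideanSpace ℝ (StateIx nz ny))
    (v : EuclideanSpace ℝ (Fin nw ⊕ Fin ny)) : stτ ((P.errorSystem T₁ T₂ L H).f x v) = -1 := rfl

lemma errorSystem_resetMap (e : EuclideanSpace ℝ (ErrIx nz ny)) (η : Vec ny) :
    mv (Matrix.fromBlocks 1 0 0 0 : Matrix (ErrIx nz ny) (ErrIx nz ny) ℝ) e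
      + mv (Matrix.fromRows 0 (-1) : Matrix (ErrIx nz ny) (Fin ny) ℝ) η = stack (upper e) (-η) := by
  rw [← stack_upper_lower e]
  ext (i | i) <;>
    simp [stack, mv, upper, lower, Matrix.fromBlocks_mulVec, Matrix.fromRows_mulVec,
      Matrix.neg_mulVec]

lemma stE_eq_of_jump (h : (P.errorSystem T₁ T₂ L H).IsSolutionPair E φ u) (h₁ : (s, j) ∈ E)
    (h₂ : (s, j + 1) ∈ E) :
    stE (φ s (j + 1)) = stack (upper (stE (φ s j))) (-lower (u s j)) := by
  obtain ⟨-, v, -, hG⟩ := h.jump s j h₁ h₂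
  rw [hG, stE_mkState, errorSystem_resetMap]

lemma stτ_mem_of_jump (h : (P.errorSystem T₁ T₂ L H).IsSolutionPair E φ u) (h₁ : (s, j) ∈ E)
    (h₂ : (s, j + 1) ∈ E) : stτ (φ s j) = 0 ∧ stτ (φ s (j + 1)) ∈ Icc T₁ T₂ := by
  obtain ⟨hD, v, hv, hG⟩ := h.jump s j h₁ h₂
  exact ⟨hD, by rwa [hG, stτ_mkState]⟩

lemma stτ_mem_Icc_of_flow (h : (P.errorSystem T₁ T₂ L H).IsSolutionPair E φ u) (hab : a ≤ b)
    (hs : Icc a b ⊆ slice E j) (ha : stτ (φ a j) ∈ Icc 0 T₂) : stτ (φ b j) ∈ Icc 0 T₂ := by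
  rcases hab.eq_or_lt with rfl | hlt
  · exact ha
  have hcont : ContinuousOn (fun t => stτ (φ t j)) (Icc a b) :=
    stτL.continuous.comp_continuousOn (h.continuousOn hab hs)
  have hb : b ∈ closure (Ioo a b) := by rw [closure_Ioo hlt.ne]; exact right_mem_Icc.2 hab
  have hmaps : MapsTo (fun t => stτ (φ t j)) (Ioo a b) (Icc 0 T₂) := fun t ht =>
    h.flow_mem j t (Ioo_subset_interior_slice hs ht)
  exact isClosed_Icc.closure_subset
    (((hcont b (right_mem_Icc.2 hab)).mono Ioo_subset_Icc_self).mem_closure hb hmaps)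

lemma isTimer_stτ (hT₁ : 0 ≤ T₁) (hT : T₁ ≤ T₂)
    (h : (P.errorSystem T₁ T₂ L H).IsSolutionPair E φ u) :
    IsTimer T₁ T₂ E fun t j => stτ (φ t j) where
  mem t j ht := by
    refine h.domain.induction (Q := fun s j => stτ (φ s j) ∈ Icc 0 T₂) ?_
      (fun j a b hab hs ha => stτ_mem_Icc_of_flow h hab hs ha) ?_ ht
    · rcases h.initial with hC | hD
      · exact hC
      · have hτ_zero : stτ (φ 0 0) = 0 := hD
        rw [hτ_zero]
        exact left_mem_Icc.2 (hT₁.trans hT)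
    · exact fun t j h₁ h₂ _ => Icc_subset_Icc_left hT₁ (stτ_mem_of_jump h h₁ h₂).2
  flow j s t hst hs := by
    have hac := absolutelyContinuousOnInterval_comp_contDiff stτL.contDiff
      (h.absolutelyContinuousOnInterval hst hs)
    have hderiv : ∀ᵐ r, r ∈ Ioo s t → HasDerivAt (fun r => stτ (φ r j)) (-1) r := by
      filter_upwards [h.ae_hasDerivAt hs] with r hr hmem
      exact stτL.hasFDerivAt.comp_hasDerivAt r (hr hmem)
    have := sub_eq_mul_of_ae_hasDerivAt_const hst hac hderiv
    simp only [stτL_apply] at this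
    linarith
  jump t j h₁ h₂ := stτ_mem_of_jump h h₁ h₂

lemma ae_hasDerivAt_lyap {P₁ : Matrix (Fin nz) (Fin nz) ℝ} {P₂ : Matrix (Fin ny) (Fin ny) ℝ}
    (hP₁ : P₁.IsHermitian) (hP₂ : P₂.IsHermitian) (δ : ℝ)
    (h : (P.errorSystem T₁ T₂ L 0).IsSolutionPair E φ u) (hs : Icc a b ⊆ slice E j) :
    ∀ᵐ t, t ∈ Ioo a b → HasDerivAt (fun s => lyap P₁ P₂ δ (stE (φ s j)) (stτ (φ s j)))
      (lyapDot P₁ P₂ δ (stE (φ t j))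
        (errField P L (stZ (φ t j)) (stE (φ t j)) (upper (u t j))) (stτ (φ t j))) t := by
  filter_upwards [h.ae_hasDerivAt hs] with t ht hmem
  have hderiv := hasDerivAt_lyap hP₁ hP₂ δ (ht hmem) (stτ_errorSystem_f _ _)
  rwa [stE_errorSystem_f] at hderiv

lemma absolutelyContinuousOnInterval_lyap (P₁ : Matrix (Fin nz) (Fin nz) ℝ)
    (P₂ : Matrix (Fin ny) (Fin ny) ℝ) (δ : ℝ)
    (h : (P.errorSystem T₁ T₂ L H).IsSolutionPair E φ u) (hab : a ≤ b)
    (hs : Icc a b ⊆ slice E j) :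
    AbsolutelyContinuousOnInterval (fun s => lyap P₁ P₂ δ (stE (φ s j)) (stτ (φ s j))) a b :=
  absolutelyContinuousOnInterval_comp_contDiff (contDiff_lyap P₁ P₂ δ)
    (h.absolutelyContinuousOnInterval hab hs)

end ErrorSystem

section Flow

variable {n m : Type*} [Fintype n] [Fintype m] {𝓗 : HybridSystem n m} {E : Set (ℝ × ℕ)}
  {φ : ℝ → ℕ → EuclideanSpace ℝ n} {u : ℝ → ℕ → EuclideanSpace ℝ m} {a b r : ℝ}
  {x y : ℝ → EuclideanSpace ℝ n} {v w : ℝ → EuclideanSpace ℝ m}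

/-- `x` is a flow of `𝓗` with input `v` on the interval `I`: the requirements on a solution pair
that concern a single slice `I` of its domain. -/
structure HybridSystem.IsFlow (𝓗 : HybridSystem n m) (I : Set ℝ) (x : ℝ → EuclideanSpace ℝ n)
    (v : ℝ → EuclideanSpace ℝ m) : Prop where
  aemeasurable : AEMeasurable v (volume.restrict I)
  bounded : ∀ T : ℝ, ∃ M : ℝ, ∀ᵐ t, t ∈ I → t ≤ T → ‖v t‖ ≤ M
  arc : LocallyAC x I
  mem : ∀ t ∈ interior I, x t ∈ 𝓗.C
  hasDerivAt : ∀ᵐ t, t ∈ interior I → HasDerivAt x (𝓗.f (x t) (v t)) t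

lemma HybridSystem.IsSolutionPair.isFlow (h : 𝓗.IsSolutionPair E φ u) (j : ℕ) :
    𝓗.IsFlow (slice E j) (fun t => φ t j) (fun t => u t j) :=
  ⟨(h.input j).1, (h.input j).2, h.arc j, h.flow_mem j, h.flow j⟩

lemma HybridSystem.isFlow_singleton (𝓗 : HybridSystem n m) (r : ℝ) (x : ℝ → EuclideanSpace ℝ n)
    (v : ℝ → EuclideanSpace ℝ m) : 𝓗.IsFlow {r} x v where
  aemeasurable := by simp [Measure.restrict_singleton]
  bounded T := ⟨0, by
    filter_upwards [Measure.ae_ne volume r] with t ht hmem using absurd hmem ht⟩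
  arc a b hab hsub := by
    obtain rfl : a = r := hsub (left_mem_Icc.2 hab)
    obtain rfl : b = a := hsub (right_mem_Icc.2 hab)
    exact absolutelyContinuousOnInterval_congr
      (LipschitzWith.const (x b)).lipschitzOnWith.absolutelyContinuousOnInterval
      fun s hs => by simp_all
  mem := by simp
  hasDerivAt := by simp

lemma HybridSystem.isFlow_Icc (har : a ≤ r)
    (hx : AbsolutelyContinuousOnInterval x a r) (hC : ∀ t ∈ Ioo a r, x t ∈ 𝓗.C)
    (hx' : ∀ᵐ t, t ∈ Ioo a r → HasDerivAt x (𝓗.f (x t) (v t)) t)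
    (hv : AEMeasurable v (volume.restrict (Icc a r)))
    (hM : ∃ M : ℝ, ∀ᵐ t, t ∈ Icc a r → ‖v t‖ ≤ M) : 𝓗.IsFlow (Icc a r) x v where
  aemeasurable := hv
  bounded T := hM.imp fun M hM => hM.mono fun t ht hmem _ => ht hmem
  arc c d hcd hsub := hx.mono (by rwa [uIcc_of_le hcd, uIcc_of_le har])
  mem := by rwa [interior_Icc]
  hasDerivAt := by rwa [interior_Icc]

lemma piecewise_Iic_eqOn_Ici {F : Type*} {f g : ℝ → F} (h : f r = g r) :
    EqOn ((Iic r).piecewise f g) g (Ici r) := fun s hs => by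
  rcases (mem_Ici.1 hs).eq_or_lt with rfl | hs
  · rw [piecewise_eq_of_mem _ _ _ self_mem_Iic, h]
  · exact piecewise_eq_of_notMem _ _ _ (notMem_Iic.2 hs)

lemma aemeasurable_piecewise_Iic {F : Type*} [MeasurableSpace F] {f g : ℝ → F}
    (hf : AEMeasurable f (volume.restrict (Icc a r)))
    (hg : AEMeasurable g (volume.restrict (Icc r b))) :
    AEMeasurable ((Iic r).piecewise f g) (volume.restrict (Icc a b)) := by
  have hf' : AEMeasurable ((Iic r).piecewise f g) (volume.restrict (Icc a r)) :=
    hf.congr (ae_restrict_of_forall_mem measurableSet_Icc fun s hs =>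
      (piecewise_eq_of_mem _ _ _ (mem_Iic.2 hs.2)).symm)
  have hg' : AEMeasurable ((Iic r).piecewise f g) (volume.restrict (Ioc r b)) :=
    (hg.mono_set Ioc_subset_Icc_self).congr (ae_restrict_of_forall_mem measurableSet_Ioc
      fun s hs => (piecewise_eq_of_notMem _ _ _ (notMem_Iic.2 hs.1)).symm)
  exact (aemeasurable_union_iff.2 ⟨hf', hg'⟩).mono_set fun s hs =>
    (le_or_gt s r).imp (fun h => ⟨hs.1, h⟩) fun h => ⟨h, hs.2⟩

lemma HybridSystem.IsFlow.concat (hx : 𝓗.IsFlow (Icc a r) x v) (hy : 𝓗.IsFlow (Icc r b) y w)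
    (har : a ≤ r) (hrb : r ≤ b) (hxy : x r = y r) (hC : x r ∈ 𝓗.C) :
    𝓗.IsFlow (Icc a b) ((Iic r).piecewise x y) ((Iic r).piecewise v w) := by
  have hleft : EqOn ((Iic r).piecewise x y) x (Iic r) := piecewise_eqOn _ _ _
  have hright : EqOn ((Iic r).piecewise x y) y (Ici r) := piecewise_Iic_eqOn_Ici hxy
  have hvleft : EqOn ((Iic r).piecewise v w) v (Iic r) := piecewise_eqOn _ _ _
  have hvright : EqOn ((Iic r).piecewise v w) w (Ioi r) := fun s hs =>
    piecewise_eq_of_notMem _ _ _ (notMem_Iic.2 hs)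
  refine isFlow_Icc (har.trans hrb) (absolutelyContinuousOnInterval_trans har hrb
    (absolutelyContinuousOnInterval_congr (hx.arc a r har Subset.rfl) fun s hs =>
      (hleft (uIcc_of_le har ▸ hs).2).symm)
    (absolutelyContinuousOnInterval_congr (hy.arc r b hrb Subset.rfl) fun s hs =>
      (hright (uIcc_of_le hrb ▸ hs).1).symm)) (fun s hs => ?_) ?_
    (aemeasurable_piecewise_Iic hx.aemeasurable hy.aemeasurable) ?_
  · rcases lt_trichotomy s r with h | rfl | h
    · rw [hleft h.le]
      exact hx.mem s (by rw [interior_Icc]; exact ⟨hs.1, h⟩)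
    · rwa [hleft self_mem_Iic]
    · rw [hright h.le]
      exact hy.mem s (by rw [interior_Icc]; exact ⟨h, hs.2⟩)
  · have hx' := hx.hasDerivAt
    have hy' := hy.hasDerivAt
    simp only [interior_Icc] at hx' hy'
    filter_upwards [hx', hy', Measure.ae_ne volume r] with s hxs hys hne hs
    rcases hne.lt_or_gt with h | h
    · rw [hleft h.le, hvleft h.le]
      exact (hxs ⟨hs.1, h⟩).congr_of_eventuallyEq (hleft.eventuallyEq_of_mem (Iic_mem_nhds h))
    · rw [hright h.le, hvright h]
      exact (hys ⟨h, hs.2⟩).congr_of_eventuallyEq (hright.eventuallyEq_of_mem (Ici_mem_nhds h))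
  · obtain ⟨M, hM⟩ := hx.bounded r
    obtain ⟨M', hM'⟩ := hy.bounded b
    refine ⟨max M M', ?_⟩
    filter_upwards [hM, hM'] with s hs hs' hmem
    rcases le_or_gt s r with h | h
    · exact hvleft h ▸ (hs ⟨hmem.1, h⟩ h).trans (le_max_left _ _)
    · exact hvright h ▸ (hs' ⟨h.le, hmem.2⟩ hmem.2).trans (le_max_right _ _)

lemma exists_hasDerivAt_of_lipschitzWith {K : NNReal} {F : EuclideanSpace ℝ n → EuclideanSpace ℝ n}
    (hF : LipschitzWith K F) (x₀ : EuclideanSpace ℝ n) (r : ℝ) {h₀ : ℝ} (hh₀ : 0 < h₀) :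
    ∃ h : ℝ, 0 < h ∧ h ≤ h₀ ∧ ∃ α : ℝ → EuclideanSpace ℝ n, α r = x₀ ∧
      AbsolutelyContinuousOnInterval α r (r + h) ∧
      ∀ s ∈ Ioo r (r + h), HasDerivAt α (F (α s)) s := by
  set A : NNReal := ‖F x₀‖₊ + K with hA
  set h : ℝ := min h₀ (1 / (A + 1))
  have hpos : 0 < h := lt_min hh₀ (by positivity)
  have hbound : ∀ x ∈ Metric.closedBall x₀ ((1 : NNReal) : ℝ), ‖F x‖ ≤ A := fun x hx =>
    calc ‖F x‖ ≤ ‖F x - F x₀‖ + ‖F x₀‖ := norm_le_norm_sub_add _ _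
      _ ≤ K * 1 + ‖F x₀‖ := by
          gcongr
          exact (hF.norm_sub_le x x₀).trans (by gcongr; exact mem_closedBall_iff_norm.1 hx)
      _ = A := by rw [hA]; push_cast; ring
  have hPL : IsPicardLindelof (fun _ => F) (tmin := r) (tmax := r + h)
      ⟨r, le_rfl, by linarith⟩ x₀ 1 0 A K := by
    refine IsPicardLindelof.of_time_independent hbound hF.lipschitzOnWith ?_
    simp only [add_sub_cancel_left, sub_self, NNReal.coe_one, NNReal.coe_zero, sub_zero]
    rw [max_eq_left hpos.le]
    calc (A : ℝ) * h ≤ A * (1 / (A + 1)) := by gcongr; exact min_le_right _ _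
      _ ≤ 1 := by rw [mul_one_div, div_le_one (by positivity)]; linarith
  obtain ⟨α, hα₀, hα⟩ := hPL.exists_eq_forall_mem_Icc_hasDerivWithinAt₀
  have hcont : ContinuousOn (fun s => F (α s)) (Icc r (r + h)) :=
    hF.continuous.comp_continuousOn fun s hs => (hα s hs).continuousWithinAt
  obtain ⟨M, hM⟩ := isCompact_Icc.exists_bound_of_continuousOn hcont
  have hlip : LipschitzOnWith M.toNNReal α (Icc r (r + h)) :=
    Convex.lipschitzOnWith_of_nnnorm_hasDerivWithin_le (convex_Icc _ _) hα fun s hs =>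
      NNReal.coe_le_coe.1 ((hM s hs).trans (Real.le_coe_toNNReal M))
  refine ⟨h, hpos, min_le_left _ _, α, hα₀, ?_, fun s hs =>
    (hα s (Ioo_subset_Icc_self hs)).hasDerivAt (Icc_mem_nhds hs.1 hs.2)⟩
  exact LipschitzOnWith.absolutelyContinuousOnInterval (by rwa [uIcc_of_le (by linarith)])

lemma exists_norm_le_mul_of_lipschitzWith {X U F : Type*} [NormedAddCommGroup X]
    [NormedAddCommGroup U] [NormedAddCommGroup F] {K : NNReal} {f : X → U → F}
    (hf : LipschitzWith K fun p : X × U => f p.1 p.2) (M : ℝ) :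
    ∃ c : ℝ, 0 < c ∧ ∀ x v, ‖v‖ ≤ M → ‖f x v‖ ≤ c * (1 + ‖x‖) := by
  refine ⟨‖f 0 0‖ + K * (1 + |M|) + 1, by positivity, fun x v hv => ?_⟩
  have hxv : ‖(x, v)‖ ≤ ‖x‖ + |M| :=
    max_le (le_add_of_nonneg_right (abs_nonneg _))
      ((hv.trans (le_abs_self _)).trans (le_add_of_nonneg_left (norm_nonneg _)))
  have hdist : ‖f x v - f 0 0‖ ≤ K * ‖(x, v)‖ := by simpa using hf.norm_sub_le (x, v) 0
  calc ‖f x v‖ ≤ ‖f x v - f 0 0‖ + ‖f 0 0‖ := norm_le_norm_sub_add _ _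
    _ ≤ K * (‖x‖ + |M|) + ‖f 0 0‖ := by gcongr; exact hdist.trans (by gcongr)
    _ ≤ (‖f 0 0‖ + K * (1 + |M|) + 1) * (1 + ‖x‖) := by
        have : 0 ≤ ‖f 0 0‖ * ‖x‖ + K * |M| * ‖x‖ + K + 1 + ‖x‖ := by positivity
        linarith

lemma norm_sq_le_exp_mul_of_linear_growth {x' : ℝ → EuclideanSpace ℝ n} {c : ℝ}
    (hc : 0 < c) (hab : a ≤ b) (hx : AbsolutelyContinuousOnInterval x a b)
    (hx' : ∀ᵐ t, t ∈ Ioo a b → HasDerivAt x (x' t) t ∧ ‖x' t‖ ≤ c * (1 + ‖x t‖)) :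
    1 + ‖x b‖ ^ 2 ≤ Real.exp (4 * c * (b - a)) * (1 + ‖x a‖ ^ 2) := by
  have hsq : AbsolutelyContinuousOnInterval (fun t => 1 + ‖x t‖ ^ 2) a b :=
    absolutelyContinuousOnInterval_comp_contDiff (g := fun y => 1 + ‖y‖ ^ 2)
      (contDiff_const.add (contDiff_norm_sq ℝ)) hx
  have hderiv : ∀ᵐ t, t ∈ Ioo a b → HasDerivAt (fun t => 1 + ‖x t‖ ^ 2)
      (2 * inner ℝ (x t) (x' t)) t ∧
        2 * inner ℝ (x t) (x' t) ≤ -(-(4 * c)) * (1 + ‖x t‖ ^ 2) + 0 := by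
    filter_upwards [hx'] with t ht hmem
    obtain ⟨hd, hle⟩ := ht hmem
    refine ⟨hd.norm_sq.const_add 1, ?_⟩
    have hinner : inner ℝ (x t) (x' t) ≤ ‖x t‖ * (c * (1 + ‖x t‖)) :=
      (real_inner_le_norm _ _).trans (by gcongr)
    nlinarith [mul_nonneg hc.le (sq_nonneg (‖x t‖ - 1))]
  simpa using le_exp_mul_add_of_ae_hasDerivAt (by linarith) hab hsq hderiv

lemma HybridSystem.IsFlow.ae_hasDerivAt_and_norm_le {K : NNReal}
    (hf : LipschitzWith K fun p : EuclideanSpace ℝ n × EuclideanSpace ℝ m => 𝓗.f p.1 p.2)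
    (hx : 𝓗.IsFlow (Ico a b) x v) :
    ∃ c : ℝ, 0 < c ∧ ∀ᵐ s, s ∈ Ioo a b →
      HasDerivAt x (𝓗.f (x s) (v s)) s ∧ ‖𝓗.f (x s) (v s)‖ ≤ c * (1 + ‖x s‖) := by
  obtain ⟨M, hM⟩ := hx.bounded b
  obtain ⟨c, hc, hgrow⟩ := exists_norm_le_mul_of_lipschitzWith hf M
  refine ⟨c, hc, ?_⟩
  filter_upwards [hx.hasDerivAt, hM] with s hs hMs hmem
  exact ⟨hs (by rwa [interior_Ico]), hgrow _ _ (hMs (Ioo_subset_Ico_self hmem) hmem.2.le)⟩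

lemma HybridSystem.IsFlow.exists_norm_le {K : NNReal}
    (hf : LipschitzWith K fun p : EuclideanSpace ℝ n × EuclideanSpace ℝ m => 𝓗.f p.1 p.2)
    (hx : 𝓗.IsFlow (Ico a b) x v) : ∃ R : ℝ, ∀ s ∈ Ico a b, ‖x s‖ ≤ R := by
  obtain ⟨c, hc, hderiv⟩ := hx.ae_hasDerivAt_and_norm_le hf
  refine ⟨Real.exp (4 * c * (b - a)) * (1 + ‖x a‖ ^ 2), fun s hs => ?_⟩
  calc ‖x s‖ ≤ 1 + ‖x s‖ ^ 2 := by nlinarith [sq_nonneg (‖x s‖ - 1)]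
    _ ≤ Real.exp (4 * c * (s - a)) * (1 + ‖x a‖ ^ 2) :=
        norm_sq_le_exp_mul_of_linear_growth hc hs.1
          (hx.arc a s hs.1 (Icc_subset_Ico_right hs.2))
          (hderiv.mono fun t ht hmem => ht ⟨hmem.1, hmem.2.trans hs.2⟩)
    _ ≤ Real.exp (4 * c * (b - a)) * (1 + ‖x a‖ ^ 2) := by gcongr; exact hs.2.le

lemma HybridSystem.IsFlow.exists_lipschitzOnWith {K : NNReal}
    (hf : LipschitzWith K fun p : EuclideanSpace ℝ n × EuclideanSpace ℝ m => 𝓗.f p.1 p.2)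
    (hx : 𝓗.IsFlow (Ico a b) x v) : ∃ K' : NNReal, LipschitzOnWith K' x (Ico a b) := by
  obtain ⟨R, hR⟩ := hx.exists_norm_le hf
  obtain ⟨c, hc, hderiv⟩ := hx.ae_hasDerivAt_and_norm_le hf
  have hle : ∀ s ∈ Ico a b, ∀ t ∈ Ico a b, s ≤ t → ‖x t - x s‖ ≤ c * (1 + R) * (t - s) := by
    intro s hs t ht hst
    refine norm_sub_le_of_ae_hasDerivAt (f' := fun r => 𝓗.f (x r) (v r)) hst
      (hx.arc s t hst fun r hr => ⟨hs.1.trans hr.1, hr.2.trans_lt ht.2⟩) ?_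
    filter_upwards [hderiv] with r hr hmem
    have hmem' : r ∈ Ioo a b := ⟨hs.1.trans_lt hmem.1, hmem.2.trans ht.2⟩
    refine ⟨(hr hmem').1, (hr hmem').2.trans ?_⟩
    gcongr
    exact hR r (Ioo_subset_Ico_self hmem')
  refine ⟨(c * (1 + R)).toNNReal, LipschitzOnWith.of_dist_le_mul fun s hs t ht => ?_⟩
  refine le_trans ?_ (mul_le_mul_of_nonneg_right (Real.le_coe_toNNReal _) dist_nonneg)
  rcases le_total s t with hst | hst
  · rw [dist_comm, dist_comm s t, dist_eq_norm, Real.dist_eq, abs_of_nonneg (sub_nonneg.2 hst)]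
    exact hle s hs t ht hst
  · rw [dist_eq_norm, Real.dist_eq, abs_of_nonneg (sub_nonneg.2 hst)]
    exact hle t ht s hs hst

-- Linear growth rules out finite escape, so the flow is Lipschitz and extends to the endpoint.
lemma HybridSystem.IsFlow.exists_eqOn_isFlow_Icc {K : NNReal}
    (hf : LipschitzWith K fun p : EuclideanSpace ℝ n × EuclideanSpace ℝ m => 𝓗.f p.1 p.2)
    (hab : a ≤ b) (hx : 𝓗.IsFlow (Ico a b) x v) :
    ∃ y, EqOn y x (Ico a b) ∧ 𝓗.IsFlow (Icc a b) y v := by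
  obtain ⟨K', hK'⟩ := hx.exists_lipschitzOnWith hf
  obtain ⟨y, hy, heq⟩ := hK'.extend_finite_dimension
  refine ⟨y, heq.symm, isFlow_Icc hab hy.lipschitzOnWith.absolutelyContinuousOnInterval
    (fun s hs => ?_) ?_
    (by rw [← Measure.restrict_congr_set Ico_ae_eq_Icc]; exact hx.aemeasurable) ?_⟩
  · rw [← heq (Ioo_subset_Ico_self hs)]
    exact hx.mem s (by rwa [interior_Ico])
  · filter_upwards [hx.hasDerivAt] with s hs hmem
    rw [interior_Ico] at hs
    rw [← heq (Ioo_subset_Ico_self hmem)]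
    exact (hs hmem).congr_of_eventuallyEq
      (heq.symm.eventuallyEq_of_mem (Ico_mem_nhds hmem.1 hmem.2))
  · obtain ⟨M, hM⟩ := hx.bounded b
    refine ⟨M, ?_⟩
    filter_upwards [hM, Measure.ae_ne volume b] with s hs hne hmem
    exact hs ⟨hmem.1, hmem.2.lt_of_ne hne⟩ hmem.2

end Flow

section Extension

variable {n m : Type*} [Fintype n] [Fintype m] {𝓗 : HybridSystem n m} {E : Set (ℝ × ℕ)}
  {φ : ℝ → ℕ → EuclideanSpace ℝ n} {u : ℝ → ℕ → EuclideanSpace ℝ m}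
  {x : ℝ → EuclideanSpace ℝ n} {v : ℝ → EuclideanSpace ℝ m} {t : ℕ → ℝ} {J : ℕ} {r : ℝ}

lemma HybridSystem.isSolutionPair_of_isFlow (hE : IsHybridTimeDomain E)
    (hflow : ∀ j, 𝓗.IsFlow (slice E j) (fun t => φ t j) fun t => u t j)
    (h₀ : φ 0 0 ∈ 𝓗.C ∪ 𝓗.D)
    (hjump : ∀ t j, (t, j) ∈ E → (t, j + 1) ∈ E →
      φ t j ∈ 𝓗.D ∧ φ t (j + 1) ∈ 𝓗.G (φ t j) (u t j)) : 𝓗.IsSolutionPair E φ u where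
  domain := hE
  input j := ⟨(hflow j).aemeasurable, (hflow j).bounded⟩
  arc j := (hflow j).arc
  initial := h₀
  flow_mem j := (hflow j).mem
  flow j := (hflow j).hasDerivAt
  jump := hjump

lemma HybridSystem.IsSolutionPair.not_isMaximal_of_isFlow (h : 𝓗.IsSolutionPair E φ u)
    {E' : Set (ℝ × ℕ)} (hE' : IsHybridTimeDomain E') (hEE' : E ⊂ E')
    (hslice : ∀ j ≠ J, slice E' j = slice E j) (hsucc : slice E' (J + 1) = ∅)
    (hflow : 𝓗.IsFlow (slice E' J) x v) (hx : EqOn x (fun s => φ s J) (slice E J))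
    (hv : EqOn v (fun s => u s J) (slice E J))
    (hjump : ∀ j, j + 1 = J → ∀ s ∈ slice E j, s ∈ slice E' J →
      φ s j ∈ 𝓗.D ∧ x s ∈ 𝓗.G (φ s j) (u s j)) :
    ¬ 𝓗.IsMaximal E φ u := by
  set φ' : ℝ → ℕ → EuclideanSpace ℝ n := fun s => Function.update (φ s) J (x s) with hφ'
  set u' : ℝ → ℕ → EuclideanSpace ℝ m := fun s => Function.update (u s) J (v s) with hu'
  have heq : ∀ p ∈ E, φ' p.1 p.2 = φ p.1 p.2 ∧ u' p.1 p.2 = u p.1 p.2 := by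
    rintro ⟨s, j⟩ hs
    rcases eq_or_ne j J with rfl | hj
    · simpa [φ', u'] using ⟨hx hs, hv hs⟩
    · simp [φ', u', hj]
  refine fun hmax => hmax.2 ⟨E', φ', u', isSolutionPair_of_isFlow hE' (fun j => ?_) ?_ ?_, hEE',
    heq⟩
  · rcases eq_or_ne j J with rfl | hj
    · simpa only [hφ', hu', Function.update_self] using hflow
    · simpa only [hφ', hu', Function.update_of_ne hj, hslice j hj] using h.isFlow j
  · rw [(heq (0, 0) h.domain.zero_mem).1]
    exact h.initial
  · intro s j h₁ h₂
    have hj : j ≠ J := by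
      rintro rfl
      exact hsucc.subset h₂
    have h₁' : (s, j) ∈ E := (hslice j hj).subset h₁
    rw [(heq _ h₁').1, (heq _ h₁').2]
    rcases eq_or_ne (j + 1) J with rfl | hj'
    · simpa only [hφ', Function.update_self] using hjump j rfl s h₁' h₂
    · have h₂' : (s, j + 1) ∈ E := (hslice _ hj').subset h₂
      rw [(heq _ h₂').1]
      exact h.jump s j h₁' h₂'

/-- The sequence of times `t` frozen at the value `r` after the index `J`: it turns `r` into the
right endpoint of a last interval with left endpoint `t J`. -/
def stopAt (t : ℕ → ℝ) (J : ℕ) (r : ℝ) (i : ℕ) : ℝ := if i ≤ J then t i else r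

lemma stopAt_of_le {i : ℕ} (hi : i ≤ J) : stopAt t J r i = t i := if_pos hi

lemma stopAt_of_lt {i : ℕ} (hi : J < i) : stopAt t J r i = r := if_neg hi.not_ge

lemma monotone_stopAt (ht : Monotone t) (hr : t J ≤ r) : Monotone (stopAt t J r) := by
  intro i k hik
  rcases le_or_gt k J with hk | hk
  · rw [stopAt_of_le (hik.trans hk), stopAt_of_le hk]
    exact ht hik
  · rw [stopAt_of_lt hk]
    rcases le_or_gt i J with hi | hi
    · rw [stopAt_of_le hi]
      exact (ht hi).trans hr
    · rw [stopAt_of_lt hi]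

lemma finiteDomain_congr {t' : ℕ → ℝ} (h : ∀ i ≤ J, t i = t' i) (I : Set ℝ) :
    finiteDomain t J I = finiteDomain t' J I := by
  ext ⟨s, j⟩
  refine or_congr (and_congr_right fun hj => ?_) Iff.rfl
  rw [h j (le_of_lt hj), h (j + 1) hj]

lemma isHybridTimeDomain_finiteDomain_Icc (ht₀ : t 0 = 0) (ht : Monotone t) (hr : t J ≤ r) :
    IsHybridTimeDomain (finiteDomain t J (Icc (t J) r)) := by
  refine ⟨stopAt t J r, (stopAt_of_le (Nat.zero_le J)).trans ht₀, monotone_stopAt ht hr,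
    Or.inr ⟨J, Icc (t J) r, Or.inl ?_, ?_⟩⟩
  · rw [stopAt_of_le le_rfl, stopAt_of_lt J.lt_succ_self]
  · exact finiteDomain_congr (fun i hi => (stopAt_of_le hi).symm) _

lemma isHybridTimeDomain_finiteDomain_stopAt (ht₀ : t 0 = 0) (ht : Monotone t) (hr : t J ≤ r) :
    IsHybridTimeDomain (finiteDomain (stopAt t J r) (J + 1) {r}) := by
  have hJ : stopAt t J r (J + 1) = r := stopAt_of_lt J.lt_succ_self
  have := isHybridTimeDomain_finiteDomain_Icc (t := stopAt t J r) (J := J + 1) (r := r)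
    ((stopAt_of_le (Nat.zero_le J)).trans ht₀) (monotone_stopAt ht hr) hJ.le
  rwa [hJ, Icc_self] at this

lemma finiteDomain_stopAt_succ (t : ℕ → ℝ) (J : ℕ) (r : ℝ) :
    finiteDomain (stopAt t J r) (J + 1) {r} =
      insert (r, J + 1) (finiteDomain t J (Icc (t J) r)) := by
  ext ⟨s, j⟩
  simp only [finiteDomain, mem_ofPred_eq, mem_insert_iff, Prod.mk.injEq, mem_singleton_iff]
  rcases lt_trichotomy j J with hj | rfl | hj
  · simp [stopAt, hj, hj.le, hj.ne, (hj.trans J.lt_succ_self).ne,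
      hj.trans J.lt_succ_self]
  · simp [stopAt]
  · simp [hj.not_gt, hj.ne', Nat.not_lt.2 (Nat.succ_le_of_lt hj), and_comm]

lemma HybridSystem.IsSolutionPair.not_isMaximal_of_extend {I : Set ℝ} (ht₀ : t 0 = 0)
    (ht : Monotone t) (hJ : t J ∈ I) (hI : I ⊂ Icc (t J) r)
    (h : 𝓗.IsSolutionPair (finiteDomain t J I) φ u) (hflow : 𝓗.IsFlow (Icc (t J) r) x v)
    (hx : EqOn x (fun s => φ s J) I) (hv : EqOn v (fun s => u s J) I) :
    ¬ 𝓗.IsMaximal (finiteDomain t J I) φ u := by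
  have hself : ∀ I, slice (finiteDomain t J I) J = I := slice_finiteDomain_self t J
  have hr : t J ≤ r := (hI.subset hJ).2
  refine h.not_isMaximal_of_isFlow (J := J) (isHybridTimeDomain_finiteDomain_Icc ht₀ ht hr)
    ⟨fun p => Or.imp_right (And.imp_right fun hs => hI.subset hs), fun hcon => hI.2 fun s hs => ?_⟩
    (fun j hj => ?_) (slice_finiteDomain_of_gt t _ J.lt_succ_self) (by rwa [hself])
    (by rwa [hself]) (by rwa [hself]) ?_
  · simpa [finiteDomain] using hcon (show (s, J) ∈ finiteDomain t J (Icc (t J) r) from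
      Or.inr ⟨rfl, hs⟩)
  · ext s
    simp [slice, finiteDomain, hj]
  · rintro j rfl s hs hs'
    rw [slice_finiteDomain_of_lt t _ j.lt_succ_self] at hs
    rw [hself] at hs'
    obtain rfl : s = t (j + 1) := le_antisymm hs.2 hs'.1
    rw [hx hJ]
    exact h.jump _ j (Or.inl ⟨j.lt_succ_self, hs⟩) (Or.inr ⟨rfl, hJ⟩)

lemma HybridSystem.IsSolutionPair.not_isMaximal_of_jump (ht₀ : t 0 = 0) (ht : Monotone t)
    (hr : t J ≤ r) (h : 𝓗.IsSolutionPair (finiteDomain t J (Icc (t J) r)) φ u)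
    (hD : φ r J ∈ 𝓗.D) (hG : (𝓗.G (φ r J) (u r J)).Nonempty) :
    ¬ 𝓗.IsMaximal (finiteDomain t J (Icc (t J) r)) φ u := by
  obtain ⟨g, hg⟩ := hG
  set E := finiteDomain t J (Icc (t J) r) with hE
  have hempty : slice E (J + 1) = ∅ := slice_finiteDomain_of_gt t _ J.lt_succ_self
  have hE' := finiteDomain_stopAt_succ t J r
  have hself : slice (finiteDomain (stopAt t J r) (J + 1) {r}) (J + 1) = {r} :=
    slice_finiteDomain_self _ _ _
  refine h.not_isMaximal_of_isFlow (J := J + 1) (x := fun _ => g) (v := fun _ => 0)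
    (isHybridTimeDomain_finiteDomain_stopAt ht₀ ht hr)
    (hE' ▸ ssubset_insert fun hcon => hempty.subset hcon) (fun j hj => ?_)
    (slice_finiteDomain_of_gt _ _ (J + 1).lt_succ_self)
    (by rw [hself]; exact 𝓗.isFlow_singleton r _ _) (by simp [hempty]) (by simp [hempty]) ?_
  · rw [hE']
    ext s
    simp [slice, hj, hE]
  · rintro j hj s - hs
    obtain rfl : j = J := Nat.succ_injective hj
    obtain rfl : s = r := hself.subset hs
    exact ⟨hD, hg⟩

lemma HybridSystem.not_isMaximal_of_Ico {K : NNReal}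
    (hf : LipschitzWith K fun p : EuclideanSpace ℝ n × EuclideanSpace ℝ m => 𝓗.f p.1 p.2)
    (ht₀ : t 0 = 0) (ht : Monotone t) (hr : t J < r)
    (h : 𝓗.IsSolutionPair (finiteDomain t J (Ico (t J) r)) φ u) :
    ¬ 𝓗.IsMaximal (finiteDomain t J (Ico (t J) r)) φ u := by
  have hflow := h.isFlow J
  rw [slice_finiteDomain_self] at hflow
  obtain ⟨y, hy, hyflow⟩ := hflow.exists_eqOn_isFlow_Icc hf hr.le
  exact h.not_isMaximal_of_extend ht₀ ht (left_mem_Ico.2 hr)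
    ⟨Ico_subset_Icc_self, fun hcon => (hcon (right_mem_Icc.2 hr.le)).2.false⟩ hyflow hy
    fun s _ => rfl

end Extension

section Completeness

variable {nz ny nw nq ns np : ℕ} {P : Plant nz ny nw nq ns np} {T₁ T₂ : ℝ}
  {L : Matrix (Fin nz) (Fin ny) ℝ} {H : Matrix (Fin ny) (Fin ny) ℝ}

lemma exists_lipschitzWith_errorSystem_f (T₁ T₂ : ℝ) (L : Matrix (Fin nz) (Fin ny) ℝ)
    (H : Matrix (Fin ny) (Fin ny) ℝ) {K : NNReal} (hψ : LipschitzWith K P.ψ) :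
    ∃ K' : NNReal, LipschitzWith K'
      fun p : EuclideanSpace ℝ (StateIx nz ny) × EuclideanSpace ℝ (Fin nw ⊕ Fin ny) =>
        (P.errorSystem T₁ T₂ L H).f p.1 p.2 := by
  let X := EuclideanSpace ℝ (StateIx nz ny)
  let U := EuclideanSpace ℝ (Fin nw ⊕ Fin ny)
  let z : X × U →L[ℝ] Vec nz := upperL.comp (ContinuousLinearMap.fst ℝ X U)
  let e : X × U →L[ℝ] EuclideanSpace ℝ (ErrIx nz ny) := stEL.comp (ContinuousLinearMap.fst ℝ X U)
  let w : X × U →L[ℝ] Vec nw := upperL.comp (ContinuousLinearMap.snd ℝ X U)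
  have hψS (g : X × U →L[ℝ] Vec nz) := hψ.comp ((mvL P.S).comp g).lipschitz
  have hz := (((mvL P.A).comp z).lipschitz.add ((mvL P.B).lipschitz.comp (hψS z))).add
    ((mvL P.N).comp w).lipschitz
  have he := (((mvL (P.matF L H)).comp e).lipschitz.add ((mvL P.matQ).lipschitz.comp
    ((hψS z).sub (hψS (z - upperL.comp e))))).add ((mvL P.matT).comp w).lipschitz
  have hτ : LipschitzWith 0 fun _ : X × U => (WithLp.toLp 2 fun _ => -1 : EuclideanSpace ℝ Unit) :=
    LipschitzWith.const _
  exact ⟨_, stackL.lipschitz.comp (hz.prodMk (stackL.lipschitz.comp (he.prodMk hτ)))⟩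

lemma exists_isFlow_errorSystem {K : NNReal} (hψ : LipschitzWith K P.ψ)
    {x₀ : EuclideanSpace ℝ (StateIx nz ny)} (hx₀ : stτ x₀ ∈ Ioc 0 T₂) (r : ℝ) :
    ∃ h : ℝ, 0 < h ∧ ∃ α, α r = x₀ ∧
      (P.errorSystem T₁ T₂ L H).IsFlow (Icc r (r + h)) α fun _ => 0 := by
  obtain ⟨K', hK'⟩ := exists_lipschitzWith_errorSystem_f T₁ T₂ L H hψ
  obtain ⟨h, hpos, hle, α, hα₀, hac, hα⟩ := exists_hasDerivAt_of_lipschitzWith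
    (hK'.comp (LipschitzWith.prodMk_right 0)) x₀ r hx₀.1
  refine ⟨h, hpos, α, hα₀, HybridSystem.isFlow_Icc (by linarith) hac (fun s hs => ?_)
    (ae_of_all _ hα) aemeasurable_const ⟨0, by simp⟩⟩
  have hderiv : ∀ y ∈ Ioo r s, HasDerivAt (fun y => stτ (α y)) (-1) y := fun y hy =>
    stτL.hasFDerivAt.comp_hasDerivAt y (hα y ⟨hy.1, hy.2.trans hs.2⟩)
  have hτ : stτ (α s) - stτ (α r) = -1 * (s - r) :=
    sub_eq_mul_of_ae_hasDerivAt_const hs.1.le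
      (absolutelyContinuousOnInterval_comp_contDiff stτL.contDiff (hac.mono (by
        rw [uIcc_of_le hs.1.le, uIcc_of_le (by linarith)]; exact Icc_subset_Icc_right hs.2.le)))
      (ae_of_all _ hderiv)
  rw [hα₀] at hτ
  exact ⟨by linarith [hs.2], by linarith [hs.1, hx₀.2]⟩

variable {φ : ℝ → ℕ → EuclideanSpace ℝ (StateIx nz ny)}
  {u : ℝ → ℕ → EuclideanSpace ℝ (Fin nw ⊕ Fin ny)} {t : ℕ → ℝ} {J : ℕ} {r : ℝ}

lemma not_isMaximal_of_stτ_mem_Ioc {K : NNReal} (hψ : LipschitzWith K P.ψ) (ht₀ : t 0 = 0)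
    (ht : Monotone t) (hr : t J ≤ r)
    (h : (P.errorSystem T₁ T₂ L H).IsSolutionPair (finiteDomain t J (Icc (t J) r)) φ u)
    (hτ : stτ (φ r J) ∈ Ioc 0 T₂) :
    ¬ (P.errorSystem T₁ T₂ L H).IsMaximal (finiteDomain t J (Icc (t J) r)) φ u := by
  obtain ⟨d, hd, α, hα₀, hα⟩ := exists_isFlow_errorSystem (T₁ := T₁) (L := L) (H := H) hψ hτ r
  have hflow := h.isFlow J
  rw [slice_finiteDomain_self] at hflow
  have hconcat := hflow.concat hα hr (by linarith) hα₀.symm (Ioc_subset_Icc_self hτ)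
  refine h.not_isMaximal_of_extend ht₀ ht (left_mem_Icc.2 hr)
    ⟨Icc_subset_Icc_right (by linarith), fun hcon => ?_⟩ hconcat
    ((piecewise_eqOn _ _ _).mono Icc_subset_Iic_self)
    ((piecewise_eqOn _ _ _).mono Icc_subset_Iic_self)
  linarith [(hcon (right_mem_Icc.2 (by linarith : t J ≤ r + d))).2]

lemma isCompleteDomain_of_isMaximal {K : NNReal} (hψ : LipschitzWith K P.ψ) (hT₁ : 0 ≤ T₁)
    (hT : T₁ ≤ T₂) {E : Set (ℝ × ℕ)} (hmax : (P.errorSystem T₁ T₂ L H).IsMaximal E φ u) :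
    HybridSystem.IsCompleteDomain E := by
  have h := hmax.1
  have hτ := (isTimer_stτ hT₁ hT h).mem
  intro R
  obtain ⟨t, ht₀, ht, rfl | ⟨J, I, hI, hE⟩⟩ := h.domain
  · obtain ⟨N, hN⟩ := exists_nat_ge R
    have htN : 0 ≤ t N := ht₀.symm.le.trans (ht (Nat.zero_le N))
    exact ⟨(t N, N), left_mem_Icc.2 (ht (Nat.le_succ N)), hN.trans (le_add_of_nonneg_left htN)⟩
  change E = finiteDomain t J I at hE
  subst hE
  rcases hI with rfl | ⟨hlt, rfl⟩ | rfl
  · have hJ : t J ≤ t (J + 1) := ht (Nat.le_succ J)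
    have hmem := hτ (t (J + 1)) J (Or.inr ⟨rfl, right_mem_Icc.2 hJ⟩)
    rcases hmem.1.eq_or_lt with hzero | hpos
    · exact absurd hmax (h.not_isMaximal_of_jump ht₀ ht hJ hzero.symm
        ⟨_, T₁, left_mem_Icc.2 hT, rfl⟩)
    · exact absurd hmax (not_isMaximal_of_stτ_mem_Ioc hψ ht₀ ht hJ h ⟨hpos, hmem.2⟩)
  · obtain ⟨K', hK'⟩ := exists_lipschitzWith_errorSystem_f T₁ T₂ L H hψ
    exact absurd hmax (HybridSystem.not_isMaximal_of_Ico hK' ht₀ ht hlt h)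
  · exact ⟨(max (t J) R, J), Or.inr ⟨rfl, mem_Ici.2 (le_max_left _ _)⟩,
      (le_max_right _ _).trans (le_add_of_nonneg_right (Nat.cast_nonneg J))⟩

end Completeness

section Stability

variable {nz ny nw nq ns np : ℕ} {P : Plant nz ny nw nq ns np} {T₁ T₂ lamt γ δ : ℝ}
  {L : Matrix (Fin nz) (Fin ny) ℝ} {P₁ : Matrix (Fin nz) (Fin nz) ℝ}
  {P₂ : Matrix (Fin ny) (Fin ny) ℝ} {E : Set (ℝ × ℕ)}
  {φ : ℝ → ℕ → EuclideanSpace ℝ (StateIx nz ny)}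
  {u : ℝ → ℕ → EuclideanSpace ℝ (Fin nw ⊕ Fin ny)}

/-- `lyap P₁ P₂ δ` is a Lyapunov function for `𝓗ₑ` with gains `L` and `0`: it is positive definite
and satisfies the dissipation inequality at every value of the timer. -/
structure IsDissipative (P : Plant nz ny nw nq ns np) (T₁ T₂ lamt γ : ℝ)
    (L : Matrix (Fin nz) (Fin ny) ℝ) (P₁ : Matrix (Fin nz) (Fin nz) ℝ)
    (P₂ : Matrix (Fin ny) (Fin ny) ℝ) (δ : ℝ) : Prop where
  T₁_pos : 0 < T₁
  T₁_le : T₁ ≤ T₂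
  lamt_pos : 0 < lamt
  γ_pos : 0 < γ
  δ_pos : 0 < δ
  posDef₁ : P₁.PosDef
  posDef₂ : P₂.PosDef
  dissipativeAt : ∀ τ ∈ Icc 0 T₂, IsDissipativeAt P L lamt γ P₁ P₂ δ τ

/-- `W` bounds, for the hybrid input `u = (w, η)`, the disturbance `w` along flows and the noise `η`
at jumps, the only times at which `𝓗ₑ` depends on them. -/
structure IsInputBound (E : Set (ℝ × ℕ)) (u : ℝ → ℕ → EuclideanSpace ℝ (Fin nw ⊕ Fin ny))
    (W : ℝ) : Prop where
  nonneg : 0 ≤ W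
  flow : ∀ j, ∀ᵐ t, t ∈ interior (slice E j) → ‖upper (u t j)‖ ≤ W
  jump : ∀ t j, (t, j) ∈ E → (t, j + 1) ∈ E → ‖lower (u t j)‖ ≤ W

lemma norm_upper_le {ι κ : Type*} [Fintype ι] [Fintype κ] (x : EuclideanSpace ℝ (ι ⊕ κ)) :
    ‖upper x‖ ≤ ‖x‖ :=
  le_of_sq_le_sq (by rw [norm_sq_eq_upper_add_lower x]; linarith [sq_nonneg ‖lower x‖])
    (norm_nonneg _)

lemma norm_lower_le {ι κ : Type*} [Fintype ι] [Fintype κ] (x : EuclideanSpace ℝ (ι ⊕ κ)) :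
    ‖lower x‖ ≤ ‖x‖ :=
  le_of_sq_le_sq (by rw [norm_sq_eq_upper_add_lower x]; linarith [sq_nonneg ‖upper x‖])
    (norm_nonneg _)

lemma isInputBound_zero (hu : ∀ p ∈ E, u p.1 p.2 = 0) : IsInputBound E u 0 where
  nonneg := le_rfl
  flow j := ae_of_all _ fun t ht => by
    have hmem : t ∈ slice E j := interior_subset ht
    exact (norm_upper_le _).trans_eq (by rw [hu (t, j) hmem, norm_zero])
  jump t j h _ := (norm_lower_le _).trans_eq (by rw [hu (t, j) h, norm_zero])

lemma isInputBound_hybridSupNorm (hE : IsHybridTimeDomain E) (hu : hybridSupNorm E u ≠ ∞) :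
    IsInputBound E u (hybridSupNorm E u).toReal where
  nonneg := ENNReal.toReal_nonneg
  flow j := by
    filter_upwards [ae_norm_le_hybridSupNorm hE hu j] with t ht hmem
    exact (norm_upper_le _).trans (ht hmem)
  jump _ _ h h' := (norm_lower_le _).trans (norm_le_hybridSupNorm_of_jump hu h h')

lemma isClassK_const_mul {c : ℝ} (hc : 0 < c) : IsClassK fun x => c * x :=
  ⟨by fun_prop, fun _ _ _ _ h => by dsimp only; gcongr, mul_zero c⟩

namespace IsDissipative

variable (h : IsDissipative P T₁ T₂ lamt γ L P₁ P₂ δ)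

include h

lemma isTimer (hsol : (P.errorSystem T₁ T₂ L 0).IsSolutionPair E φ u) :
    IsTimer T₁ T₂ E fun t j => stτ (φ t j) :=
  isTimer_stτ h.T₁_pos.le h.T₁_le hsol

lemma lyap_nonneg (e : EuclideanSpace ℝ (ErrIx nz ny)) {τ : ℝ} (hτ : 0 ≤ τ) :
    0 ≤ lyap P₁ P₂ δ e τ := by
  obtain ⟨a, ha, hle⟩ := exists_pos_mul_norm_sq_le_lyap h.posDef₁ h.posDef₂ h.δ_pos.le
  exact le_trans (by positivity) (hle e τ hτ)

lemma lyap_flow_le (hsol : (P.errorSystem T₁ T₂ L 0).IsSolutionPair E φ u) {W : ℝ}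
    (hW : IsInputBound E u W) {j : ℕ} {s t : ℝ} (hst : s ≤ t) (hs : Icc s t ⊆ slice E j) :
    lyap P₁ P₂ δ (stE (φ t j)) (stτ (φ t j)) ≤ Real.exp (-(2 * lamt) * (t - s)) *
      (lyap P₁ P₂ δ (stE (φ s j)) (stτ (φ s j)) - γ ^ 2 * W ^ 2 / (2 * lamt))
        + γ ^ 2 * W ^ 2 / (2 * lamt) := by
  refine le_exp_mul_add_of_ae_hasDerivAt (mul_pos two_pos h.lamt_pos).ne'
    (V' := fun r => lyapDot P₁ P₂ δ (stE (φ r j))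
      (errField P L (stZ (φ r j)) (stE (φ r j)) (upper (u r j))) (stτ (φ r j))) hst
    (absolutelyContinuousOnInterval_lyap P₁ P₂ δ hsol hst hs) ?_
  filter_upwards [ae_hasDerivAt_lyap h.posDef₁.isHermitian h.posDef₂.isHermitian δ hsol hs,
    hW.flow j] with r hr hWr hmem
  refine ⟨hr hmem, ?_⟩
  have hdiss := h.dissipativeAt _ ((h.isTimer hsol).mem r j (hs (Ioo_subset_Icc_self hmem)))
    (stZ (φ r j)) (stE (φ r j)) (upper (u r j))
  have hsupply : γ ^ 2 * ‖upper (u r j)‖ ^ 2 ≤ γ ^ 2 * W ^ 2 := by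
    gcongr; exact hWr (Ioo_subset_interior_slice hs hmem)
  linarith [sq_nonneg ‖mv P.Cp (upper (stE (φ r j)))‖]

lemma lyap_jump_le (hsol : (P.errorSystem T₁ T₂ L 0).IsSolutionPair E φ u) {t : ℝ} {j : ℕ}
    (h₁ : (t, j) ∈ E) (h₂ : (t, j + 1) ∈ E) :
    lyap P₁ P₂ δ (stE (φ t (j + 1))) (stτ (φ t (j + 1))) ≤
      lyap P₁ P₂ δ (stE (φ t j)) (stτ (φ t j))
        + Real.exp (δ * T₂) * ‖mvL P₂‖ * ‖lower (u t j)‖ ^ 2 := by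
  obtain ⟨hτ, hτ'⟩ := stτ_mem_of_jump hsol h₁ h₂
  have hle := lyap_le_lyap_zero_add P₁ h.posDef₂.posSemidef h.δ_pos.le hτ'.2
    (e := stE (φ t j)) (e' := stE (φ t (j + 1))) (by rw [stE_eq_of_jump hsol h₁ h₂, upper_stack])
  have hlower : lower (stE (φ t (j + 1))) = -lower (u t j) := by
    rw [stE_eq_of_jump hsol h₁ h₂, lower_stack]
  rwa [hlower, norm_neg, ← hτ] at hle

lemma exists_lyap_le :
    ∃ G > 0, ∀ (E : Set (ℝ × ℕ)) (φ : ℝ → ℕ → EuclideanSpace ℝ (StateIx nz ny))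
      (u : ℝ → ℕ → EuclideanSpace ℝ (Fin nw ⊕ Fin ny)) (W : ℝ),
      (P.errorSystem T₁ T₂ L 0).IsSolutionPair E φ u → IsInputBound E u W →
        ∀ (t : ℝ) (j : ℕ), (t, j) ∈ E → lyap P₁ P₂ δ (stE (φ t j)) (stτ (φ t j)) ≤
          Real.exp (-(2 * lamt) * t) * lyap P₁ P₂ δ (stE (φ 0 0)) (stτ (φ 0 0)) + G * W ^ 2 := by
  have hlamt := h.lamt_pos
  have hγ := h.γ_pos
  have hgrow : 0 < Real.exp (2 * lamt * T₁) - 1 :=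
    sub_pos.2 (Real.one_lt_exp_iff.2 (mul_pos (by positivity) h.T₁_pos))
  set k := Real.exp (δ * T₂) * ‖mvL P₂‖
  refine ⟨γ ^ 2 / (2 * lamt) + k / (Real.exp (2 * lamt * T₁) - 1) * Real.exp (2 * lamt * T₂),
    by positivity, fun E φ u W hsol hW t j ht => ?_⟩
  have hτ := h.isTimer hsol
  calc lyap P₁ P₂ δ (stE (φ t j)) (stτ (φ t j))
      ≤ Real.exp (-(2 * lamt) * t) * lyap P₁ P₂ δ (stE (φ 0 0)) (stτ (φ 0 0))
          + γ ^ 2 * W ^ 2 / (2 * lamt)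
          + k * W ^ 2 / (Real.exp (2 * lamt * T₁) - 1) * Real.exp (2 * lamt * stτ (φ t j)) := by
        refine hτ.le_of_flow_of_jump hsol.domain h.T₁_pos (by positivity) (by positivity)
          (by positivity) (V := fun t j => lyap P₁ P₂ δ (stE (φ t j)) (stτ (φ t j)))
          (fun j s t hst hs => h.lyap_flow_le hsol hW hst hs) (fun t j h₁ h₂ => ?_) ht
        refine (h.lyap_jump_le hsol h₁ h₂).trans ?_
        gcongr
        exact hW.jump t j h₁ h₂
    _ ≤ Real.exp (-(2 * lamt) * t) * lyap P₁ P₂ δ (stE (φ 0 0)) (stτ (φ 0 0))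
          + γ ^ 2 * W ^ 2 / (2 * lamt)
          + k * W ^ 2 / (Real.exp (2 * lamt * T₁) - 1) * Real.exp (2 * lamt * T₂) := by
        gcongr; exact (hτ.mem t j ht).2
    _ = _ := by ring

lemma exists_norm_stE_le :
    ∃ κ > 0, ∃ g > 0, ∀ (E : Set (ℝ × ℕ)) (φ : ℝ → ℕ → EuclideanSpace ℝ (StateIx nz ny))
      (u : ℝ → ℕ → EuclideanSpace ℝ (Fin nw ⊕ Fin ny)) (W : ℝ),
      (P.errorSystem T₁ T₂ L 0).IsSolutionPair E φ u → IsInputBound E u W →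
        ∀ (t : ℝ) (j : ℕ), (t, j) ∈ E →
          ‖stE (φ t j)‖ ≤ max (κ * Real.exp (-lamt * t) * ‖stE (φ 0 0)‖) (g * W) := by
  obtain ⟨a, ha, hlower⟩ := exists_pos_mul_norm_sq_le_lyap h.posDef₁ h.posDef₂ h.δ_pos.le
  obtain ⟨b, hb, hupper⟩ := exists_lyap_le_mul_norm_sq P₁ P₂ h.δ_pos.le T₂
  obtain ⟨G, hG, hlyap⟩ := h.exists_lyap_le
  refine ⟨√(2 * b / a), by positivity, √(2 * G / a), by positivity,
    fun E φ u W hsol hW t j ht => ?_⟩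
  have hτ := h.isTimer hsol
  set A := Real.exp (-lamt * t) * ‖stE (φ 0 0)‖ with hA
  have hsum : a * ‖stE (φ t j)‖ ^ 2 ≤ b * A ^ 2 + G * W ^ 2 :=
    calc a * ‖stE (φ t j)‖ ^ 2 ≤ lyap P₁ P₂ δ (stE (φ t j)) (stτ (φ t j)) :=
          hlower _ _ (hτ.mem t j ht).1
      _ ≤ Real.exp (-(2 * lamt) * t) * lyap P₁ P₂ δ (stE (φ 0 0)) (stτ (φ 0 0)) + G * W ^ 2 :=
          hlyap E φ u W hsol hW t j ht
      _ ≤ Real.exp (-(2 * lamt) * t) * (b * ‖stE (φ 0 0)‖ ^ 2) + G * W ^ 2 := by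
          gcongr; exact hupper _ _ (hτ.mem 0 0 hsol.domain.zero_mem).2
      _ = b * A ^ 2 + G * W ^ 2 := by
          rw [hA, mul_pow, ← Real.exp_nat_mul]; push_cast; ring_nf
  have hroot : ∀ {c x : ℝ}, 0 ≤ c → 0 ≤ x → a * ‖stE (φ t j)‖ ^ 2 ≤ 2 * (c * x ^ 2) →
      ‖stE (φ t j)‖ ≤ √(2 * c / a) * x := by
    intro c x hc hx hle
    refine le_of_sq_le_sq ?_ (by positivity)
    rw [mul_pow, Real.sq_sqrt (by positivity), div_mul_eq_mul_div, le_div_iff₀ ha]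
    linarith
  rw [mul_assoc, ← hA, le_max_iff]
  rcases le_total (G * W ^ 2) (b * A ^ 2) with hle | hle
  · exact Or.inl (hroot hb.le (by positivity) (by linarith))
  · exact Or.inr (hroot hG.le hW.nonneg (by linarith))

lemma infDist_attractor_eq (hsol : (P.errorSystem T₁ T₂ L 0).IsSolutionPair E φ u) {t : ℝ} {j : ℕ}
    (ht : (t, j) ∈ E) : Metric.infDist (φ t j) (attractor nz ny T₂) = ‖stE (φ t j)‖ :=
  infDist_attractor ((h.isTimer hsol).mem t j ht)

lemma exists_infDist_le :
    ∃ κ : ℝ, 0 < κ ∧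
      ∀ (E : Set (ℝ × ℕ)) (φ : ℝ → ℕ → EuclideanSpace ℝ (StateIx nz ny))
        (u : ℝ → ℕ → EuclideanSpace ℝ (Fin nw ⊕ Fin ny)),
        (P.errorSystem T₁ T₂ L 0).IsSolutionPair E φ u → (∀ p ∈ E, u p.1 p.2 = 0) →
          ∀ (t : ℝ) (j : ℕ), (t, j) ∈ E →
            Metric.infDist (φ t j) (attractor nz ny T₂) ≤
              κ * Real.exp (-lamt * t) * Metric.infDist (φ 0 0) (attractor nz ny T₂) := by
  obtain ⟨κ, hκ, g, -, hle⟩ := h.exists_norm_stE_le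
  refine ⟨κ, hκ, fun E φ u hsol hu t j ht => ?_⟩
  rw [h.infDist_attractor_eq hsol ht, h.infDist_attractor_eq hsol hsol.domain.zero_mem]
  have := hle E φ u 0 hsol (isInputBound_zero hu) t j ht
  rwa [mul_zero, max_eq_left (by positivity)] at this

-- The dwell time bounds the number of jumps, `j T₁ ≤ t + T₂`, so decay in `t` is decay in `t + j`.
lemma exp_le_exp_hybridTime (hsol : (P.errorSystem T₁ T₂ L 0).IsSolutionPair E φ u) {t : ℝ} {j : ℕ}
    (ht : (t, j) ∈ E) :
    Real.exp (-lamt * t) ≤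
      Real.exp (lamt * T₂ / 2) * Real.exp (-(lamt / 2 * min 1 T₁) * (t + j)) := by
  have hlamt := h.lamt_pos
  have hj := (h.isTimer hsol).mul_le_add hsol.domain ht
  have hmin_t : min 1 T₁ * t ≤ 1 * t :=
    mul_le_mul_of_nonneg_right (min_le_left _ _) (hsol.domain.nonneg ht)
  have hmin_j : min 1 T₁ * j ≤ T₁ * j :=
    mul_le_mul_of_nonneg_right (min_le_right _ _) j.cast_nonneg
  have hsum : lamt / 2 * (min 1 T₁ * t + min 1 T₁ * j) ≤ lamt / 2 * (t + (t + T₂)) :=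
    mul_le_mul_of_nonneg_left (by linarith) (by positivity)
  rw [← Real.exp_add]
  gcongr
  linarith

lemma exists_iss :
    ∃ (κ lam : ℝ) (ρ : ℝ → ℝ), 0 < κ ∧ 0 < lam ∧ IsClassK ρ ∧
      ∀ (E : Set (ℝ × ℕ)) (φ : ℝ → ℕ → EuclideanSpace ℝ (StateIx nz ny))
        (u : ℝ → ℕ → EuclideanSpace ℝ (Fin nw ⊕ Fin ny)),
        (P.errorSystem T₁ T₂ L 0).IsSolutionPair E φ u → hybridSupNorm E u ≠ ∞ →
        ∀ (t : ℝ) (j : ℕ), (t, j) ∈ E →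
          Metric.infDist (φ t j) (attractor nz ny T₂) ≤
            max (κ * Real.exp (-lam * (t + j)) * Metric.infDist (φ 0 0) (attractor nz ny T₂))
              (ρ (hybridSupNorm E u).toReal) := by
  obtain ⟨κ, hκ, g, hg, hle⟩ := h.exists_norm_stE_le
  refine ⟨κ * Real.exp (lamt * T₂ / 2), lamt / 2 * min 1 T₁, fun x => g * x, by positivity,
    mul_pos (half_pos h.lamt_pos) (lt_min one_pos h.T₁_pos), isClassK_const_mul hg,
    fun E φ u hsol hu t j ht => ?_⟩
  rw [h.infDist_attractor_eq hsol ht, h.infDist_attractor_eq hsol hsol.domain.zero_mem]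
  refine (hle E φ u _ hsol (isInputBound_hybridSupNorm hsol.domain hu) t j ht).trans ?_
  rw [mul_assoc κ (Real.exp (lamt * T₂ / 2))]
  gcongr
  exact h.exp_le_exp_hybridTime hsol ht

end IsDissipative

end Stability

section Gain

lemma ofReal_integral_norm_sq {F : Type*} [NormedAddCommGroup F] {f : ℝ → F} {s t : ℝ}
    (hst : s ≤ t) (hf : IntervalIntegrable (fun x => ‖f x‖ ^ 2) volume s t) :
    ENNReal.ofReal (∫ x in s..t, ‖f x‖ ^ 2) = ∫⁻ x in Ioc s t, ‖f x‖ₑ ^ 2 := by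
  rw [intervalIntegral.integral_of_le hst, ofReal_integral_eq_lintegral_ofReal
    ((intervalIntegrable_iff_integrableOn_Ioc_of_le hst).1 hf)
    (ae_of_all _ fun x => sq_nonneg _)]
  refine lintegral_congr fun x => ?_
  rw [ENNReal.ofReal_pow (norm_nonneg _), ofReal_norm]

lemma ofReal_sq_rpow_half {x : ℝ} (hx : 0 ≤ x) :
    ENNReal.ofReal (x ^ 2) ^ (1 / 2 : ℝ) = ENNReal.ofReal x := by
  rw [ENNReal.ofReal_rpow_of_nonneg (sq_nonneg _) (by norm_num), ← Real.sqrt_eq_rpow,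
    Real.sqrt_sq hx]

lemma IsHybridInput.intervalIntegrable_norm_sq {m : Type*} [Fintype m] {E : Set (ℝ × ℕ)}
    {u : ℝ → ℕ → EuclideanSpace ℝ m} (hu : IsHybridInput E u) {F : Type*}
    [NormedAddCommGroup F] [NormedSpace ℝ F] (g : EuclideanSpace ℝ m →L[ℝ] F)
    {j : ℕ} {s t : ℝ} (hst : s ≤ t) (hs : Icc s t ⊆ slice E j) :
    IntervalIntegrable (fun x => ‖g (u x j)‖ ^ 2) volume s t := by
  rw [intervalIntegrable_iff_integrableOn_Ioc_of_le hst]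
  obtain ⟨hmeas, hbdd⟩ := hu j
  obtain ⟨M, hM⟩ := hbdd t
  have hmeas' : AEStronglyMeasurable (fun x => ‖g (u x j)‖ ^ 2) (volume.restrict (Ioc s t)) :=
    (g.continuous.norm.pow 2).comp_aestronglyMeasurable
      (hmeas.mono_set (Ioc_subset_Icc_self.trans hs)).aestronglyMeasurable
  refine Integrable.of_bound hmeas' ((‖g‖ * M) ^ 2) ?_
  rw [ae_restrict_iff' measurableSet_Ioc]
  filter_upwards [hM] with x hx hmem
  rw [Real.norm_of_nonneg (sq_nonneg _)]
  gcongr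
  exact g.le_opNorm_of_le (hx (hs (Ioc_subset_Icc_self hmem)) hmem.2)

namespace IsDissipative

variable {nz ny nw nq ns np : ℕ} {P : Plant nz ny nw nq ns np} {T₁ T₂ lamt γ δ : ℝ}
  {L : Matrix (Fin nz) (Fin ny) ℝ} {P₁ : Matrix (Fin nz) (Fin nz) ℝ}
  {P₂ : Matrix (Fin ny) (Fin ny) ℝ} {E : Set (ℝ × ℕ)}
  {φ : ℝ → ℕ → EuclideanSpace ℝ (StateIx nz ny)}
  {u : ℝ → ℕ → EuclideanSpace ℝ (Fin nw ⊕ Fin ny)}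
  (h : IsDissipative P T₁ T₂ lamt γ L P₁ P₂ δ)

include h

lemma integral_add_lyap_le (hsol : (P.errorSystem T₁ T₂ L 0).IsSolutionPair E φ u)
    {j : ℕ} {s t : ℝ} (hst : s ≤ t) (hs : Icc s t ⊆ slice E j)
    (hy : IntervalIntegrable (fun x => ‖mv P.Cp (upper (stE (φ x j)))‖ ^ 2) volume s t)
    (hw : IntervalIntegrable (fun x => ‖upper (u x j)‖ ^ 2) volume s t) :
    (∫ x in s..t, ‖mv P.Cp (upper (stE (φ x j)))‖ ^ 2)
        + lyap P₁ P₂ δ (stE (φ t j)) (stτ (φ t j)) ≤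
      lyap P₁ P₂ δ (stE (φ s j)) (stτ (φ s j)) + γ ^ 2 * ∫ x in s..t, ‖upper (u x j)‖ ^ 2 := by
  have hint := sub_le_integral_of_ae_hasDerivAt
    (g := fun x => γ ^ 2 * ‖upper (u x j)‖ ^ 2 - ‖mv P.Cp (upper (stE (φ x j)))‖ ^ 2) hst
    (absolutelyContinuousOnInterval_lyap P₁ P₂ δ hsol hst hs) (by
      filter_upwards [ae_hasDerivAt_lyap h.posDef₁.isHermitian h.posDef₂.isHermitian δ hsol hs]
        with r hr hmem
      have hτ := (h.isTimer hsol).mem r j (hs (Ioo_subset_Icc_self hmem))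
      have hdiss := h.dissipativeAt _ hτ (stZ (φ r j)) (stE (φ r j)) (upper (u r j))
      exact ⟨hr hmem, by linarith [mul_nonneg h.lamt_pos.le (h.lyap_nonneg (stE (φ r j)) hτ.1)]⟩)
    ((hw.const_mul _).sub hy)
  rw [intervalIntegral.integral_sub (hw.const_mul _) hy,
    intervalIntegral.integral_const_mul] at hint
  linarith

lemma lintegral_Ioc_add_lyap_le (hsol : (P.errorSystem T₁ T₂ L 0).IsSolutionPair E φ u)
    {j : ℕ} {s t : ℝ} (hst : s ≤ t) (hs : Icc s t ⊆ slice E j) :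
    (∫⁻ x in Ioc s t, ‖mv P.Cp (upper (stE (φ x j)))‖ₑ ^ 2) +
        ENNReal.ofReal (lyap P₁ P₂ δ (stE (φ t j)) (stτ (φ t j))) ≤
      ENNReal.ofReal (lyap P₁ P₂ δ (stE (φ s j)) (stτ (φ s j))) +
        ∫⁻ x in Ioc s t, ENNReal.ofReal (γ ^ 2) * ‖upper (u x j)‖ₑ ^ 2 := by
  have hy : IntervalIntegrable (fun x => ‖mv P.Cp (upper (stE (φ x j)))‖ ^ 2) volume s t := by
    refine ContinuousOn.intervalIntegrable_of_Icc hst ?_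
    exact ((((mvL P.Cp).comp (upperL.comp stEL)).continuous.norm).pow 2).comp_continuousOn
      (hsol.continuousOn hst hs)
  have hw : IntervalIntegrable (fun x => ‖upper (u x j)‖ ^ 2) volume s t :=
    hsol.input.intervalIntegrable_norm_sq upperL hst hs
  have hnonneg : ∀ x ∈ Icc s t, 0 ≤ lyap P₁ P₂ δ (stE (φ x j)) (stτ (φ x j)) := fun x hx =>
    h.lyap_nonneg _ ((h.isTimer hsol).mem x j (hs hx)).1
  have hy_nonneg : 0 ≤ ∫ x in s..t, ‖mv P.Cp (upper (stE (φ x j)))‖ ^ 2 :=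
    intervalIntegral.integral_nonneg hst fun x _ => sq_nonneg _
  have hw_nonneg : 0 ≤ ∫ x in s..t, ‖upper (u x j)‖ ^ 2 :=
    intervalIntegral.integral_nonneg hst fun x _ => sq_nonneg _
  rw [lintegral_const_mul' _ _ ENNReal.ofReal_ne_top, ← ofReal_integral_norm_sq hst hy,
    ← ofReal_integral_norm_sq hst hw, ← ENNReal.ofReal_mul (sq_nonneg γ),
    ← ENNReal.ofReal_add hy_nonneg (hnonneg t (right_mem_Icc.2 hst)),
    ← ENNReal.ofReal_add (hnonneg s (left_mem_Icc.2 hst)) (by positivity)]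
  exact ENNReal.ofReal_le_ofReal (h.integral_add_lyap_le hsol hst hs hy hw)

lemma lintegral_timeProj_le (hsol : (P.errorSystem T₁ T₂ L 0).IsSolutionPair E φ u)
    (hη : ∀ p ∈ E, lower (u p.1 p.2) = 0) :
    ∫⁻ s in timeProj E, ‖mv P.Cp (upper (stE (φ s (firstIndex E s))))‖ₑ ^ 2 ≤
      ENNReal.ofReal (lyap P₁ P₂ δ (stE (φ 0 0)) (stτ (φ 0 0))) +
        ENNReal.ofReal (γ ^ 2) * ∫⁻ s in timeProj E, ‖upper (u s (firstIndex E s))‖ₑ ^ 2 := by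
  rw [← lintegral_const_mul' _ _ ENNReal.ofReal_ne_top]
  refine hsol.domain.lintegral_timeProj_le
    (v := fun t j => ENNReal.ofReal (lyap P₁ P₂ δ (stE (φ t j)) (stτ (φ t j))))
    (f := fun t j => ‖mv P.Cp (upper (stE (φ t j)))‖ₑ ^ 2)
    (g := fun t j => ENNReal.ofReal (γ ^ 2) * ‖upper (u t j)‖ₑ ^ 2)
    (fun j s t hst hs => h.lintegral_Ioc_add_lyap_le hsol hst hs) fun t j h₁ h₂ => ?_
  refine ENNReal.ofReal_le_ofReal ?_
  simpa [hη (t, j) h₁] using h.lyap_jump_le hsol h₁ h₂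

lemma exists_gain :
    ∃ α : ℝ, 0 < α ∧
      ∀ (E : Set (ℝ × ℕ)) (φ : ℝ → ℕ → EuclideanSpace ℝ (StateIx nz ny))
        (u : ℝ → ℕ → EuclideanSpace ℝ (Fin nw ⊕ Fin ny)),
        (P.errorSystem T₁ T₂ L 0).IsSolutionPair E φ u → (∀ p ∈ E, lower (u p.1 p.2) = 0) →
          (∫⁻ s in timeProj E, ‖mv P.Cp (upper (stE (φ s (firstIndex E s))))‖ₑ ^ 2)
              ^ (1 / 2 : ℝ) ≤
            ENNReal.ofReal (α * Metric.infDist (φ 0 0) (attractor nz ny T₂)) +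
              ENNReal.ofReal γ *
                (∫⁻ s in timeProj E, ‖upper (u s (firstIndex E s))‖ₑ ^ 2) ^ (1 / 2 : ℝ) := by
  obtain ⟨b, hb, hupper⟩ := exists_lyap_le_mul_norm_sq P₁ P₂ h.δ_pos.le T₂
  refine ⟨√b, by positivity, fun E φ u hsol hη => ?_⟩
  have hzero := hsol.domain.zero_mem
  have hV : lyap P₁ P₂ δ (stE (φ 0 0)) (stτ (φ 0 0)) ≤ (√b * ‖stE (φ 0 0)‖) ^ 2 := by
    rw [mul_pow, Real.sq_sqrt hb.le]
    exact hupper _ _ ((h.isTimer hsol).mem 0 0 hzero).2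
  have hle := (h.lintegral_timeProj_le hsol hη).trans
    (add_le_add_left (ENNReal.ofReal_le_ofReal hV) _)
  rw [h.infDist_attractor_eq hsol hzero]
  calc _ ≤ _ := ENNReal.rpow_le_rpow hle (by norm_num)
    _ ≤ _ := ENNReal.rpow_add_le_add_rpow _ _ (by norm_num) (by norm_num)
    _ = _ := by
      rw [ENNReal.mul_rpow_of_nonneg _ _ (by norm_num), ofReal_sq_rpow_half (by positivity),
        ofReal_sq_rpow_half h.γ_pos.le]

end IsDissipative

end Gain

section SampledArc

variable {ι κ : Type*} [Fintype ι] [Fintype κ] {a b : ℝ}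

lemma absolutelyContinuousOnInterval_stack {f : ℝ → EuclideanSpace ℝ ι} {g : ℝ → EuclideanSpace ℝ κ}
    (hf : AbsolutelyContinuousOnInterval f a b) (hg : AbsolutelyContinuousOnInterval g a b) :
    AbsolutelyContinuousOnInterval (fun s => stack (f s) (g s)) a b := by
  have hf' := absolutelyContinuousOnInterval_comp_contDiff
    (stackL.comp (ContinuousLinearMap.inl ℝ _ (EuclideanSpace ℝ κ))).contDiff hf
  have hg' := absolutelyContinuousOnInterval_comp_contDiff
    (stackL.comp (ContinuousLinearMap.inr ℝ (EuclideanSpace ℝ ι) _)).contDiff hg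
  refine absolutelyContinuousOnInterval_congr (hf'.fun_add hg') fun s _ => ?_
  change stackL (f s, 0) + stackL (0, g s) = stackL (f s, g s)
  rw [← map_add, Prod.mk_add_mk, add_zero, zero_add]

lemma hasDerivAt_stack {f : ℝ → EuclideanSpace ℝ ι} {g : ℝ → EuclideanSpace ℝ κ}
    {f' : EuclideanSpace ℝ ι} {g' : EuclideanSpace ℝ κ} {s : ℝ} (hf : HasDerivAt f f' s)
    (hg : HasDerivAt g g' s) : HasDerivAt (fun s => stack (f s) (g s)) (stack f' g') s :=
  (stackL (ι := ι) (κ := κ)).hasFDerivAt.comp_hasDerivAt s (hf.prodMk hg)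

variable {nz ny nw nq ns np : ℕ} {z : ℝ → Vec nz} {e : ℝ → EuclideanSpace ℝ (ErrIx nz ny)}
  {τ : ℝ → ℝ}

/-- The embedding of `ℝ` in `EuclideanSpace ℝ Unit`, the space of the timer component of a state. -/
def timerL : ℝ →L[ℝ] EuclideanSpace ℝ Unit :=
  LinearMap.toContinuousLinearMap
    { toFun := fun τ => WithLp.toLp 2 fun _ => τ
      map_add' := fun _ _ => rfl
      map_smul' := fun _ _ => rfl }

lemma absolutelyContinuousOnInterval_mkState (hz : AbsolutelyContinuousOnInterval z a b)
    (he : AbsolutelyContinuousOnInterval e a b) (hτ : AbsolutelyContinuousOnInterval τ a b) :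
    AbsolutelyContinuousOnInterval (fun s => mkState (z s) (e s) (τ s)) a b :=
  absolutelyContinuousOnInterval_stack hz (absolutelyContinuousOnInterval_stack he
    (absolutelyContinuousOnInterval_comp_contDiff timerL.contDiff hτ))

lemma hasDerivAt_mkState {z' : Vec nz} {e' : EuclideanSpace ℝ (ErrIx nz ny)} {τ' s : ℝ}
    (hz : HasDerivAt z z' s) (he : HasDerivAt e e' s) (hτ : HasDerivAt τ τ' s) :
    HasDerivAt (fun s => mkState (z s) (e s) (τ s)) (mkState z' e' τ') s :=
  hasDerivAt_stack hz (hasDerivAt_stack he (timerL.hasFDerivAt.comp_hasDerivAt s hτ))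

/-- The hybrid time domain of a sampling sequence. -/
def samplingDomain (t : ℕ → ℝ) : Set (ℝ × ℕ) := {p | p.1 ∈ Icc (t p.2) (t (p.2 + 1))}

/-- The hybrid arc of a trajectory of the plant and the observer. Between samples `θ` is constant,
and its value after the `j`-th sample is read off at the next one, where `θ` is left-continuous. -/
def sampledArc (P : Plant nz ny nw nq ns np) (t : ℕ → ℝ) (z zhat : ℝ → Vec nz) (θ : ℝ → Vec ny)
    (s : ℝ) (j : ℕ) : EuclideanSpace ℝ (StateIx nz ny) :=
  mkState (z s) (stack (z s - zhat s) (mv P.C (z s - zhat s) - θ (t (j + 1)))) (t (j + 1) - s)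

open Classical in
/-- The hybrid input of a trajectory of the plant and the observer. It consists of `w` off the
sampling times and of `η` at the sampling times, so that no sample contributes to the bound on `w`
and no flow to the bound on `η`. -/
def sampledInput (t : ℕ → ℝ) (w : ℝ → Vec nw) (η : ℝ → Vec ny) (s : ℝ) (j : ℕ) :
    EuclideanSpace ℝ (Fin nw ⊕ Fin ny) :=
  if s = t (j + 1) then stack 0 (η s) else stack (w s) 0

end SampledArc

section Sampling

variable {T₁ T₂ : ℝ} {t : ℕ → ℝ}

namespace IsSamplingSequence

lemma monotone (ht : IsSamplingSequence T₁ T₂ t) (hT₁ : 0 ≤ T₁) : Monotone t := by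
  refine monotone_nat_of_le_succ fun j => ?_
  rcases j.eq_zero_or_pos with rfl | hj
  · rw [ht.1]; exact ht.2.1.1
  · linarith [(ht.2.2 j hj).1]

lemma nonneg (ht : IsSamplingSequence T₁ T₂ t) (hT₁ : 0 ≤ T₁) (j : ℕ) : 0 ≤ t j :=
  ht.1.symm.le.trans (ht.monotone hT₁ j.zero_le)

lemma sub_le (ht : IsSamplingSequence T₁ T₂ t) (j : ℕ) : t (j + 1) - t j ≤ T₂ := by
  rcases j.eq_zero_or_pos with rfl | hj
  · rw [ht.1, sub_zero]; exact ht.2.1.2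
  · exact (ht.2.2 j hj).2

lemma mul_le (ht : IsSamplingSequence T₁ T₂ t) (j : ℕ) : j * T₁ ≤ t (j + 1) := by
  induction j with
  | zero => simpa using ht.2.1.1
  | succ j ih =>
    push_cast
    linarith [(ht.2.2 (j + 1) j.succ_pos).1]

lemma exists_mem_Icc (ht : IsSamplingSequence T₁ T₂ t) (hT₁ : 0 < T₁) {s : ℝ} (hs : 0 ≤ s) :
    ∃ j, s ∈ Icc (t j) (t (j + 1)) ∧ (t j < s ∨ j = 0) := by
  have hex : ∃ j, s ≤ t (j + 1) := by
    obtain ⟨j, hj⟩ := exists_nat_ge (s / T₁)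
    exact ⟨j, ((div_le_iff₀ hT₁).1 hj).trans (ht.mul_le j)⟩
  classical
  rcases hj : Nat.find hex with _ | j
  · exact ⟨0, ⟨ht.1.le.trans hs, by simpa [hj] using Nat.find_spec hex⟩, Or.inr rfl⟩
  · have hlt : t (j + 1) < s := not_le.1 (Nat.find_min hex (hj ▸ j.lt_succ_self))
    exact ⟨j + 1, ⟨hlt.le, hj ▸ Nat.find_spec hex⟩, Or.inl hlt⟩

lemma isHybridTimeDomain (ht : IsSamplingSequence T₁ T₂ t) (hT₁ : 0 ≤ T₁) :
    IsHybridTimeDomain (samplingDomain t) :=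
  ⟨t, ht.1, ht.monotone hT₁, Or.inl rfl⟩

lemma timeProj_samplingDomain (ht : IsSamplingSequence T₁ T₂ t) (hT₁ : 0 < T₁) :
    timeProj (samplingDomain t) = Ici 0 := by
  ext s
  constructor
  · rintro ⟨j, hj⟩
    exact (ht.nonneg hT₁.le j).trans hj.1
  · intro hs
    obtain ⟨j, hj, -⟩ := ht.exists_mem_Icc hT₁ hs
    exact ⟨j, hj⟩

end IsSamplingSequence

lemma eq_of_mem_samplingDomain_succ {s : ℝ} {j : ℕ} (h₁ : (s, j) ∈ samplingDomain t)
    (h₂ : (s, j + 1) ∈ samplingDomain t) : s = t (j + 1) := le_antisymm h₁.2 h₂.1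

variable {nw ny : ℕ} (t) (w : ℝ → Vec nw) (η : ℝ → Vec ny) (j : ℕ)

lemma sampledInput_sample : sampledInput t w η (t (j + 1)) j = stack 0 (η (t (j + 1))) := if_pos rfl

lemma ae_sampledInput_eq : ∀ᵐ s, sampledInput t w η s j = stack (w s) 0 := by
  filter_upwards [Measure.ae_ne volume (t (j + 1))] with s hs
  exact if_neg hs

end Sampling

section Trajectory

lemma eq_of_hasDerivAt_zero {F : Type*} [NormedAddCommGroup F] [NormedSpace ℝ F] [CompleteSpace F]
    {f : ℝ → F} {a b : ℝ} (hab : a ≤ b) (hf : ContinuousOn f (Icc a b))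
    (hf' : ∀ s ∈ Ioo a b, HasDerivAt f 0 s) : f a = f b := by
  have h := intervalIntegral.integral_eq_sub_of_hasDerivAt_of_le hab hf hf' (by simp)
  rw [intervalIntegral.integral_zero] at h
  exact (sub_eq_zero.1 h.symm).symm

variable {nz ny nw nq ns np : ℕ} {P : Plant nz ny nw nq ns np} {T₁ T₂ : ℝ}
  {L : Matrix (Fin nz) (Fin ny) ℝ} {t : ℕ → ℝ} {w : ℝ → Vec nw} {η : ℝ → Vec ny}
  {z zhat : ℝ → Vec nz} {θ : ℝ → Vec ny} {j : ℕ} {s : ℝ}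

lemma errField_stack_sub (z zhat : Vec nz) (θ : Vec ny) (w : Vec nw) :
    errField P L z (stack (z - zhat) (mv P.C (z - zhat) - θ)) w =
      stack ((mv P.A z + mv P.B (P.ψ (mv P.S z)) + mv P.N w) -
          (mv P.A zhat + mv P.B (P.ψ (mv P.S zhat)) + mv L θ))
        (mv P.C ((mv P.A z + mv P.B (P.ψ (mv P.S z)) + mv P.N w) -
          (mv P.A zhat + mv P.B (P.ψ (mv P.S zhat)) + mv L θ))) := by
  have hε : mv P.A (z - zhat) - mv L (mv P.C (z - zhat)) + mv L (mv P.C (z - zhat) - θ)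
      + mv P.B (P.zeta z (z - zhat)) + mv P.N w =
        (mv P.A z + mv P.B (P.ψ (mv P.S z)) + mv P.N w) -
          (mv P.A zhat + mv P.B (P.ψ (mv P.S zhat)) + mv L θ) := by
    simp only [← mvL_apply, Plant.zeta, sub_sub_cancel, map_sub]
    abel
  rw [errField_eq_stack, upper_stack, lower_stack, hε]

namespace IsTrajectory

variable (h : IsTrajectory P L 0 t w η z zhat θ)

include h

lemma hold_eq (h₀ : t 0 = 0) (hs : s ∈ Icc (t j) (t (j + 1))) (hs' : t j < s ∨ j = 0) :
    θ s = θ (t (j + 1)) := by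
  refine eq_of_hasDerivAt_zero hs.2 ?_ fun r hr => ?_
  · rcases j.eq_zero_or_pos with rfl | hj
    · exact h.θ_init.mono (Icc_subset_Icc_left (h₀.ge.trans hs.1))
    · exact (h.θ_cont j hj).mono fun r hr => ⟨(hs'.resolve_right hj.ne').trans_le hr.1, hr.2⟩
  · have hzero : mv (0 : Matrix (Fin ny) (Fin ny) ℝ) (θ r) = 0 := by ext i; simp [mv]
    exact hzero ▸ h.θ_flow j r ⟨hs.1.trans_lt hr.1, hr.2⟩

lemma hold_eq_sample (ht : IsSamplingSequence T₁ T₂ t) (hT₁ : 0 < T₁) (j : ℕ) :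
    θ (t (j + 1 + 1)) = mv P.C (z (t (j + 1)) - zhat (t (j + 1))) + η (t (j + 1)) := by
  have hlt : t (j + 1) < t (j + 1 + 1) := by linarith [(ht.2.2 (j + 1) j.succ_pos).1]
  have hlim : Tendsto θ (𝓝[>] t (j + 1)) (𝓝 (θ (t (j + 1 + 1)))) := by
    refine tendsto_const_nhds.congr' ?_
    filter_upwards [Ioo_mem_nhdsGT hlt] with s hs
    exact (h.hold_eq ht.1 (Ioo_subset_Icc_self hs) (Or.inl hs.1)).symm
  rw [tendsto_nhds_unique hlim (h.θ_jump (j + 1) j.succ_pos)]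
  simp only [← mvL_apply, map_sub]
  abel

lemma absolutelyContinuousOnInterval_sampledArc {a b : ℝ} (ha : 0 ≤ a) (hab : a ≤ b) (j : ℕ) :
    AbsolutelyContinuousOnInterval (fun s => sampledArc P t z zhat θ s j) a b := by
  have hpos : Icc a b ⊆ Ici 0 := fun s hs => ha.trans hs.1
  have hz := h.z_ac a b hab hpos
  have hε := hz.fun_sub (h.zhat_ac a b hab hpos)
  have hy : AbsolutelyContinuousOnInterval
      (fun s => mv P.C (z s - zhat s) - θ (t (j + 1))) a b :=
    absolutelyContinuousOnInterval_comp_contDiff ((mvL P.C).contDiff.sub contDiff_const) hε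
  have hτ : AbsolutelyContinuousOnInterval (fun s => t (j + 1) - s) a b :=
    (contDiff_const.sub contDiff_id).contDiffOn.absolutelyContinuousOnInterval
  exact absolutelyContinuousOnInterval_mkState hz (absolutelyContinuousOnInterval_stack hε hy) hτ

lemma ae_hasDerivAt_sampledArc (ht : IsSamplingSequence T₁ T₂ t) (hT₁ : 0 ≤ T₁) (j : ℕ) :
    ∀ᵐ s, s ∈ Ioo (t j) (t (j + 1)) → HasDerivAt (fun s => sampledArc P t z zhat θ s j)
      ((P.errorSystem T₁ T₂ L 0).f (sampledArc P t z zhat θ s j) (sampledInput t w η s j)) s := by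
  filter_upwards [h.z_flow, h.zhat_flow, ae_sampledInput_eq t w η j] with s hz hzhat hu hs
  have hs₀ : 0 < s := (ht.nonneg hT₁ j).trans_lt hs.1
  have hε := (hz hs₀).sub (hzhat hs₀)
  have hy := ((mvL P.C).hasFDerivAt.comp_hasDerivAt s hε).sub_const (θ (t (j + 1)))
  have hτ := (hasDerivAt_id s).const_sub (t (j + 1))
  have hfield := errField_stack_sub (P := P) (L := L) (z s) (zhat s) (θ (t (j + 1))) (w s)
  refine (hasDerivAt_mkState (hz hs₀) (hasDerivAt_stack hε hy) hτ).congr_deriv ?_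
  rw [hu, ← mkState_stZ_stE_stτ ((P.errorSystem T₁ T₂ L 0).f _ _), stE_errorSystem_f,
    stτ_errorSystem_f, h.hold_eq ht.1 (Ioo_subset_Icc_self hs) (Or.inl hs.1)]
  simp only [sampledArc, stE_mkState, stZ_mkState, upper_stack, hfield]
  rfl

lemma aemeasurable_sampledInput (ht : IsSamplingSequence T₁ T₂ t) (hT₁ : 0 ≤ T₁) (j : ℕ) :
    AEMeasurable (fun s => sampledInput t w η s j)
      (volume.restrict (Icc (t j) (t (j + 1)))) := by
  have hw := h.w_meas.mono_set fun s (hs : s ∈ Icc (t j) (t (j + 1))) =>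
    (ht.nonneg hT₁ j).trans hs.1
  have hstack : Measurable fun v : Vec nw => stack v (0 : Vec ny) :=
    (stackL.comp (ContinuousLinearMap.inl ℝ (Vec nw) (Vec ny))).continuous.measurable
  refine (hstack.comp_aemeasurable hw).congr (ae_restrict_of_ae ?_)
  filter_upwards [ae_sampledInput_eq t w η j] with s hs using hs.symm

lemma exists_norm_sampledInput_le (ht : IsSamplingSequence T₁ T₂ t) (hT₁ : 0 ≤ T₁) (j : ℕ) :
    ∃ M : ℝ, ∀ᵐ s, s ∈ Icc (t j) (t (j + 1)) → ‖sampledInput t w η s j‖ ≤ M := by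
  obtain ⟨M, hM⟩ := h.w_bdd (t (j + 1))
  refine ⟨M, ?_⟩
  filter_upwards [hM, ae_sampledInput_eq t w η j] with s hw hu hs
  have hnorm : ‖stack (w s) (0 : Vec ny)‖ ^ 2 = ‖w s‖ ^ 2 := by
    simp [norm_sq_eq_upper_add_lower (stack (w s) 0)]
  rw [hu, (sq_eq_sq₀ (norm_nonneg _) (norm_nonneg _)).1 hnorm]
  exact hw ⟨(ht.nonneg hT₁ j).trans hs.1, hs.2⟩

lemma isFlow_sampledArc (ht : IsSamplingSequence T₁ T₂ t) (hT₁ : 0 ≤ T₁) (j : ℕ) :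
    (P.errorSystem T₁ T₂ L 0).IsFlow (slice (samplingDomain t) j)
      (fun s => sampledArc P t z zhat θ s j) fun s => sampledInput t w η s j := by
  have hle := ht.monotone hT₁ j.le_succ
  refine HybridSystem.isFlow_Icc hle
    (h.absolutelyContinuousOnInterval_sampledArc (ht.nonneg hT₁ j) hle j) (fun s hs => ?_)
    (h.ae_hasDerivAt_sampledArc ht hT₁ j) (h.aemeasurable_sampledInput ht hT₁ j)
    (h.exists_norm_sampledInput_le ht hT₁ j)
  change t (j + 1) - s ∈ Icc 0 T₂
  exact ⟨by linarith [hs.2], by linarith [hs.1, ht.sub_le j]⟩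

lemma isSolutionPair_sampledArc (ht : IsSamplingSequence T₁ T₂ t) (hT₁ : 0 < T₁) :
    (P.errorSystem T₁ T₂ L 0).IsSolutionPair (samplingDomain t) (sampledArc P t z zhat θ)
      (sampledInput t w η) := by
  refine HybridSystem.isSolutionPair_of_isFlow (ht.isHybridTimeDomain hT₁.le)
    (h.isFlow_sampledArc ht hT₁.le) (Or.inl ?_) fun s j h₁ h₂ => ?_
  · change t (0 + 1) - 0 ∈ Icc 0 T₂
    simpa using ht.2.1
  · obtain rfl := eq_of_mem_samplingDomain_succ h₁ h₂
    refine ⟨sub_self _, t (j + 1 + 1) - t (j + 1), ht.2.2 (j + 1) j.succ_pos, ?_⟩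
    rw [errorSystem_resetMap, sampledInput_sample, lower_stack]
    simp only [sampledArc, stE_mkState, stZ_mkState, upper_stack, h.hold_eq_sample ht hT₁,
      sub_add_cancel_left]

lemma errNorm_eq (h₀ : t 0 = 0) (hs : s ∈ Icc (t j) (t (j + 1))) (hs' : t j < s ∨ j = 0) :
    errNorm P (z s) (zhat s) (θ s) = ‖stE (sampledArc P t z zhat θ s j)‖ := by
  rw [errNorm, h.hold_eq h₀ hs hs', sampledArc, stE_mkState]

lemma errNorm_zero_eq (ht : IsSamplingSequence T₁ T₂ t) :
    errNorm P (z 0) (zhat 0) (θ 0) = ‖stE (sampledArc P t z zhat θ 0 0)‖ :=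
  h.errNorm_eq ht.1 ⟨ht.1.le, ht.2.1.1⟩ (Or.inr rfl)

end IsTrajectory

lemma IsSamplingSequence.isInputBound_sampledInput (ht : IsSamplingSequence T₁ T₂ t) (hT₁ : 0 ≤ T₁)
    {W : ℝ} (hW : 0 ≤ W) (hw : ∀ᵐ s, 0 ≤ s → ‖w s‖ ≤ W) (hη : ∀ k : ℕ, 1 ≤ k → ‖η (t k)‖ ≤ W) :
    IsInputBound (samplingDomain t) (sampledInput t w η) W where
  nonneg := hW
  flow j := by
    filter_upwards [hw, ae_sampledInput_eq t w η j] with s hs hu hmem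
    have hslice : s ∈ slice (samplingDomain t) j := interior_subset hmem
    rw [hu, upper_stack]
    exact hs ((ht.nonneg hT₁ j).trans hslice.1)
  jump s j h₁ h₂ := by
    obtain rfl := eq_of_mem_samplingDomain_succ h₁ h₂
    rw [sampledInput_sample, lower_stack]
    exact hη (j + 1) j.succ_pos

namespace IsDissipative

variable {lamt γ δ : ℝ} {P₁ : Matrix (Fin nz) (Fin nz) ℝ} {P₂ : Matrix (Fin ny) (Fin ny) ℝ}
  (h : IsDissipative P T₁ T₂ lamt γ L P₁ P₂ δ)

include h

lemma exists_errNorm_le :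
    ∃ κ > 0, ∃ g > 0, ∀ (t : ℕ → ℝ) (w : ℝ → Vec nw) (η : ℝ → Vec ny) (z zhat : ℝ → Vec nz)
      (θ : ℝ → Vec ny), IsSamplingSequence T₁ T₂ t → IsTrajectory P L 0 t w η z zhat θ →
      ∀ W : ℝ, 0 ≤ W → (∀ᵐ s, 0 ≤ s → ‖w s‖ ≤ W) → (∀ k : ℕ, 1 ≤ k → ‖η (t k)‖ ≤ W) →
        ∀ s : ℝ, 0 ≤ s → errNorm P (z s) (zhat s) (θ s) ≤
          max (κ * Real.exp (-lamt * s) * errNorm P (z 0) (zhat 0) (θ 0)) (g * W) := by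
  obtain ⟨κ, hκ, g, hg, hle⟩ := h.exists_norm_stE_le
  refine ⟨κ, hκ, g, hg, fun t w η z zhat θ ht htraj W hW hw hη s hs => ?_⟩
  obtain ⟨j, hj, hj'⟩ := ht.exists_mem_Icc h.T₁_pos hs
  rw [htraj.errNorm_eq ht.1 hj hj', htraj.errNorm_zero_eq ht]
  exact hle _ _ _ W (htraj.isSolutionPair_sampledArc ht h.T₁_pos)
    (ht.isInputBound_sampledInput h.T₁_pos.le hW hw hη) s j hj

lemma exists_sampled_rate :
    ∃ κ : ℝ, 0 < κ ∧
      ∀ (t : ℕ → ℝ) (w : ℝ → Vec nw) (η : ℝ → Vec ny) (z zhat : ℝ → Vec nz) (θ : ℝ → Vec ny),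
        IsSamplingSequence T₁ T₂ t → IsTrajectory P L 0 t w η z zhat θ →
        (∀ s : ℝ, 0 ≤ s → w s = 0) → (∀ s : ℝ, 0 ≤ s → η s = 0) →
          ∀ s : ℝ, 0 ≤ s → errNorm P (z s) (zhat s) (θ s) ≤
            κ * Real.exp (-lamt * s) * errNorm P (z 0) (zhat 0) (θ 0) := by
  obtain ⟨κ, hκ, g, -, hle⟩ := h.exists_errNorm_le
  refine ⟨κ, hκ, fun t w η z zhat θ ht htraj hw hη s hs => ?_⟩
  have hs_le := hle t w η z zhat θ ht htraj 0 le_rfl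
    (ae_of_all _ fun r hr => by rw [hw r hr, norm_zero])
    (fun k _ => by rw [hη _ (ht.nonneg h.T₁_pos.le k), norm_zero]) s hs
  have hnonneg : 0 ≤ errNorm P (z 0) (zhat 0) (θ 0) := norm_nonneg _
  rwa [mul_zero, max_eq_left (by positivity)] at hs_le

lemma exists_sampled_bound :
    ∃ (κ : ℝ) (ρ : ℝ → ℝ), 0 < κ ∧ IsClassK ρ ∧
      ∀ (t : ℕ → ℝ) (w : ℝ → Vec nw) (η : ℝ → Vec ny) (z zhat : ℝ → Vec nz) (θ : ℝ → Vec ny),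
        IsSamplingSequence T₁ T₂ t → IsTrajectory P L 0 t w η z zhat θ →
        ∀ W : ℝ, 0 ≤ W → (∀ᵐ s, 0 ≤ s → ‖w s‖ ≤ W) → (∀ k : ℕ, 1 ≤ k → ‖η (t k)‖ ≤ W) →
          ∀ s : ℝ, 0 ≤ s → errNorm P (z s) (zhat s) (θ s) ≤
            max (κ * errNorm P (z 0) (zhat 0) (θ 0)) (ρ W) := by
  obtain ⟨κ, hκ, g, hg, hle⟩ := h.exists_errNorm_le
  refine ⟨κ, fun W => g * W, hκ, isClassK_const_mul hg,
    fun t w η z zhat θ ht htraj W hW hw hη s hs => ?_⟩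
  have hexp : Real.exp (-lamt * s) ≤ 1 := by
    rw [Real.exp_le_one_iff, neg_mul, neg_nonpos]
    exact mul_nonneg h.lamt_pos.le hs
  refine (hle t w η z zhat θ ht htraj W hW hw hη s hs).trans (max_le_max_right _ ?_)
  exact mul_le_mul_of_nonneg_right (mul_le_of_le_one_right hκ.le hexp) (norm_nonneg _)

lemma exists_sampled_gain :
    ∃ α : ℝ, 0 < α ∧
      ∀ (t : ℕ → ℝ) (w : ℝ → Vec nw) (η : ℝ → Vec ny) (z zhat : ℝ → Vec nz) (θ : ℝ → Vec ny),
        IsSamplingSequence T₁ T₂ t → IsTrajectory P L 0 t w η z zhat θ →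
        (∀ s : ℝ, 0 ≤ s → η s = 0) →
          (∫⁻ s in Ici (0 : ℝ), ‖mv P.Cp (z s - zhat s)‖ₑ ^ 2) ^ (1 / 2 : ℝ) ≤
            ENNReal.ofReal (α * errNorm P (z 0) (zhat 0) (θ 0)) +
              ENNReal.ofReal γ * (∫⁻ s in Ici (0 : ℝ), ‖w s‖ₑ ^ 2) ^ (1 / 2 : ℝ) := by
  obtain ⟨α, hα, hle⟩ := h.exists_gain
  refine ⟨α, hα, fun t w η z zhat θ ht htraj hη => ?_⟩
  have hsol := htraj.isSolutionPair_sampledArc ht h.T₁_pos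
  have hgain := hle _ _ _ hsol fun ⟨s, j⟩ hs => by
    simp only [sampledInput]
    split_ifs
    · rw [lower_stack, hη s ((ht.nonneg h.T₁_pos.le j).trans hs.1)]
    · rw [lower_stack]
  rw [h.infDist_attractor_eq hsol hsol.domain.zero_mem, ← htraj.errNorm_zero_eq ht,
    ht.timeProj_samplingDomain h.T₁_pos] at hgain
  refine hgain.trans ?_
  gcongr with s
  simp only [sampledInput]
  split_ifs <;> simp

end IsDissipative

end Trajectory

lemma IsDissipative.solvesProblem {nz ny nw nq ns np : ℕ} {P : Plant nz ny nw nq ns np}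
    {T₁ T₂ lamt γ δ : ℝ} {L : Matrix (Fin nz) (Fin ny) ℝ} {P₁ : Matrix (Fin nz) (Fin nz) ℝ}
    {P₂ : Matrix (Fin ny) (Fin ny) ℝ} (h : IsDissipative P T₁ T₂ lamt γ L P₁ P₂ δ) {K : NNReal}
    (hψ : LipschitzWith K P.ψ) : SolvesProblem P T₁ T₂ lamt γ L 0 where
  eiss := ⟨h.exists_iss, fun _ _ _ => isCompleteDomain_of_isMaximal hψ h.T₁_pos.le h.T₁_le⟩
  rate := h.exists_infDist_le
  gain := h.exists_gain
  sampled_rate := h.exists_sampled_rate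
  sampled_bounded := h.exists_sampled_bound
  sampled_gain := h.exists_sampled_gain

end SporadicObserver

end

theorem proposition5 {nz ny nw nq ns np : ℕ} (P : SporadicObserver.Plant nz ny nw nq ns np)
    (ℓ T₁ T₂ lamt γ : ℝ) (hℓ : 0 < ℓ)
    (hψ : ∀ v₁ v₂ : SporadicObserver.Vec nq, ‖P.ψ v₁ - P.ψ v₂‖ ≤ ℓ * ‖v₁ - v₂‖)
    (hT₁ : 0 < T₁) (hT : T₁ ≤ T₂) (hlamt : 0 < lamt) (hγ : 0 < γ)
    (P₁ : Matrix (Fin nz) (Fin nz) ℝ) (P₂ : Matrix (Fin ny) (Fin ny) ℝ)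
    (hP₁ : P₁.PosDef) (hP₂ : P₂.PosDef) (δ χ : ℝ) (hδ : 0 < δ) (hχ : 0 < χ)
    (X : Matrix (Fin nz) (Fin nz) ℝ) (hX : IsUnit X)
    (X₅ Y₅ X₇ Y₇ : Matrix (Fin ny) (Fin nz) ℝ) (X₆ Y₆ X₈ Y₈ : Matrix (Fin ny) (Fin ny) ℝ)
    (J : Matrix (Fin nz) (Fin ny) ℝ)
    (hLMI₀ : SporadicObserver.NegDef
      (SporadicObserver.lmiZOH P ℓ lamt γ P₁ P₂ δ χ X J X₅ X₆ X₇ X₈ 0))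
    (hLMI₂ : SporadicObserver.NegDef
      (SporadicObserver.lmiZOH P ℓ lamt γ P₁ P₂ δ χ X J Y₅ Y₆ Y₇ Y₈ T₂)) :
    SporadicObserver.SolvesProblem P T₁ T₂ lamt γ ((Xᵀ)⁻¹ * J) 0 := by
  set L := (Xᵀ)⁻¹ * J
  have hJ : Xᵀ * L = J :=
    Matrix.mul_nonsing_inv_cancel_left _ _
      (by rw [Matrix.det_transpose]; exact (Matrix.isUnit_iff_isUnit_det X).1 hX)
  rw [← hJ] at hLMI₀ hLMI₂
  have hdiss₀ := SporadicObserver.isDissipativeAt_of_negDef_lmiZOH hψ hχ.le hLMI₀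
  have hdiss₂ := SporadicObserver.isDissipativeAt_of_negDef_lmiZOH hψ hχ.le hLMI₂
  have hdiss : SporadicObserver.IsDissipative P T₁ T₂ lamt γ L P₁ P₂ δ :=
    { T₁_pos := hT₁
      T₁_le := hT
      lamt_pos := hlamt
      γ_pos := hγ
      δ_pos := hδ
      posDef₁ := hP₁
      posDef₂ := hP₂
      dissipativeAt := fun τ hτ => hdiss₀.of_mem_Icc hdiss₂ hδ.le hτ }
  have hlip : LipschitzWith ℓ.toNNReal P.ψ := LipschitzWith.of_dist_le_mul fun v₁ v₂ => by
    simpa only [dist_eq_norm, Real.coe_toNNReal _ hℓ.le] using hψ v₁ v₂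
  exact hdiss.solvesProblem hlip
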